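/- **Conventions.** A function $g:\mathbb N\to\mathbb R_{\ge 0}$ is negligible if $g(n)=n^{-\omega(1)}$. PPT means probabilistic polynomial-time Turing machine; an efficient non-uniform algorithm is a PPT algorithm with polynomially long advice. For $x\in\{0,1\}^n$ and real $r$, $B_r(x)$ is the set of $z\in\{0,1\}^n$ at Hamming distance at most $r$ from $x$. $\mathsf{RR}_\varepsilon(x)$ is the random string that keeps each bit of $x$ independently with probability $\frac{e^\varepsilon}{1+e^\varepsilon}$ and flips it otherwise. **Hash functions.** Let $H=\{H_n:\{0,1\}^n\to\{0,1\}^{\gamma(n)}\}_{n}$ be a sequence of functions that is computable in uniform polynomial time and multi-collision resistant in the following sense: for every constant $c_1>0$ there is a constant $c_2>0$ such that, for every PPT algorithm $\mathcal A$ and every sequence of advice strings $z_n$ with $|z_n|=\lceil n^{c_1}\rceil$, the probability that $\mathcal A(1^n;z_n)$ outputs $K_n=\lceil n^{c_2}\rceil$ distinct strings $Y_1,\dots,Y_{K_n}\in\{0,1\}^n$ with $H_n(Y_1)=\dots=H_n(Y_{K_n})$ is at most a negligible function of $n$. (Nothing is assumed about $\gamma$; in particular $\gamma(n)=o(\log^2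 n)$ is allowed.) **Samplers.** Let $\mathcal C=\{\mathcal C_n\}$ be a collection of circuits with $n$ input bits. An efficient deterministic non-uniform algorithm $\mathsf{Sampler}=\{\mathsf{Sampler}_n\}$, which maps a random seed $\theta$ to a pair of circuits, is a *public-coin differing-inputs sampler* for $\mathcal C$ if its output lies in $\mathcal C_n\times\mathcal C_n$ and for every efficient non-uniform algorithm $\mathcal A=\{\mathcal A_n\}$ there is a negligible function $\mathrm{negl}$ such that for all $n$ $$\Pr_\theta\bigl[C_0(y)\ne C_1(y)\;:\;(C_0,C_1)\gets\mathsf{Sampler}_n(\theta),\ y\gets\mathcal A_n(\theta)\bigr]\le \mathrm{negl}(n),$$ where the probability is also over the coins of $\mathcal A_n$. **Statement.** Let $\varepsilon>0$ be a constant, $r=0.5\,n^{0.9}$ and $\tilde r=\frac{n}{1+e^\varepsilon}+n^{0.6}$. Let $\upsilon_n\in\{0,1\}^{\gamma(n)}$ and $x_n,x_n'\in\{0,1\}^n$ be arbitrary sequences with $x_n,x'_n$ at Hamming distance $1$ for all $n\ge1$. Consider $\mathsf{LDS}\text{-}\mathsf{Sampler}_n$: on a seed $\theta\sim\mathsf{RR}_\varepsilon(0^n)$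 it puts $\tilde x=x_n\oplus\theta$ and outputs $(C_0,C_1)$, where $C_0$ is a Boolean circuit computing the indicator function of $B_r(x_n)\cap B_{\tilde r}(\tilde x)\cap H_n^{-1}(\upsilon_n)$ and $C_1$ one computing the indicator function of $B_r(x_n')\cap B_{\tilde r}(\tilde x)\cap H_n^{-1}(\upsilon_n)$. Then this sampler has an efficient (deterministic, non-uniform) implementation, and every such implementation is a public-coin differing-inputs sampler for the collection of circuits that compute the indicator function of a set $B_r(a)\cap B_{\tilde r}(b)\cap H_n^{-1}(\upsilon_n)$ with $a,b\in\{0,1\}^n$. -/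

import Mathlib

namespace LDS

/-! ### Polynomial-time computation -/

/-- A tuple of bit strings written on a tape over the alphabet `{0, 1, #}`: every string is
followed by the separator `# = none`. -/
def encodeStrings (l : List (List Bool)) : List (Option Bool) :=
  l.flatMap fun w => w.map some ++ [none]

/-- `f`, from tuples of bit strings to tuples of bit strings, is computed by a (deterministic,
multi-stack) Turing machine within a number of steps polynomial in the length of the input. -/
def PolyTime (f : List (List Bool) → List (List Bool)) : Prop :=
  Nonempty (Turing.TM2ComputableInPolyTime encodeStrings encodeStrings f)

/-- A vector of bits as a bit string. -/
def bits {n : ℕ} (x : Fin n → Bool) : List Bool := List.ofFn x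

/-- The unary string `1ⁿ`. -/
def ones (n : ℕ) : List Bool := List.replicate n true

/-- Advice strings of length polynomial in the security parameter. -/
def PolyLength (a : ℕ → List Bool) : Prop :=
  ∃ p : Polynomial ℕ, ∀ n, (a n).length ≤ p.eval n

/-- The probability of `E` over `m` independent fair coins. -/
noncomputable def coinProb (m : ℕ) (E : (Fin m → Bool) → Prop) : ℝ :=
  ({ρ : Fin m → Bool | E ρ}.ncard : ℝ) / 2 ^ m

/-- `g` is nonnegative and `g n = n ^ (-ω(1))`. -/
def Negligible (g : ℕ → ℝ) : Prop :=
  (∀ n, 0 ≤ g n) ∧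
    Asymptotics.SuperpolynomialDecay Filter.atTop (fun n : ℕ => (n : ℝ)) g

/-- A probabilistic polynomial-time algorithm: a polynomial-time machine that receives, as the last
component of its input, polynomially many fair coins. -/
structure PPT where
  /-- the function computed from the input and the coins -/
  run : List (List Bool) → List (List Bool)
  /-- it runs in polynomial time -/
  polyTime : PolyTime run
  /-- the number of coins, as a function of the security parameter -/
  coins : Polynomial ℕ

/-- An efficient non-uniform algorithm: a probabilistic polynomial-time algorithm with advice of
polynomial length. -/
structure NonuniformPPT extends PPT where
  /-- the advice for each security parameter -/
  advice : ℕ → List Bool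
  /-- it has polynomial length -/
  polyLength : PolyLength advice

/-! ### Boolean circuits -/

/-- A gate of a circuit with `n` input bits; `not`, `and`, `or` refer to earlier gates by their
position. -/
inductive Gate (n : ℕ) where
  | const (b : Bool)
  | input (i : Fin n)
  | not (j : ℕ)
  | and (j k : ℕ)
  | or (j k : ℕ)

namespace Gate

variable {n : ℕ}

/-- The positions a gate refers to. -/
def refs : Gate n → List ℕ
  | const _ => []
  | input _ => []
  | not j => [j]
  | and j k => [j, k]
  | or j k => [j, k]

/-- The value of a gate on input `z`, where `w` lists the values of the preceding gates. -/
def eval (z : Fin n → Bool) (w : List Bool) : Gate n → Bool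
  | const b => b
  | input i => z i
  | not j => !(w.getD j false)
  | and j k => w.getD j false && w.getD k false
  | or j k => w.getD j false || w.getD k false

/-- A self-delimiting unary code for a number. -/
def unary (j : ℕ) : List Bool := List.replicate j true ++ [false]

/-- A self-delimiting code for a gate: a three-bit tag and the arguments. -/
def code : Gate n → List Bool
  | const b => [false, false, b]
  | input i => [false, true, false] ++ unary i
  | not j => [false, true, true] ++ unary j
  | and j k => [true, false, false] ++ unary j ++ unary k
  | or j k => [true, false, true] ++ unary j ++ unary k

end Gate

/-- A Boolean circuit with `n` input bits and one output bit: a nonempty list of gates in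
topological order, the last of which is the output. -/
structure Circuit (n : ℕ) where
  /-- the gates -/
  gates : List (Gate n)
  /-- every gate refers to earlier gates only -/
  wf : ∀ (i : ℕ) (h : i < gates.length), ∀ j ∈ gates[i].refs, j < i
  /-- there is an output gate -/
  ne_nil : gates ≠ []

namespace Circuit

variable {n : ℕ}

/-- The values of all gates on input `z`. -/
def values (C : Circuit n) (z : Fin n → Bool) : List Bool :=
  C.gates.foldl (fun w g => w ++ [g.eval z w]) []

/-- The output of the circuit on input `z`. -/
def eval (C : Circuit n) (z : Fin n → Bool) : Bool :=
  (C.values z).getLastD false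

/-- The description of a circuit as a bit string. -/
def code (C : Circuit n) : List Bool := C.gates.flatMap Gate.code

end Circuit

/-! ### Keyless hash functions -/

section Hash

variable {γ : ℕ → ℕ}

/-- The sequence `H n : {0,1}ⁿ → {0,1}^γ(n)` is computable in (uniform) polynomial time. -/
def EfficientlyComputable (H : ∀ n, (Fin n → Bool) → (Fin (γ n) → Bool)) : Prop :=
  ∃ f, PolyTime f ∧ ∀ (n : ℕ) (y : Fin n → Bool), f [bits y] = [bits (H n y)]

/-- The strings in `out` are `K` distinct `n`-bit strings with the same hash value. -/
def IsMultiCollision (H : ∀ n, (Fin n → Bool) → (Fin (γ n) → Bool)) (n K : ℕ)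
    (out : List (List Bool)) : Prop :=
  ∃ Y : Fin K → (Fin n → Bool), out = List.ofFn (fun i => bits (Y i)) ∧
    Function.Injective Y ∧ ∀ i j, H n (Y i) = H n (Y j)

/-- `H` is `K`-collision resistant for advice length `ζ`: no uniform probabilistic polynomial-time
algorithm that is given `1ⁿ` and an advice string of length `ζ n` outputs `K n` distinct strings
with the same hash value, except with negligible probability. -/
def CollisionResistant (H : ∀ n, (Fin n → Bool) → (Fin (γ n) → Bool)) (K ζ : ℕ → ℕ) : Prop :=
  ∀ (A : PPT) (z : ℕ → List Bool), (∀ n, (z n).length = ζ n) →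
    ∃ negl, Negligible negl ∧ ∀ n,
      coinProb (A.coins.eval n)
        (fun ρ => IsMultiCollision H n (K n) (A.run [ones n, z n, bits ρ])) ≤ negl n

/-- `H` is an efficiently computable sequence of multi-collision-resistant keyless hash functions:
for every advice length `n ^ c₁` there is `c₂` such that it is `n ^ c₂`-collision resistant. -/
def IsCRKHF (H : ∀ n, (Fin n → Bool) → (Fin (γ n) → Bool)) : Prop :=
  EfficientlyComputable H ∧
    ∀ c₁ : ℝ, 0 < c₁ → ∃ c₂ : ℝ, 0 < c₂ ∧
      CollisionResistant H (fun n => ⌈(n : ℝ) ^ c₂⌉₊) (fun n => ⌈(n : ℝ) ^ c₁⌉₊)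

end Hash

/-! ### Public-coin differing-inputs samplers -/

/-- A deterministic map that turns a seed of `ℓ n` bits into a pair of circuits. -/
abbrev Sampler (ℓ : ℕ → ℕ) : Type := ∀ n, (Fin (ℓ n) → Bool) → Circuit n × Circuit n

/-- The sampler is computed by a deterministic polynomial-time algorithm with advice of polynomial
length. -/
def Sampler.Efficient {ℓ : ℕ → ℕ} (S : Sampler ℓ) : Prop :=
  ∃ (f : List (List Bool) → List (List Bool)) (a : ℕ → List Bool), PolyTime f ∧ PolyLength a ∧
    ∀ (n : ℕ) (θ : Fin (ℓ n) → Bool),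
      f [ones n, a n, bits θ] = [(S n θ).1.code, (S n θ).2.code]

/-- The probability, over a seed `θ` with distribution `D` and over the coins of `A`, that `A`
on input `θ` outputs a `y` in `{0,1}ⁿ` on which the two circuits sampled with `θ` differ. -/
noncomputable def differProb {ℓ : ℕ → ℕ} (S : Sampler ℓ) (n : ℕ)
    (D : PMF (Fin (ℓ n) → Bool)) (A : NonuniformPPT) : ℝ :=
  ∑ θ : Fin (ℓ n) → Bool, (D θ).toReal *
    coinProb (A.coins.eval n) (fun ρ => ∃ y : Fin n → Bool,
      A.run [ones n, A.advice n, bits θ, bits ρ] = [bits y] ∧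
        (S n θ).1.eval y ≠ (S n θ).2.eval y)

/-- `S`, with seeds distributed according to `D`, is a public-coin differing-inputs sampler for the
collection `𝒞` of circuits. -/
def IsPublicCoinDISampler {ℓ : ℕ → ℕ} (D : ∀ n, PMF (Fin (ℓ n) → Bool))
    (𝒞 : ∀ n, Set (Circuit n)) (S : Sampler ℓ) : Prop :=
  S.Efficient ∧
  (∀ n, ∀ θ ∈ (D n).support, (S n θ).1 ∈ 𝒞 n ∧ (S n θ).2 ∈ 𝒞 n) ∧
  ∀ A : NonuniformPPT, ∃ negl, Negligible negl ∧ ∀ n, differProb S n (D n) A ≤ negl n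

/-! ### The low-diameter-set sampler -/

/-- The probability that randomized response turns the bit `a` into the bit `b`. -/
noncomputable def rrBit (ε : ℝ) (a b : Bool) : ENNReal :=
  ENNReal.ofReal (if b = a then Real.exp ε / (1 + Real.exp ε) else 1 / (1 + Real.exp ε))

theorem sum_rrBit (ε : ℝ) (a : Bool) : ∑ b, rrBit ε a b = 1 := by
  have h : (0 : ℝ) < 1 + Real.exp ε := by positivity
  have h2 : Real.exp ε / (1 + Real.exp ε) + 1 / (1 + Real.exp ε) = 1 := by
    field_simp
    ring
  have h1 : ENNReal.ofReal (Real.exp ε / (1 + Real.exp ε)) +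
      ENNReal.ofReal (1 / (1 + Real.exp ε)) = 1 := by
    rw [← ENNReal.ofReal_add (by positivity) (by positivity), h2, ENNReal.ofReal_one]
  cases a
  · simpa [rrBit, add_comm] using h1
  · simpa [rrBit] using h1

/-- Randomized response: every bit of `x` is kept with probability `e^ε / (1 + e^ε)` and flipped
otherwise, independently. -/
noncomputable def randomizedResponse (ε : ℝ) {n : ℕ} (x : Fin n → Bool) : PMF (Fin n → Bool) :=
  PMF.ofFintype (fun y => ∏ i, rrBit ε (x i) (y i)) (by
    rw [← Fintype.prod_sum]
    exact Finset.prod_eq_one fun i _ => sum_rrBit ε (x i))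

/-- The Hamming ball of radius `r` around `x`. -/
def ball {n : ℕ} (x : Fin n → Bool) (r : ℝ) : Set (Fin n → Bool) :=
  {z | (hammingDist x z : ℝ) ≤ r}

/-- Bit-wise XOR. -/
def xorBits {n : ℕ} (x θ : Fin n → Bool) : Fin n → Bool := fun i => xor (x i) (θ i)

/-- The circuit `C` computes the indicator function of `B`. -/
def Circuit.Recognizes {n : ℕ} (C : Circuit n) (B : Set (Fin n → Bool)) : Prop :=
  ∀ z, C.eval z = true ↔ z ∈ B

section LDSSampler

variable {γ : ℕ → ℕ} (H : ∀ n, (Fin n → Bool) → (Fin (γ n) → Bool))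
  (υ : ∀ n, Fin (γ n) → Bool) (r r' : ℕ → ℝ)

/-- The set `B_r(x) ∩ B_r'(x') ∩ H⁻¹(υ)`. -/
def ldsSet (n : ℕ) (x x' : Fin n → Bool) : Set (Fin n → Bool) :=
  ball x (r n) ∩ ball x' (r' n) ∩ H n ⁻¹' {υ n}

/-- The circuits that compute the indicator function of such a set, for some centers. -/
def ldsCircuits (n : ℕ) : Set (Circuit n) :=
  {C | ∃ x x', C.Recognizes (ldsSet H υ r r' n x x')}

/-- `S` implements the sampler: on the seed `θ` it puts `x̃ = x ⊕ θ` and returns a circuit for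
`B_r(x) ∩ B_r'(x̃) ∩ H⁻¹(υ)` and a circuit for `B_r(x') ∩ B_r'(x̃) ∩ H⁻¹(υ)`. -/
def IsLDSSampler (x x' : ∀ n, Fin n → Bool) (S : Sampler fun n => n) : Prop :=
  ∀ (n : ℕ) (θ : Fin n → Bool),
    (S n θ).1.Recognizes (ldsSet H υ r r' n (x n) (xorBits (x n) θ)) ∧
    (S n θ).2.Recognizes (ldsSet H υ r r' n (x' n) (xorBits (x n) θ))

end LDSSampler

end LDS

/-! Why it is true. Write `p = 1 / (1 + e^ε) < 1/2`. The centers `x`, `x'` are at distance 1, so a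
point on which the two circuits differ is at distance at least `r - 1` from `x`; it also lies within
`r̃` of `x̃ = x ⊕ θ` and hashes to `υ`. A fixed point `c` at distance at least `r - 1` from `x` has
expected distance at least `p n + (1 - 2p)(r - 1)` from `x̃`, which exceeds `r̃ = p n + n^0.6` by
order `n^0.9`. A Chernoff bound (`sum_flipProb_ball_le` with parameter `n^(-0.3)`) shows that `c` is
eligible with probability at most about `exp(-n^0.5)`, so no single string is a likely winning
output (`uprob_trialOutput_le`). An adversary that wins infinitely often with probability at least
`n^(-k)` therefore yields, when rerun on fresh seeds, ever new preimages of `υ`: any polynomial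
number `K` of them in polynomial time (`le_uprob_select_injective`), against multi-collision
resistance.

The order of quantifiers in the hardness assumption is the delicate point. The advice length `n^c₁`
is fixed first, and only then does `c₂`, hence `K`, become known; moreover the collision finder must
be a uniform machine. Its advice is a straight-line program for one block of trials, together with a
binary counter of `n` digits that makes a universal evaluator repeat the program `K` times. The
length of this advice does not depend on `K` (`le_coinProb_isMultiCollision`). The evaluator is
implemented as an explicit polynomial-time machine (`exists_polyTime_evaluate`).

The adversary and the hash function enter such a program as circuits, obtained from their machines
by the tableau construction (`PolyTime.exists_comp`). Seeds of randomized response are simulated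
from fair coins by comparators with dyadic bias, at the price of a factor 2
(`approximates_of_uprob_eq`).

The sampler is efficient because its two circuits can be written with `θ` hardwired into a fixed
template (`Comp.exists_circuit`); the same evaluator prints that template
(`exists_efficient_sampler`). -/

namespace LDS

/-! ### Gate complexity of families of Boolean functions -/

/-- `Gates B l`: the functions in `l` (newest first) are obtained one after the other from the
functions in `B` by constants, negation and conjunction. -/
inductive Gates {X : Type} (B : Set (X → Bool)) : List (X → Bool) → Prop
  | nil : Gates B []
  | const (b : Bool) {l : List (X → Bool)} : Gates B l → Gates B ((fun _ => b) :: l)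
  | not {l : List (X → Bool)} {φ : X → Bool} :
      Gates B l → (φ ∈ B ∨ φ ∈ l) → Gates B ((fun x => !φ x) :: l)
  | and {l : List (X → Bool)} {φ ψ : X → Bool} :
      Gates B l → (φ ∈ B ∨ φ ∈ l) → (ψ ∈ B ∨ ψ ∈ l) → Gates B ((fun x => φ x && ψ x) :: l)

/-- All functions in `T` are computed from the functions in `B` by `c` gates. -/
def Comp {X : Type} (B : Set (X → Bool)) (c : ℕ) (T : Set (X → Bool)) : Prop :=
  ∃ l, Gates B l ∧ l.length ≤ c ∧ ∀ φ ∈ T, φ ∈ B ∨ φ ∈ l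

section Comp

variable {X : Type} {B B' T U : Set (X → Bool)} {c d : ℕ}

/-- Sequential composition: every wire of `T` used by the second computation is already available in
`B` or in `l`. Since `l` is shared, costs add. -/
theorem Gates.append {l l' : List (X → Bool)} (hl : Gates B l) (hl' : Gates T l')
    (h : ∀ φ ∈ T, φ ∈ B ∨ φ ∈ l) : Gates B (l' ++ l) := by
  have key : ∀ {φ : X → Bool} {l'' : List (X → Bool)}, (φ ∈ T ∨ φ ∈ l'') →
      (φ ∈ B ∨ φ ∈ l'' ++ l) := by
    intro φ l'' hφ
    rcases hφ with hφ | hφ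
    · rcases h φ hφ with h | h
      · exact Or.inl h
      · exact Or.inr (List.mem_append_right _ h)
    · exact Or.inr (List.mem_append_left _ hφ)
  induction hl' with
  | nil => simpa using hl
  | const b _ ih => exact ih.const b
  | not _ h1 ih => exact ih.not (key h1)
  | and _ h1 h2 ih => exact ih.and (key h1) (key h2)

/-- Wires are functions on the whole input space, so substituting `g` for the input preserves the
number of gates. This is how a circuit is placed inside a larger one. -/
theorem Gates.comap {Y : Type} {l : List (X → Bool)} (hl : Gates B l) (g : Y → X)
    {B' : Set (Y → Bool)} (hB : ∀ φ ∈ B, φ ∘ g ∈ B') : Gates B' (l.map (· ∘ g)) := by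
  have key : ∀ {φ : X → Bool} {l : List (X → Bool)}, (φ ∈ B ∨ φ ∈ l) →
      (φ ∘ g ∈ B' ∨ φ ∘ g ∈ l.map (· ∘ g)) := fun {φ l} h =>
    h.imp (hB φ) fun h => List.mem_map_of_mem h
  induction hl with
  | nil => exact .nil
  | const b _ ih => exact ih.const b
  | not _ h1 ih => exact ih.not (key h1)
  | and _ h1 h2 ih => exact ih.and (key h1) (key h2)

theorem Comp.trans (h : Comp B c T) (h' : Comp T d U) : Comp B (c + d) U := by
  obtain ⟨l, hl, hc, hT⟩ := h
  obtain ⟨l', hl', hd, hU⟩ := h'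
  refine ⟨l' ++ l, hl.append hl' hT, by simp; omega, fun φ hφ => ?_⟩
  rcases hU φ hφ with h | h
  · exact (hT φ h).imp_right fun h => List.mem_append_right _ h
  · exact Or.inr (List.mem_append_left _ h)

theorem Comp.of_subset (h : T ⊆ B) : Comp B 0 T :=
  ⟨[], .nil, by simp, fun _ hφ => Or.inl (h hφ)⟩

theorem Comp.mono (h : Comp B c T) (hB : B ⊆ B') (hc : c ≤ d) (hU : U ⊆ T) : Comp B' d U := by
  have h1 := ((Comp.of_subset hB).trans h).trans (Comp.of_subset hU)
  obtain ⟨l, hl, h2, h3⟩ := h1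
  exact ⟨l, hl, by omega, h3⟩

theorem Comp.union (h : Comp B c T) (h' : Comp B d U) : Comp B (c + d) (T ∪ U) := by
  obtain ⟨l, hl, hc, hT⟩ := h
  obtain ⟨l', hl', hd, hU⟩ := h'
  refine ⟨l' ++ l, hl.append hl' fun φ hφ => Or.inl hφ, by simp; omega, ?_⟩
  rintro φ (hφ | hφ)
  · exact (hT φ hφ).imp_right fun h => List.mem_append_right _ h
  · exact (hU φ hφ).imp_right fun h => List.mem_append_left _ h

theorem Comp.range {ι : Type} [Fintype ι] {φ : ι → X → Bool} (h : ∀ i, Comp B c {φ i}) :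
    Comp B (Fintype.card ι * c) (Set.range φ) := by
  classical
  suffices H : ∀ s : Finset ι, Comp B (s.card * c) (φ '' s) by
    simpa using H Finset.univ
  intro s
  induction s using Finset.induction_on with
  | empty => simpa using Comp.of_subset (Set.empty_subset B)
  | insert i s hi ih =>
    refine ((h i).union ih).mono subset_rfl (le_of_eq ?_) (by
      rw [Finset.coe_insert, Set.image_insert_eq, Set.insert_eq])
    rw [Finset.card_insert_of_notMem hi]
    ring

theorem Comp.mem {φ : X → Bool} (h : φ ∈ B) : Comp B 0 {φ} :=
  .of_subset (by simpa using h)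

theorem Comp.const (b : Bool) : Comp B 1 {fun _ => b} :=
  ⟨[fun _ => b], .const b .nil, by simp, by simp⟩

theorem Comp.not {φ : X → Bool} (h : Comp B c {φ}) : Comp B (c + 1) {fun x => !φ x} :=
  h.trans ⟨[_], .not .nil (Or.inl rfl), by simp, by simp⟩

theorem Comp.and {φ ψ : X → Bool} (h : Comp B c {φ}) (h' : Comp B d {ψ}) :
    Comp B (c + d + 1) {fun x => φ x && ψ x} :=
  (h.union h').trans ⟨[_], .and .nil (Or.inl (Or.inl rfl)) (Or.inl (Or.inr rfl)), by simp, by simp⟩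

theorem Comp.or {φ ψ : X → Bool} (h : Comp B c {φ}) (h' : Comp B d {ψ}) :
    Comp B (c + d + 4) {fun x => φ x || ψ x} := by
  refine ((h.not.and h'.not).not).mono subset_rfl (by omega) ?_
  simp

theorem Comp.ite {φ ψ χ : X → Bool} {e : ℕ} (h : Comp B c {φ}) (h1 : Comp B d {ψ})
    (h0 : Comp B e {χ}) : Comp B (2 * c + d + e + 7) {fun x => if φ x then ψ x else χ x} := by
  refine ((h.and h1).or (h.not.and h0)).mono subset_rfl (by omega) ?_
  simp only [Set.singleton_subset_iff, Set.mem_singleton_iff]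
  funext x
  cases φ x <;> simp

theorem Comp.xor {φ ψ : X → Bool} (h : Comp B c {φ}) (h' : Comp B d {ψ}) :
    Comp B (2 * c + 2 * d + 8) {fun x => Bool.xor (φ x) (ψ x)} := by
  refine (Comp.ite h h'.not h').mono subset_rfl (by omega) ?_
  simp only [Set.singleton_subset_iff, Set.mem_singleton_iff]
  funext x
  cases φ x <;> simp

theorem Comp.forall {ι : Type} [Fintype ι] {φ : ι → X → Bool} (h : ∀ i, Comp B c {φ i}) :
    Comp B (Fintype.card ι * (c + 1) + 1) {fun x => decide (∀ i, φ i x = true)} := by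
  classical
  suffices H : ∀ s : Finset ι,
      Comp B (s.card * (c + 1) + 1) {fun x => decide (∀ i ∈ s, φ i x = true)} by
    simpa using H Finset.univ
  intro s
  induction s using Finset.induction_on with
  | empty => simpa using Comp.const true
  | insert i s hi ih =>
    refine ((h i).and ih).mono subset_rfl (le_of_eq ?_) ?_
    · rw [Finset.card_insert_of_notMem hi]
      ring
    · simp only [Set.singleton_subset_iff, Set.mem_singleton_iff]
      funext x
      simp

theorem Comp.comap {Y : Type} (h : Comp B c T) (g : Y → X) {B' : Set (Y → Bool)}
    (hB : ∀ φ ∈ B, φ ∘ g ∈ B') : Comp B' c ((· ∘ g) '' T) := by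
  obtain ⟨l, hl, hc, hT⟩ := h
  refine ⟨_, hl.comap g hB, by simpa using hc, ?_⟩
  rintro _ ⟨φ, hφ, rfl⟩
  exact (hT φ hφ).imp (hB φ) fun h => List.mem_map_of_mem h

/-- The number of gates that suffice for every function of `d` bits. -/
def localCost (d : ℕ) : ℕ := 8 * (2 ^ d - 1) + 2 ^ d

theorem localCost_succ (d : ℕ) : localCost (d + 1) = 2 * localCost d + 8 := by
  have := Nat.one_le_two_pow (n := d)
  simp only [localCost, pow_succ]
  omega

/-- Shannon expansion along the first wire: `φ` is a multiplexer of two functions of the remaining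
wires, which gives the recursion `localCost_succ`. -/
theorem Comp.of_dependsOn_list (W : List (X → Bool)) (hW : ∀ w ∈ W, w ∈ B) (φ : X → Bool)
    (h : ∀ x x', (∀ w ∈ W, w x = w x') → φ x = φ x') : Comp B (localCost W.length) {φ} := by
  classical
  induction W generalizing φ with
  | nil =>
    have h' : ∀ x x', φ x = φ x' := fun x x' => h x x' (by simp)
    rcases isEmpty_or_nonempty X with hX | ⟨⟨x0⟩⟩
    · refine (Comp.const true).mono subset_rfl (by simp [localCost]) ?_
      simp only [Set.singleton_subset_iff, Set.mem_singleton_iff]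
      exact funext fun x => isEmptyElim x
    · refine (Comp.const (φ x0)).mono subset_rfl (by simp [localCost]) ?_
      simp only [Set.singleton_subset_iff, Set.mem_singleton_iff]
      exact funext fun x => h' x x0
  | cons w W ih =>
    -- The cofactor of `φ` at `w = b`. The existential is needed because the values of `W` at `x`
    -- together with `w = b` need not be attained in `X`; the cofactor is then `false`, which does
    -- no harm.
    let ψ : Bool → X → Bool := fun b x =>
      decide (∃ x', w x' = b ∧ (∀ w' ∈ W, w' x' = w' x) ∧ φ x' = true)
    have hψ : ∀ b, Comp B (localCost W.length) {ψ b} := by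
      intro b
      refine ih (fun w' hw' => hW _ (List.mem_cons_of_mem _ hw')) _ fun x x' hx => ?_
      have : ∀ x'', (∀ w' ∈ W, w' x'' = w' x) ↔ (∀ w' ∈ W, w' x'' = w' x') :=
        fun x'' => forall₂_congr fun w' hw' => by rw [hx w' hw']
      simp only [ψ, this]
    refine (Comp.ite (.mem (hW w (by simp))) (hψ true) (hψ false)).mono subset_rfl ?_ ?_
    · rw [List.length_cons, localCost_succ]; omega
    · simp only [Set.singleton_subset_iff, Set.mem_singleton_iff]
      funext x
      have key : φ x = ψ (w x) x := by
        rw [Bool.eq_iff_iff]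
        simp only [ψ, decide_eq_true_eq]
        refine ⟨fun hx => ⟨x, rfl, fun _ _ => rfl, hx⟩, ?_⟩
        rintro ⟨x', h1, h2, h3⟩
        rw [← h3]
        refine h _ _ fun w' hw' => ?_
        rcases List.mem_cons.1 hw' with rfl | hw'
        · exact h1.symm
        · exact (h2 w' hw').symm
      rw [key]
      cases w x <;> simp

/-- A function that is determined by finitely many given ones. -/
theorem Comp.of_dependsOn {ι : Type} [Fintype ι] (w : ι → X → Bool) (hw : ∀ i, w i ∈ B)
    (φ : X → Bool) (h : ∀ x x', (∀ i, w i x = w i x') → φ x = φ x') :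
    Comp B (localCost (Fintype.card ι)) {φ} := by
  have := Comp.of_dependsOn_list (B := B) (Finset.univ.toList.map w) (by simpa using hw) φ
    (fun x x' hx => h x x' (by simpa using hx))
  simpa using this

end Comp

end LDS

namespace LDS

/-! ### Circuits simulate Turing machines -/

section Local

open Turing TM2

/-- A cell is known through its one-hot tests, and only the symbols of `G` have wires. No other
symbol occurs, so these tests determine the cell, including whether it is empty. -/
theorem cell_eq_of_forall {K : Type} {Γ : K → Type} {Λ σ : Type} {G : Set (Σ k, Γ k)} {c c' : Cfg Γ Λ σ} {k : K} {i : ℕ}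
    (hc : ∀ g ∈ c.stk k, (⟨k, g⟩ : Σ k, Γ k) ∈ G) (hc' : ∀ g ∈ c'.stk k, (⟨k, g⟩ : Σ k, Γ k) ∈ G)
    (h : ∀ g, (⟨k, g⟩ : Σ k, Γ k) ∈ G → ((c.stk k)[i]? = some g ↔ (c'.stk k)[i]? = some g)) :
    (c.stk k)[i]? = (c'.stk k)[i]? := by
  apply Option.ext
  intro g
  constructor <;> intro hg
  · exact (h g (hc g (List.mem_of_getElem? hg))).1 hg
  · exact (h g (hc' g (List.mem_of_getElem? hg))).2 hg

variable {K : Type} [DecidableEq K] {Γ : K → Type} {Λ σ : Type}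

/-- The configuration after one step; a halting configuration stays. -/
def nextCfg (M : Λ → Stmt Γ Λ σ) (c : Cfg Γ Λ σ) : Cfg Γ Λ σ := (step M c).getD c

/-- A statement has a radius `d` such that the label, the variable and every cell after its execution
are determined by the label, the variable, the topmost `d` cells of the stacks and the cells at
distance at most `d`. -/
theorem exists_radius_stepAux (q : Stmt Γ Λ σ) : ∃ d : ℕ, ∀ (v : σ) (S S' : ∀ k, List (Γ k)),
    (∀ k, ∀ i < d, (S k)[i]? = (S' k)[i]?) →
    (stepAux q v S).l = (stepAux q v S').l ∧ (stepAux q v S).var = (stepAux q v S').var ∧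
    ∀ k i, (∀ j, j ≤ i + d → i ≤ j + d → (S k)[j]? = (S' k)[j]?) →
      ((stepAux q v S).stk k)[i]? = ((stepAux q v S').stk k)[i]? := by
  induction q with
  | push k f q ih =>
    obtain ⟨d, hd⟩ := ih
    refine ⟨d + 1, fun v S S' h => ?_⟩
    have key : ∀ (k' : K) (i : ℕ), (∀ j, j + 1 = i → (S k')[j]? = (S' k')[j]?) →
        (S k')[i]? = (S' k')[i]? →
        (Function.update S k (f v :: S k) k')[i]? = (Function.update S' k (f v :: S' k) k')[i]? := by
      intro k' i h1 h2
      by_cases hk : k' = k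
      · subst hk
        cases i with
        | zero => simp
        | succ i => simpa using h1 i rfl
      · simpa [Function.update_of_ne hk] using h2
    obtain ⟨h1, h2, h3⟩ := hd v (Function.update S k (f v :: S k))
      (Function.update S' k (f v :: S' k))
      (fun k' i hi => key k' i (fun j hj => h k' j (by omega)) (h k' i (by omega)))
    refine ⟨h1, h2, fun k' i hi => h3 k' i fun j hj hj' => key k' j (fun j' hj'' => ?_) ?_⟩
    · exact hi _ (by omega) (by omega)
    · exact hi _ (by omega) (by omega)
  | peek k f q ih =>
    obtain ⟨d, hd⟩ := ih
    refine ⟨d + 1, fun v S S' h => ?_⟩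
    have h0 : (S k).head? = (S' k).head? := by
      rw [List.head?_eq_getElem?, List.head?_eq_getElem?]; exact h k 0 (by omega)
    simp only [stepAux, h0]
    obtain ⟨h1, h2, h3⟩ := hd (f v (S' k).head?) S S' fun k' i hi => h k' i (by omega)
    exact ⟨h1, h2, fun k' i hi => h3 k' i fun j hj hj' => hi j (by omega) (by omega)⟩
  | pop k f q ih =>
    obtain ⟨d, hd⟩ := ih
    refine ⟨d + 1, fun v S S' h => ?_⟩
    have h0 : (S k).head? = (S' k).head? := by
      rw [List.head?_eq_getElem?, List.head?_eq_getElem?]; exact h k 0 (by omega)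
    simp only [stepAux, h0]
    have key : ∀ (k' : K) (i : ℕ), (S k')[i + 1]? = (S' k')[i + 1]? → (S k')[i]? = (S' k')[i]? →
        (Function.update S k (S k).tail k')[i]? = (Function.update S' k (S' k).tail k')[i]? := by
      intro k' i h1 h2
      by_cases hk : k' = k
      · subst hk; simpa using h1
      · simpa [Function.update_of_ne hk] using h2
    obtain ⟨h1, h2, h3⟩ := hd (f v (S' k).head?) (Function.update S k (S k).tail)
      (Function.update S' k (S' k).tail)
      (fun k' i hi => key k' i (h k' _ (by omega)) (h k' i (by omega)))
    exact ⟨h1, h2, fun k' i hi => h3 k' i fun j hj hj' =>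
      key k' j (hi _ (by omega) (by omega)) (hi _ (by omega) (by omega))⟩
  | load a q ih =>
    obtain ⟨d, hd⟩ := ih
    exact ⟨d, fun v S S' h => hd (a v) S S' h⟩
  | branch f q₁ q₂ ih₁ ih₂ =>
    obtain ⟨d, hd⟩ := ih₁
    obtain ⟨e, he⟩ := ih₂
    refine ⟨d + e, fun v S S' h => ?_⟩
    simp only [stepAux]
    cases f v
    · obtain ⟨h1, h2, h3⟩ := he v S S' fun k' i hi => h k' i (by omega)
      exact ⟨h1, h2, fun k' i hi => h3 k' i fun j hj hj' => hi j (by omega) (by omega)⟩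
    · obtain ⟨h1, h2, h3⟩ := hd v S S' fun k' i hi => h k' i (by omega)
      exact ⟨h1, h2, fun k' i hi => h3 k' i fun j hj hj' => hi j (by omega) (by omega)⟩
  | goto f => exact ⟨0, fun v S S' _ => ⟨rfl, rfl, fun k i hi => hi i (by omega) (by omega)⟩⟩
  | halt => exact ⟨0, fun v S S' _ => ⟨rfl, rfl, fun k i hi => hi i (by omega) (by omega)⟩⟩

theorem exists_length_stepAux_le (q : Stmt Γ Λ σ) : ∃ d : ℕ, ∀ (v : σ) (S : ∀ k, List (Γ k)) (k : K),
    ((stepAux q v S).stk k).length ≤ (S k).length + d := by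
  induction q with
  | push k f q ih =>
    obtain ⟨d, hd⟩ := ih
    refine ⟨d + 1, fun v S k' => (hd v _ k').trans ?_⟩
    by_cases hk : k' = k
    · subst hk; simp; omega
    · simp [Function.update_of_ne hk]
  | peek k f q ih =>
    obtain ⟨d, hd⟩ := ih
    exact ⟨d, fun v S k' => hd _ _ k'⟩
  | pop k f q ih =>
    obtain ⟨d, hd⟩ := ih
    refine ⟨d, fun v S k' => (hd _ _ k').trans ?_⟩
    by_cases hk : k' = k
    · subst hk; simp
    · simp [Function.update_of_ne hk]
  | load a q ih =>
    obtain ⟨d, hd⟩ := ih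
    exact ⟨d, fun v S k' => hd _ _ k'⟩
  | branch f q₁ q₂ ih₁ ih₂ =>
    obtain ⟨d, hd⟩ := ih₁
    obtain ⟨e, he⟩ := ih₂
    refine ⟨d + e, fun v S k' => ?_⟩
    simp only [stepAux]
    have h1 := hd v S k'
    have h2 := he v S k'
    cases f v <;> simp only [cond_true, cond_false] <;> omega
  | goto f => exact ⟨0, fun v S k' => le_rfl⟩
  | halt => exact ⟨0, fun v S k' => le_rfl⟩

/-- Only finitely many symbols can be pushed. -/
theorem exists_finite_symbols_stepAux [Finite σ] (q : Stmt Γ Λ σ) :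
    ∃ G : Set (Σ k, Γ k), G.Finite ∧ ∀ G', G ⊆ G' → ∀ (v : σ) (S : ∀ k, List (Γ k)),
      (∀ k, ∀ g ∈ S k, (⟨k, g⟩ : Σ k, Γ k) ∈ G') →
      ∀ k, ∀ g ∈ (stepAux q v S).stk k, (⟨k, g⟩ : Σ k, Γ k) ∈ G' := by
  induction q with
  | push k f q ih =>
    obtain ⟨G, hG, h⟩ := ih
    refine ⟨G ∪ Set.range fun v => ⟨k, f v⟩, hG.union (Set.finite_range _), ?_⟩
    refine fun G' hG' v S hS => h G' (Set.subset_union_left.trans hG') v _ fun k' g hg => ?_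
    by_cases hk : k' = k
    · subst hk
      simp only [Function.update_self, List.mem_cons] at hg
      rcases hg with rfl | hg
      · exact hG' (Or.inr ⟨v, rfl⟩)
      · exact hS _ _ hg
    · rw [Function.update_of_ne hk] at hg
      exact hS _ _ hg
  | peek k f q ih =>
    obtain ⟨G, hG, h⟩ := ih
    exact ⟨G, hG, fun G' hG' v S hS => h G' hG' _ S hS⟩
  | pop k f q ih =>
    obtain ⟨G, hG, h⟩ := ih
    refine ⟨G, hG, fun G' hG' v S hS => h G' hG' _ _ fun k' g hg => ?_⟩
    by_cases hk : k' = k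
    · subst hk
      rw [Function.update_self] at hg
      exact hS _ _ (List.mem_of_mem_tail hg)
    · rw [Function.update_of_ne hk] at hg
      exact hS _ _ hg
  | load a q ih =>
    obtain ⟨G, hG, h⟩ := ih
    exact ⟨G, hG, fun G' hG' v S hS => h G' hG' _ S hS⟩
  | branch f q₁ q₂ ih₁ ih₂ =>
    obtain ⟨G, hG, h⟩ := ih₁
    obtain ⟨G₂, hG₂, h₂⟩ := ih₂
    refine ⟨G ∪ G₂, hG.union hG₂, fun G' hG' v S hS => ?_⟩
    simp only [stepAux]
    cases f v
    · exact h₂ G' (Set.subset_union_right.trans hG') v S hS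
    · exact h G' (Set.subset_union_left.trans hG') v S hS
  | goto f => exact ⟨∅, Set.finite_empty, fun G' _ v S hS => hS⟩
  | halt => exact ⟨∅, Set.finite_empty, fun G' _ v S hS => hS⟩

variable (M : Λ → Stmt Γ Λ σ)

/-- There are finitely many labels, so the sum of the radii of their statements serves all of them.
-/
theorem exists_radius_nextCfg [Finite Λ] : ∃ d : ℕ, ∀ c c' : Cfg Γ Λ σ, c.l = c'.l → c.var = c'.var →
    (∀ k, ∀ i < d, (c.stk k)[i]? = (c'.stk k)[i]?) →
    (nextCfg M c).l = (nextCfg M c').l ∧ (nextCfg M c).var = (nextCfg M c').var ∧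
    ∀ k i, (∀ j, j ≤ i + d → i ≤ j + d → (c.stk k)[j]? = (c'.stk k)[j]?) →
      ((nextCfg M c).stk k)[i]? = ((nextCfg M c').stk k)[i]? := by
  cases nonempty_fintype Λ
  choose d hd using fun l => exists_radius_stepAux (M l)
  have hle : ∀ l, d l ≤ ∑ l, d l := fun l =>
    Finset.single_le_sum (f := d) (fun _ _ => Nat.zero_le _) (Finset.mem_univ l)
  refine ⟨∑ l, d l, ?_⟩
  rintro ⟨_ | l, v, S⟩ ⟨_ | l', v', S'⟩ hl hv h <;> simp only [reduceCtorEq, Option.some.injEq] at hl hv h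
  · exact ⟨rfl, hv, fun k i hi => hi i (by omega) (by omega)⟩
  · subst hl hv
    obtain ⟨h1, h2, h3⟩ := hd l v S S' fun k' i hi => h k' i (hi.trans_le (hle l))
    refine ⟨h1, h2, fun k i hi => h3 k i fun j hj hj' => hi j ?_ ?_⟩ <;> have := hle l <;> omega

theorem exists_length_nextCfg_le [Finite Λ] : ∃ d : ℕ, ∀ (c : Cfg Γ Λ σ) (k : K),
    ((nextCfg M c).stk k).length ≤ (c.stk k).length + d := by
  cases nonempty_fintype Λ
  choose d hd using fun l => exists_length_stepAux_le (M l)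
  refine ⟨∑ l, d l, ?_⟩
  rintro ⟨_ | l, v, S⟩ k
  · simp [nextCfg]
  · refine (hd l v S k).trans ?_
    have := Finset.single_le_sum (f := d) (fun _ _ => Nat.zero_le _) (Finset.mem_univ l)
    simp only
    omega

theorem exists_length_iterate_nextCfg_le [Finite Λ] : ∃ d : ℕ, ∀ (c : Cfg Γ Λ σ) (t : ℕ) (k : K),
    (((nextCfg M)^[t] c).stk k).length ≤ (c.stk k).length + d * t := by
  obtain ⟨d, hd⟩ := exists_length_nextCfg_le M
  refine ⟨d, fun c t k => ?_⟩
  induction t with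
  | zero => simp
  | succ t ih =>
    rw [Function.iterate_succ_apply']
    refine (hd _ k).trans ?_
    rw [mul_add]
    omega

/-- The stack alphabets need not be finite, but finitely many labels and internal states push only
finitely many symbols. Any set containing these is preserved by a step, so a finite `G` allows
one-hot coding with finitely many wires per cell. -/
theorem exists_finite_symbols_nextCfg [Finite Λ] [Finite σ] :
    ∃ G : Set (Σ k, Γ k), G.Finite ∧ ∀ G', G ⊆ G' → ∀ c : Cfg Γ Λ σ,
      (∀ k, ∀ g ∈ c.stk k, (⟨k, g⟩ : Σ k, Γ k) ∈ G') →
      ∀ k, ∀ g ∈ (nextCfg M c).stk k, (⟨k, g⟩ : Σ k, Γ k) ∈ G' := by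
  choose G hG h using fun l => exists_finite_symbols_stepAux (M l)
  refine ⟨⋃ l, G l, Set.finite_iUnion hG, ?_⟩
  rintro G' hG' ⟨_ | l, v, S⟩ hS
  · exact hS
  · exact h l G' ((Set.subset_iUnion G l).trans hG') v S hS

open Classical in
/-- The label and variable of a family of configurations, and the cells above depth `R` with symbols
from `G`, in one-hot form. -/
noncomputable def cfgWire {X : Type} (C : X → Cfg Γ Λ σ) (G : Set (Σ k, Γ k)) (R : ℕ) :
    Option Λ ⊕ σ ⊕ (Fin R × G) → X → Bool
  | .inl l, x => decide ((C x).l = l)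
  | .inr (.inl v), x => decide ((C x).var = v)
  | .inr (.inr (i, g)), x => decide (((C x).stk g.1.1)[(i : ℕ)]? = some g.1.2)

-- One layer of the tableau. The label, the variable and each cell after a step depend on the label,
-- the variable, the top `d` cells and a window of `2 * d + 1` cells. This is a number of wires
-- independent of `R`, so each new wire has constant cost.
open Classical in
theorem exists_comp_cfgWire [Fintype Λ] [Fintype σ] (G : Set (Σ k, Γ k)) [Fintype G] :
    ∃ d a : ℕ, ∀ (X : Type) (C : X → Cfg Γ Λ σ) (R : ℕ),
      (∀ x k, ∀ g ∈ (C x).stk k, (⟨k, g⟩ : Σ k, Γ k) ∈ G) →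
      (∀ x k, ∀ g ∈ (nextCfg M (C x)).stk k, (⟨k, g⟩ : Σ k, Γ k) ∈ G) →
      Comp (Set.range (cfgWire C G (R + d))) (a * (R + 1))
        (Set.range (cfgWire (fun x => nextCfg M (C x)) G R)) := by
  obtain ⟨d, hd⟩ := exists_radius_nextCfg M
  let ι := Option Λ ⊕ σ ⊕ (Fin d × G) ⊕ (Fin (2 * d + 1) × G)
  refine ⟨d + 1, (Fintype.card (Option Λ) + Fintype.card σ + Fintype.card G) *
    localCost (Fintype.card ι), fun X C R hC hC' => ?_⟩
  have main : ∀ j, Comp (Set.range (cfgWire C G (R + (d + 1)))) (localCost (Fintype.card ι))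
      {cfgWire (fun x => nextCfg M (C x)) G R j} := by
    intro j
    let i₀ : ℕ := match j with
      | .inr (.inr (i, _)) => i
      | _ => 0
    have hi₀ : i₀ ≤ R := by
      rcases j with l | v | ⟨i, g⟩
      · exact Nat.zero_le _
      · exact Nat.zero_le _
      · exact i.2.le
    let e : ι → Option Λ ⊕ σ ⊕ (Fin (R + (d + 1)) × G)
      | .inl l => .inl l
      | .inr (.inl v) => .inr (.inl v)
      | .inr (.inr (.inl (i, g))) => .inr (.inr (⟨i, by omega⟩, g))
      -- The window is centered at `i₀`; near the top of the stack the truncated subtraction only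
      -- repeats the cell 0.
      | .inr (.inr (.inr (i, g))) => .inr (.inr (⟨i₀ + i - d, by omega⟩, g))
    refine Comp.of_dependsOn (fun i => cfgWire C G (R + (d + 1)) (e i))
      (fun i => by exact ⟨_, rfl⟩) _ ?_
    intro x x' hx
    have hl : (C x).l = (C x').l := by
      have := hx (.inl (C x).l)
      simpa [e, cfgWire, eq_comm] using this
    have hv : (C x).var = (C x').var := by
      have := hx (.inr (.inl (C x).var))
      simpa [e, cfgWire, eq_comm] using this
    have htop : ∀ k, ∀ i < d, ((C x).stk k)[i]? = ((C x').stk k)[i]? := by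
      intro k i hi
      refine cell_eq_of_forall (hC x k) (hC x' k) fun g hg => ?_
      have := hx (.inr (.inr (.inl (⟨i, hi⟩, ⟨_, hg⟩))))
      simpa [e, cfgWire] using this
    obtain ⟨h1, h2, h3⟩ := hd _ _ hl hv htop
    have hwin : ∀ k, ((nextCfg M (C x)).stk k)[i₀]? = ((nextCfg M (C x')).stk k)[i₀]? := by
      intro k
      refine h3 k i₀ fun i hi hi' => ?_
      refine cell_eq_of_forall (hC x k) (hC x' k) fun g hg => ?_
      have := hx (.inr (.inr (.inr (⟨i + d - i₀, by omega⟩, ⟨_, hg⟩))))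
      have h4 : i₀ + (i + d - i₀) - d = i := by omega
      simpa [e, cfgWire, h4] using this
    rcases j with l | v | ⟨i, g⟩
    · simp only [cfgWire, h1]
    · simp only [cfgWire, h2]
    · have := hwin g.1.1
      simp only [i₀] at this
      simp only [cfgWire, this]
  refine (Comp.range main).mono subset_rfl ?_ subset_rfl
  rw [Fintype.card_sum, Fintype.card_sum, Fintype.card_prod, Fintype.card_fin, mul_right_comm]
  refine Nat.mul_le_mul_right _ ?_
  nlinarith [Nat.zero_le R, Nat.zero_le (Fintype.card (Option Λ)), Nat.zero_le (Fintype.card σ),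
    Nat.zero_le (Fintype.card G)]

/-- Layers of the tableau are stacked. Each step back in time enlarges the relevant depth by `d`,
hence the depth `R + d * T` at the start. -/
theorem exists_comp_iterate_cfgWire [Fintype Λ] [Fintype σ] (G : Set (Σ k, Γ k)) [Fintype G]
    (hG : ∀ c : Cfg Γ Λ σ, (∀ k, ∀ g ∈ c.stk k, (⟨k, g⟩ : Σ k, Γ k) ∈ G) →
      ∀ k, ∀ g ∈ (nextCfg M c).stk k, (⟨k, g⟩ : Σ k, Γ k) ∈ G) :
    ∃ d a : ℕ, ∀ (X : Type) (C : X → Cfg Γ Λ σ) (R T : ℕ),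
      (∀ x k, ∀ g ∈ (C x).stk k, (⟨k, g⟩ : Σ k, Γ k) ∈ G) →
      Comp (Set.range (cfgWire C G (R + d * T))) (T * (a * (R + d * T + 1)))
        (Set.range (cfgWire (fun x => (nextCfg M)^[T] (C x)) G R)) := by
  obtain ⟨d, a, h⟩ := exists_comp_cfgWire M G
  refine ⟨d, a, fun X C R T => ?_⟩
  induction T generalizing C with
  | zero =>
    intro hC
    simpa using Comp.of_subset subset_rfl
  | succ T ih =>
    intro hC
    have h1 := h X C (R + d * T) hC fun x => hG _ (hC x)
    have h2 := ih (fun x => nextCfg M (C x)) fun x => hG _ (hC x)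
    have h3 : R + d * (T + 1) = R + d * T + d := by ring
    rw [h3]
    refine (h1.trans h2).mono subset_rfl ?_ (by simp only [Function.iterate_succ_apply]; rfl)
    have : a * (R + d * T + 1) ≤ a * (R + d * T + d + 1) := Nat.mul_le_mul_left _ (by omega)
    nlinarith [Nat.zero_le T]

end Local

/-- A partial run that reaches `b` never met `none` on the way, so it agrees with the total
iteration in which halted configurations stay put. -/
theorem iterate_getD_of_iterate_bind {α : Type} (f : α → Option α) (n : ℕ) {a b : α}
    (h : (flip bind f)^[n] (some a) = some b) : (fun c => (f c).getD c)^[n] a = b := by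
  induction n generalizing a with
  | zero => simpa using h
  | succ n ih =>
    rw [Function.iterate_succ_apply] at h ⊢
    have h1 : flip bind f (some a) = f a := rfl
    rw [h1] at h
    cases hfa : f a with
    | none =>
      rw [hfa] at h
      have : ∀ n, (flip bind f)^[n] (none : Option α) = none := fun n => by
        induction n with
        | zero => rfl
        | succ n ih => rw [Function.iterate_succ_apply]; exact ih
      rw [this] at h
      cases h
    | some a' =>
      rw [hfa] at h
      simpa using ih h

theorem nat_polynomial_eval_mono (p : Polynomial ℕ) {m n : ℕ} (h : m ≤ n) : p.eval m ≤ p.eval n := by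
  simp only [Polynomial.eval_eq_sum, Polynomial.sum]
  exact Finset.sum_le_sum fun i _ => Nat.mul_le_mul_left _ (Nat.pow_le_pow_left h i)

open Classical in
/-- The symbols of `enc (inp x)`, one-hot. -/
noncomputable def cellWire {X : Type} (w : X → List (Option Bool)) (i : ℕ) (g : Option Bool) :
    X → Bool :=
  fun x => decide ((w x)[i]? = some g)

open Turing in
/-- Polynomial-time machines have polynomial-size circuits: the symbols of the output are computed
from the symbols of the input. -/
theorem PolyTime.exists_comp {f : List (List Bool) → List (List Bool)} (hf : PolyTime f) :
    ∃ Q : Polynomial ℕ, ∀ (X : Type) (B : Set (X → Bool)) (inp : X → List (List Bool)) (ℓ : ℕ),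
      (∀ x, (encodeStrings (inp x)).length ≤ ℓ) →
      (∀ i g, cellWire (fun x => encodeStrings (inp x)) i g ∈ B) →
      (∀ x, (encodeStrings (f (inp x))).length ≤ Q.eval ℓ) ∧
      Comp B (Q.eval ℓ) {φ | ∃ i g, φ = cellWire (fun x => encodeStrings (f (inp x))) i g} := by
  classical
  obtain ⟨h⟩ := hf
  let _ := h.tm.ΛFin
  let _ := h.tm.σFin
  let _ := h.tm.Γk₀Fin
  obtain ⟨G₀, hG₀, hstep⟩ := exists_finite_symbols_nextCfg h.tm.m
  let G : Set (Σ k, h.tm.Γ k) := G₀ ∪ Set.range fun g : h.tm.Γ h.tm.k₀ => ⟨h.tm.k₀, g⟩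
  have hGfin : G.Finite := hG₀.union (Set.finite_range _)
  let _ : Fintype G := hGfin.fintype
  have hGstep := hstep G Set.subset_union_left
  obtain ⟨d, a, hcomp⟩ := exists_comp_iterate_cfgWire h.tm.m G hGstep
  obtain ⟨e, he⟩ := exists_length_iterate_nextCfg_le h.tm.m
  let R : Polynomial ℕ := Polynomial.X + Polynomial.C e * h.time
  refine ⟨R + (2 + h.time * (Polynomial.C a * (R + Polynomial.C d * h.time + 1)) + 1),
    fun X B inp ℓ hℓ hB => ?_⟩
  set T := h.time.eval ℓ with hT
  let C : X → TM2.Cfg h.tm.Γ h.tm.Λ h.tm.σ := fun x =>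
    initList h.tm ((encodeStrings (inp x)).map h.inputAlphabet.invFun)
  have hstk₀ : ∀ x, (C x).stk h.tm.k₀ = (encodeStrings (inp x)).map h.inputAlphabet.invFun := by
    intro x
    simp [C, initList]
  have hstk : ∀ x k, k ≠ h.tm.k₀ → (C x).stk k = [] := by
    intro x k hk
    simp [C, initList, hk]
  have hCG : ∀ x k, ∀ g ∈ (C x).stk k, (⟨k, g⟩ : Σ k, h.tm.Γ k) ∈ G := by
    intro x k g hg
    by_cases hk : k = h.tm.k₀
    · subst hk
      exact Or.inr ⟨g, rfl⟩
    · rw [hstk x k hk] at hg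
      cases hg
  have hlen : ∀ x k, ((C x).stk k).length ≤ ℓ := by
    intro x k
    by_cases hk : k = h.tm.k₀
    · subst hk
      rw [hstk₀, List.length_map]
      exact hℓ x
    · simp [hstk x k hk]
  have hrun : ∀ x, (nextCfg h.tm.m)^[T] (C x) =
      haltList h.tm ((encodeStrings (f (inp x))).map h.outputAlphabet.invFun) := by
    intro x
    obtain ⟨⟨n, hn⟩, hle⟩ := h.outputsFun (inp x)
    have h1 := iterate_getD_of_iterate_bind _ n hn
    -- The halting configuration is fixed by `nextCfg`, so all inputs may be run for the same number
    -- `T` of steps.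
    have h2 : n ≤ T := hle.trans (nat_polynomial_eval_mono _ (hℓ x))
    obtain ⟨m, hm⟩ := Nat.exists_eq_add_of_le' h2
    rw [hm, Function.iterate_add_apply]
    have h3 : (nextCfg h.tm.m)^[n] (C x) =
        haltList h.tm ((encodeStrings (f (inp x))).map h.outputAlphabet.invFun) := h1
    rw [h3]
    exact Function.iterate_fixed rfl m
  have hout : ∀ x, (haltList h.tm ((encodeStrings (f (inp x))).map h.outputAlphabet.invFun)).stk
      h.tm.k₁ = (encodeStrings (f (inp x))).map h.outputAlphabet.invFun := by
    intro x
    simp [haltList]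
  have houtG : ∀ x k, ∀ g ∈ ((nextCfg h.tm.m)^[T] (C x)).stk k, (⟨k, g⟩ : Σ k, h.tm.Γ k) ∈ G := by
    intro x
    have : ∀ t, ∀ k, ∀ g ∈ ((nextCfg h.tm.m)^[t] (C x)).stk k, (⟨k, g⟩ : Σ k, h.tm.Γ k) ∈ G := by
      intro t
      induction t with
      | zero => exact hCG x
      | succ t ih => rw [Function.iterate_succ_apply']; exact hGstep _ ih
    exact this T
  have hR : R.eval ℓ = ℓ + e * T := by simp [R, T]
  have hlen' : ∀ x, (encodeStrings (f (inp x))).length ≤ R.eval ℓ := by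
    intro x
    have h1 := he (C x) T h.tm.k₁
    rw [hrun x, hout, List.length_map] at h1
    have := hlen x h.tm.k₁
    omega
  refine ⟨fun x => (hlen' x).trans (by simp), ?_⟩
  -- Initially the label and the variable are constant, the input stack is read off from `B`, and
  -- the other stacks are empty: two constant gates suffice.
  have hin : Comp B 2 (Set.range (cfgWire C G (R.eval ℓ + d * T))) := by
    refine ((Comp.of_subset (subset_refl B)).union ((Comp.const true).union
      (Comp.const false))).mono subset_rfl le_rfl ?_
    have hb : ∀ b : Bool, (fun _ : X => b) ∈
        B ∪ ({fun _ => true} ∪ {fun _ => false} : Set (X → Bool)) := by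
      rintro (_ | _) <;> simp
    rintro _ ⟨l | v | ⟨i, ⟨k, g⟩, hg⟩, rfl⟩
    · exact hb (decide (some h.tm.main = l))
    · exact hb (decide (h.tm.initialState = v))
    · by_cases hk : k = h.tm.k₀
      · subst hk
        refine Or.inl ?_
        convert! hB i (h.inputAlphabet g) using 1
        funext x
        simp only [cfgWire, cellWire, hstk₀ x, List.getElem?_map, decide_eq_decide]
        cases (encodeStrings (inp x))[(i : ℕ)]? <;> simp [Equiv.symm_apply_eq]
      · convert! hb false using 1
        funext x
        simp [cfgWire, hstk x k hk]
  have hfin : Comp (Set.range (cfgWire (fun x => (nextCfg h.tm.m)^[T] (C x)) G (R.eval ℓ))) 1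
      {φ | ∃ i g, φ = cellWire (fun x => encodeStrings (f (inp x))) i g} := by
    refine ((Comp.of_subset subset_rfl).union (Comp.const false)).mono subset_rfl le_rfl ?_
    rintro _ ⟨i, g, rfl⟩
    have hcell : ∀ x, (encodeStrings (f (inp x)))[i]? = some g ↔
        (((nextCfg h.tm.m)^[T] (C x)).stk h.tm.k₁)[i]? = some (h.outputAlphabet.symm g) := by
      intro x
      rw [hrun, hout, List.getElem?_map]
      cases (encodeStrings (f (inp x)))[i]? <;> simp
    -- In the second case the cell lies too deep or the symbol never occurs, and the test is
    -- constantly false.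
    by_cases hig : i < R.eval ℓ ∧ (⟨h.tm.k₁, h.outputAlphabet.symm g⟩ : Σ k, h.tm.Γ k) ∈ G
    · refine Or.inl ⟨.inr (.inr (⟨i, hig.1⟩, ⟨_, hig.2⟩)), ?_⟩
      funext x
      simp only [cfgWire, cellWire, hcell]
    · refine Or.inr ?_
      rw [Set.mem_singleton_iff]
      funext x
      simp only [cellWire, decide_eq_false_iff_not]
      intro hx
      refine hig ⟨?_, ?_⟩
      · exact (List.getElem?_eq_some_iff.1 hx).1.trans_le (hlen' x)
      · exact houtG x _ _ (List.mem_of_getElem? ((hcell x).1 hx))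
  refine ((hin.trans (hcomp X C (R.eval ℓ) T hCG)).trans hfin).mono subset_rfl ?_ subset_rfl
  simp [T]

end LDS

namespace LDS

/-! ### A machine that evaluates straight-line programs repeatedly -/

/-- The instructions of straight-line programs. The memory is a list of bits, of which the part
above the cursor is on another stack. The instructions `cnt0` and `cnt1` form a binary
counter. -/
inductive Op
  | up | down | ld | and | not | clr | push | coin | out | sep | cnt0 | cnt1

instance : Fintype Op where
  elems := ⟨([.up, .down, .ld, .and, .not, .clr, .push, .coin, .out, .sep, .cnt0, .cnt1] : List Op), by simp⟩
  complete o := by cases o <;> simp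

namespace Op

/-- The cyclic successor of an instruction in the order of their codes. -/
def next : Op → Op
  | up => down | down => ld | ld => and | and => not | not => clr | clr => push | push => coin
  | coin => out | out => sep | sep => cnt0 | cnt0 => cnt1 | cnt1 => up

/-- The position of an instruction in the order of the codes. -/
def index : Op → ℕ
  | up => 0 | down => 1 | ld => 2 | and => 3 | not => 4 | clr => 5 | push => 6 | coin => 7
  | out => 8 | sep => 9 | cnt0 => 10 | cnt1 => 11

/-- The code of an instruction as a bit string. -/
def code (o : Op) : List Bool := List.replicate o.index true ++ [false]

/-- One instruction of the decrement of the counter: the new instruction and the borrow. -/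
def decr : Op → Bool → Op × Bool
  | cnt0, true => (cnt1, true)
  | cnt1, true => (cnt0, false)
  | o, b => (o, b)

end Op

/-- The state of the evaluation: the rest of the input, the memory below and above the cursor, the
output, and the accumulator. -/
structure EvalState where
  /-- the rest of the input -/
  inp : List (Option Bool)
  /-- memory below the cursor -/
  mem : List Bool
  /-- memory above the cursor -/
  aux : List Bool
  /-- output -/
  out : List (Option Bool)
  /-- accumulator -/
  acc : Bool

/-- The bit that a symbol stands for. -/
def symBit : Option (Option Bool) → Bool
  | some (some b) => b
  | _ => false

/-- The effect of an instruction. -/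
def Op.exec : EvalState → Op → EvalState
  | s, .up => { s with mem := s.mem.tail, aux := s.mem.head?.getD false :: s.aux }
  | s, .down => { s with aux := s.aux.tail, mem := s.aux.head?.getD false :: s.mem }
  | s, .ld => { s with acc := s.mem.head?.getD false }
  | s, .and => { s with acc := s.acc && s.mem.head?.getD false }
  | s, .not => { s with acc := !s.acc }
  | s, .clr => { s with acc := false }
  | s, .push => { s with mem := s.acc :: s.mem }
  | s, .coin => { s with inp := s.inp.tail, acc := symBit s.inp.head? }
  | s, .out => { s with out := some s.acc :: s.out }
  | s, .sep => { s with out := none :: s.out }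
  | s, .cnt0 => s
  | s, .cnt1 => s

/-- Reversal of a program, with decrement of its counter if `b` is set. -/
def rewind : List Op → Bool → List Op → Bool × List Op
  | [], b, P => (b, P)
  | o :: D, b, P => rewind D (o.decr b).2 ((o.decr b).1 :: P)

/-- Decoding of a program, up to the next separator; the result is reversed. -/
def parse : List (Option Bool) → Op → List Op → Option (List (Option Bool) × List Op)
  | [], _, _ => none
  | none :: w, _, D => some (w, D)
  | some true :: w, o, D => parse w o.next D
  | some false :: w, o, D => parse w .up (o :: D)

/-- Skips a string with its separator. -/
def skipString : List (Option Bool) → Option (List (Option Bool))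
  | [] => none
  | none :: w => some w
  | some _ :: w => skipString w

/-- Execution of the reversed program `D` again and again until its counter is exhausted or the input
ends, at most `n` times. Returns the output. -/
def evalLoop : ℕ → EvalState → List Op → List (Option Bool)
  | 0, s, _ => s.out
  | n + 1, s, D =>
    if (rewind D true []).1 then s.out
    else
      let P := (rewind D true []).2
      let s' := P.foldl Op.exec { s with out := none :: s.out }
      match s'.inp with
      | some _ :: w => evalLoop n { s' with inp := w } P.reverse
      | _ => s'.out

/-- The function computed by the evaluator: the input consists of a string that is skipped, a program,
and the coins. -/
def evaluate (w : List (Option Bool)) : List (Option Bool) :=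
  match skipString w with
  | none => []
  | some w₁ =>
    match parse w₁ .up [] with
    | none => []
    | some (w₂, D) => evalLoop (w₂.length + 1) ⟨w₂, [], [], [], false⟩ D

/-! ### The evaluator as a multi-stack machine, and its running time -/

namespace Evaluator

/-- The stacks. -/
inductive Stk
  | I | D | P | V | W | O
  deriving DecidableEq

instance : Fintype Stk where
  elems := ⟨([.I, .D, .P, .V, .W, .O] : List Stk), by simp⟩
  complete k := by cases k <;> simp

/-- The stack alphabets. -/
def Alph : Stk → Type
  | .I => Option Bool
  | .D => Op
  | .P => Op
  | .V => Bool
  | .W => Bool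
  | .O => Option Bool

/-- The labels. -/
inductive Lab
  | skip | parse | rew | exec | act (o : Op) | clean

open Classical in
noncomputable instance : Fintype Lab :=
  Fintype.ofSurjective (fun x : Op ⊕ Fin 5 => match x with
    | .inl o => .act o
    | .inr 0 => .skip
    | .inr 1 => .parse
    | .inr 2 => .rew
    | .inr 3 => .exec
    | .inr 4 => .clean) (by
    rintro (_ | _ | _ | _ | o | _)
    exacts [⟨.inr 0, rfl⟩, ⟨.inr 1, rfl⟩, ⟨.inr 2, rfl⟩, ⟨.inr 3, rfl⟩, ⟨.inl o, rfl⟩, ⟨.inr 4, rfl⟩])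

/-- The internal states. -/
structure Reg where
  /-- instruction that is being decoded -/
  ctr : Op
  /-- accumulator -/
  acc : Bool
  /-- borrow of the decrement -/
  flag : Bool
  /-- bit read -/
  bit : Bool
  /-- instruction read -/
  op : Option Op
  /-- symbol read -/
  sym : Option (Option Bool)

open Classical in
noncomputable instance : Fintype Reg :=
  Fintype.ofSurjective
    (fun x : Op × Bool × Bool × Bool × Option Op × Option (Option Bool) =>
      ⟨x.1, x.2.1, x.2.2.1, x.2.2.2.1, x.2.2.2.2.1, x.2.2.2.2.2⟩)
    fun r => ⟨(r.ctr, r.acc, r.flag, r.bit, r.op, r.sym), rfl⟩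

/-- Is the symbol a separator? -/
def isSep : Option (Option Bool) → Bool
  | some none => true
  | _ => false

/-- Is the symbol a one? -/
def isOne : Option (Option Bool) → Bool
  | some (some true) => true
  | _ => false

/-- The initial internal state. -/
def Reg.init : Reg := ⟨.up, false, false, false, none, none⟩

/-- Forgets what was read. -/
def Reg.clear (r : Reg) : Reg := { r with bit := false, op := none, sym := none }

open Turing TM2 Stmt

/-- Jump, forgetting what was read. -/
def jump (l : Lab) : TM2.Stmt Alph Lab Reg := load Reg.clear (goto fun _ => l)

/-- The program of the machine. -/
def prog : Lab → TM2.Stmt Alph Lab Reg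
  | .skip => pop .I (fun r s => { r with sym := s })
      (branch (fun r => r.sym.isNone) (jump .clean)
        (branch (fun r => isSep r.sym) (jump .parse) (jump .skip)))
  | .parse => pop .I (fun r s => { r with sym := s })
      (branch (fun r => r.sym.isNone) (jump .clean)
        (branch (fun r => isSep r.sym)
          (load (fun r => { r with flag := true, ctr := .up }) (jump .rew))
          (branch (fun r => isOne r.sym)
            (load (fun r => { r with ctr := r.ctr.next }) (jump .parse))
            (push .D (fun r => r.ctr) (load (fun r => { r with ctr := .up }) (jump .parse))))))
  | .rew => pop .D (fun r o => { r with op := o })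
      (branch (fun r => r.op.isNone)
        (branch (fun r => r.flag) (jump .clean) (push .O (fun _ => none) (jump .exec)))
        (push .P (fun r => ((r.op.getD .up).decr r.flag).1)
          (load (fun r => { r with flag := ((r.op.getD .up).decr r.flag).2 }) (jump .rew))))
  | .exec => pop .P (fun r o => { r with op := o })
      (branch (fun r => r.op.isNone)
        (pop .I (fun r s => { r with sym := s })
          (branch (fun r => r.sym.isNone || isSep r.sym) (jump .clean)
            (load (fun r => { r with flag := true }) (jump .rew))))
        (push .D (fun r => r.op.getD .up) (goto fun r => .act (r.op.getD .up))))
  | .act .up => pop .V (fun r b => { r with bit := b.getD false })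
      (push .W (fun r => r.bit) (jump .exec))
  | .act .down => pop .W (fun r b => { r with bit := b.getD false })
      (push .V (fun r => r.bit) (jump .exec))
  | .act .ld => peek .V (fun r b => { r with acc := b.getD false }) (jump .exec)
  | .act .and => peek .V (fun r b => { r with acc := r.acc && b.getD false }) (jump .exec)
  | .act .not => load (fun r => { r with acc := !r.acc }) (jump .exec)
  | .act .clr => load (fun r => { r with acc := false }) (jump .exec)
  | .act .push => push .V (fun r => r.acc) (jump .exec)
  | .act .coin => pop .I (fun r s => { r with acc := symBit s }) (jump .exec)
  | .act .out => push .O (fun r => some r.acc) (jump .exec)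
  | .act .sep => push .O (fun _ => none) (jump .exec)
  | .act .cnt0 => jump .exec
  | .act .cnt1 => jump .exec
  | .clean => pop .I (fun r s => { r with bit := s.isSome })
      (pop .D (fun r s => { r with bit := r.bit || s.isSome })
        (pop .P (fun r s => { r with bit := r.bit || s.isSome })
          (pop .V (fun r s => { r with bit := r.bit || s.isSome })
            (pop .W (fun r s => { r with bit := r.bit || s.isSome })
              (branch (fun r => r.bit) (jump .clean) (load (fun _ => Reg.init) halt))))))

/-- The machine. -/
noncomputable def machine : FinTM2 where
  K := Stk
  k₀ := .I
  k₁ := .O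
  Γ := Alph
  Λ := Lab
  main := .skip
  σ := Reg
  initialState := Reg.init
  Γk₀Fin := inferInstanceAs (Fintype (Option Bool))
  m := prog

/-- The contents of the stacks. -/
def stks (I : List (Option Bool)) (D P : List Op) (V W : List Bool) (O : List (Option Bool)) :
    ∀ k, List (Alph k)
  | .I => I
  | .D => D
  | .P => P
  | .V => V
  | .W => W
  | .O => O

/-- The machine goes from `c` to `c'` in `t` steps. -/
def Runs (t : ℕ) (c c' : TM2.Cfg Alph Lab Reg) : Prop :=
  (flip bind (TM2.step prog))^[t] (some c) = some c'

theorem Runs.refl (c : TM2.Cfg Alph Lab Reg) : Runs 0 c c := rfl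

theorem Runs.trans {t t' : ℕ} {c c' c'' : TM2.Cfg Alph Lab Reg} (h : Runs t c c')
    (h' : Runs t' c' c'') : Runs (t' + t) c c'' := by
  unfold Runs at *
  rw [Function.iterate_add_apply, h, h']

theorem Runs.single {l : Lab} {r : Reg} {S : ∀ k, List (Alph k)} {c' : TM2.Cfg Alph Lab Reg}
    (hl : (TM2.stepAux (prog l) r S).l = c'.l) (hv : (TM2.stepAux (prog l) r S).var = c'.var)
    (hS : ∀ k, (TM2.stepAux (prog l) r S).stk k = c'.stk k) : Runs 1 ⟨some l, r, S⟩ c' := by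
  have : TM2.stepAux (prog l) r S = c' := by
    generalize TM2.stepAux (prog l) r S = c at hl hv hS
    obtain ⟨l₁, v₁, S₁⟩ := c
    obtain ⟨l₂, v₂, S₂⟩ := c'
    obtain rfl : S₁ = S₂ := funext hS
    simp only at hl hv
    rw [hl, hv]
  exact congrArg some this

/-- The configuration with given label, internal state, program stacks and evaluation state. -/
def conf (l : Lab) (ctr : Op) (flag : Bool) (D P : List Op) (s : EvalState) :
    TM2.Cfg Alph Lab Reg :=
  ⟨some l, ⟨ctr, s.acc, flag, false, none, none⟩, stks s.inp D P s.mem s.aux s.out⟩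

theorem runs_exec_op (ctr : Op) (flag : Bool) (D P : List Op) (s : EvalState) (o : Op) :
    Runs 2 (conf .exec ctr flag D (o :: P) s) (conf .exec ctr flag (o :: D) P (o.exec s)) := by
  refine Runs.trans (t := 1) (t' := 1) (c' := ⟨some (.act o),
    ⟨ctr, s.acc, flag, false, some o, none⟩, stks s.inp (o :: D) P s.mem s.aux s.out⟩)
    (Runs.single rfl rfl fun k => by cases k <;> rfl) ?_
  cases o <;> exact Runs.single rfl rfl fun k => by cases k <;> rfl

theorem runs_exec_sep (ctr : Op) (flag : Bool) (D : List Op) (s : EvalState)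
    (h : s.inp.head? = none ∨ s.inp.head? = some none) :
    Runs 1 (conf .exec ctr flag D [] s) (conf .clean ctr flag D [] { s with inp := s.inp.tail }) := by
  obtain ⟨_ | ⟨_ | b, I⟩, V, W, O, acc⟩ := s
  · exact Runs.single rfl rfl fun k => by cases k <;> rfl
  · exact Runs.single rfl rfl fun k => by cases k <;> rfl
  · simp at h

theorem runs_exec_some (ctr : Op) (flag : Bool) (D : List Op) (s : EvalState) (b : Bool)
    (I : List (Option Bool)) (h : s.inp = some b :: I) :
    Runs 1 (conf .exec ctr flag D [] s) (conf .rew ctr true D [] { s with inp := I }) := by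
  obtain ⟨_, V, W, O, acc⟩ := s
  subst h
  exact Runs.single rfl rfl fun k => by cases k <;> rfl

theorem runs_rew_true (ctr : Op) (P : List Op) (s : EvalState) :
    Runs 1 (conf .rew ctr true [] P s) (conf .clean ctr true [] P s) :=
  Runs.single rfl rfl fun k => by cases k <;> rfl

theorem runs_rew_false (ctr : Op) (P : List Op) (s : EvalState) :
    Runs 1 (conf .rew ctr false [] P s)
      (conf .exec ctr false [] P { s with out := none :: s.out }) :=
  Runs.single rfl rfl fun k => by cases k <;> rfl

theorem runs_exec (ctr : Op) (flag : Bool) (D P : List Op) (s : EvalState) :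
    Runs (2 * P.length) (conf .exec ctr flag D P s)
      (conf .exec ctr flag (P.reverse ++ D) [] (P.foldl Op.exec s)) := by
  induction P generalizing D s with
  | nil => exact Runs.refl _
  | cons o P ih =>
    have := (runs_exec_op ctr flag D P s o).trans (ih (o :: D) (o.exec s))
    simpa [mul_add, add_comm] using this

theorem runs_rew (ctr : Op) (flag : Bool) (D P : List Op) (s : EvalState) :
    Runs D.length (conf .rew ctr flag D P s)
      (conf .rew ctr (rewind D flag P).1 [] (rewind D flag P).2 s) := by
  induction D generalizing flag P with
  | nil => exact Runs.refl _
  | cons o D ih =>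
    refine Runs.trans (t := 1) ?_ (ih (o.decr flag).2 ((o.decr flag).1 :: P))
    exact Runs.single rfl rfl fun k => by cases k <;> rfl

theorem length_rewind (D : List Op) (flag : Bool) (P : List Op) :
    (rewind D flag P).2.length = D.length + P.length := by
  induction D generalizing flag P with
  | nil => simp [rewind]
  | cons o D ih => rw [rewind, ih]; simp; omega

theorem length_inp_exec_le (s : EvalState) (o : Op) : (o.exec s).inp.length ≤ s.inp.length := by
  cases o <;> simp [Op.exec]

theorem length_inp_foldl_exec_le (P : List Op) (s : EvalState) :
    (P.foldl Op.exec s).inp.length ≤ s.inp.length := by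
  induction P generalizing s with
  | nil => exact le_rfl
  | cons o P ih => exact (ih _).trans (length_inp_exec_le s o)

/-- A round costs `D.length` steps for the rewind, two per instruction and two for the transitions.
Every further round consumes at least the bit that separates the blocks, so fuel above the input
length is never used up. -/
theorem runs_loop (n : ℕ) (ctr : Op) (s : EvalState) (D : List Op) (hn : s.inp.length < n) :
    ∃ t ≤ n * (3 * D.length + 2), ∃ flag D' P' s', s'.out = evalLoop n s D ∧
      Runs t (conf .rew ctr true D [] s) (conf .clean ctr flag D' P' s') := by
  induction n generalizing s D with
  | zero => omega
  | succ n ih =>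
    have h1 := runs_rew ctr true D [] s
    by_cases hb : (rewind D true []).1 = true
    · refine ⟨1 + D.length, by nlinarith, true, [], (rewind D true []).2, s, by simp [evalLoop, hb],
        h1.trans ?_⟩
      rw [hb]
      exact runs_rew_true _ _ _
    · set P := (rewind D true []).2 with hP
      have hPlen : P.length = D.length := by simpa using length_rewind D true []
      set s₁ : EvalState := { s with out := none :: s.out } with hs₁
      have h2 : Runs 1 (conf .rew ctr (rewind D true []).1 [] P s) (conf .exec ctr false [] P s₁) := by
        rw [Bool.not_eq_true] at hb
        rw [hb]
        exact runs_rew_false _ _ _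
      have h3 := runs_exec ctr false [] P s₁
      set s₂ := P.foldl Op.exec s₁ with hs₂
      have hlen : s₂.inp.length ≤ s.inp.length := length_inp_foldl_exec_le P s₁
      rw [List.append_nil] at h3
      have h123 := (h1.trans h2).trans h3
      rcases hi : s₂.inp with _ | ⟨_ | b, w⟩
      · refine ⟨_, ?_, _, _, _, _, ?_, h123.trans (runs_exec_sep _ _ _ _ (by simp [hi]))⟩
        · nlinarith
        · simp [evalLoop, hb, ← hP, ← hs₁, ← hs₂, hi]
      · refine ⟨_, ?_, _, _, _, _, ?_, h123.trans (runs_exec_sep _ _ _ _ (by simp [hi]))⟩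
        · nlinarith
        · simp [evalLoop, hb, ← hP, ← hs₁, ← hs₂, hi]
      · obtain ⟨t, ht, flag, D', P', s', hs', hrun⟩ := ih { s₂ with inp := w } P.reverse (by
          rw [hi] at hlen
          simp only [List.length_cons] at hlen ⊢
          omega)
        have h4 : Runs 1 (conf .exec ctr false P.reverse [] s₂)
            (conf .rew ctr true P.reverse [] { s₂ with inp := w }) :=
          runs_exec_some _ _ _ _ _ _ hi
        refine ⟨_, ?_, flag, D', P', s', ?_, (h123.trans h4).trans hrun⟩
        · rw [List.length_reverse, hPlen] at ht
          nlinarith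
        · rw [hs']
          simp [evalLoop, hb, ← hP, ← hs₁, ← hs₂, hi]

theorem runs_skip (w : List (Option Bool)) :
    ∃ t ≤ w.length + 1, Runs t (conf .skip .up false [] [] ⟨w, [], [], [], false⟩)
      (match skipString w with
        | none => conf .clean .up false [] [] ⟨[], [], [], [], false⟩
        | some w' => conf .parse .up false [] [] ⟨w', [], [], [], false⟩) := by
  induction w with
  | nil =>
    exact ⟨1, by simp, Runs.single rfl rfl fun k => by cases k <;> rfl⟩
  | cons a w ih =>
    rcases a with _ | b
    · exact ⟨1, by simp, Runs.single rfl rfl fun k => by cases k <;> rfl⟩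
    · obtain ⟨t, ht, h⟩ := ih
      refine ⟨t + 1, by simpa using ht, Runs.trans ?_ h⟩
      exact Runs.single rfl rfl fun k => by cases k <;> rfl

theorem runs_parse (w : List (Option Bool)) (o : Op) (D : List Op) :
    ∃ t ≤ w.length + 1, ∃ ctr D₀, Runs t (conf .parse o false D [] ⟨w, [], [], [], false⟩)
      (match parse w o D with
        | none => conf .clean ctr false D₀ [] ⟨[], [], [], [], false⟩
        | some (w', D') => conf .rew .up true D' [] ⟨w', [], [], [], false⟩) := by
  induction w generalizing o D with
  | nil =>
    exact ⟨1, by simp, o, D, Runs.single rfl rfl fun k => by cases k <;> rfl⟩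
  | cons a w ih =>
    rcases a with _ | _ | _
    · exact ⟨1, by simp, o, D, Runs.single rfl rfl fun k => by cases k <;> rfl⟩
    · obtain ⟨t, ht, c, D₀, h⟩ := ih .up (o :: D)
      refine ⟨t + 1, by simpa using ht, c, D₀, Runs.trans ?_ h⟩
      exact Runs.single rfl rfl fun k => by cases k <;> rfl
    · obtain ⟨t, ht, c, D₀, h⟩ := ih o.next D
      refine ⟨t + 1, by simpa using ht, c, D₀, Runs.trans ?_ h⟩
      exact Runs.single rfl rfl fun k => by cases k <;> rfl

theorem length_skipString_le {w w' : List (Option Bool)} (h : skipString w = some w') :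
    w'.length ≤ w.length := by
  induction w with
  | nil => cases h
  | cons a w ih =>
    rcases a with _ | b
    · cases h; simp
    · exact (ih h).trans (by simp)

theorem length_parse_le {w w' : List (Option Bool)} {o : Op} {D D' : List Op}
    (h : parse w o D = some (w', D')) : w'.length ≤ w.length ∧ D'.length ≤ w.length + D.length := by
  induction w generalizing o D with
  | nil => cases h
  | cons a w ih =>
    rcases a with _ | _ | _
    · cases h; simp
    · obtain ⟨h1, h2⟩ := ih (o := .up) (D := o :: D) h
      simp only [List.length_cons] at h2 ⊢
      omega
    · obtain ⟨h1, h2⟩ := ih (o := o.next) (D := D) h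
      simp only [List.length_cons] at h2 ⊢
      omega

/-- The final configuration. -/
def final (O : List (Option Bool)) : TM2.Cfg Alph Lab Reg :=
  ⟨none, Reg.init, stks [] [] [] [] [] O⟩

/-- `haltList` demands the initial internal state and empty stacks apart from the output. A pass
pops one symbol from each of the five other stacks; the first pass that finds them all empty halts.
-/
theorem runs_clean (n : ℕ) (ctr : Op) (flag : Bool) (D P : List Op) (s : EvalState)
    (hI : s.inp.length ≤ n) (hD : D.length ≤ n) (hP : P.length ≤ n) (hV : s.mem.length ≤ n)
    (hW : s.aux.length ≤ n) :
    ∃ t ≤ n + 1, Runs t (conf .clean ctr flag D P s) (final s.out) := by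
  induction n generalizing D P s with
  | zero =>
    obtain ⟨I, V, W, O, acc⟩ := s
    simp only [nonpos_iff_eq_zero, List.length_eq_zero_iff] at hI hD hP hV hW
    subst hI hD hP hV hW
    exact ⟨1, by simp, Runs.single rfl rfl fun k => by cases k <;> rfl⟩
  | succ n ih =>
    obtain ⟨I, V, W, O, acc⟩ := s
    have hrec := ih D.tail P.tail ⟨I.tail, V.tail, W.tail, O, acc⟩ (by simp at hI ⊢; omega)
      (by simp; omega) (by simp; omega) (by simp at hV ⊢; omega) (by simp at hW ⊢; omega)
    obtain ⟨t, ht, h⟩ := hrec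
    by_cases hne : I = [] ∧ D = [] ∧ P = [] ∧ V = [] ∧ W = []
    · obtain ⟨rfl, rfl, rfl, rfl, rfl⟩ := hne
      exact ⟨1, by omega, Runs.single rfl rfl fun k => by cases k <;> rfl⟩
    · refine ⟨t + 1, by omega, Runs.trans ?_ h⟩
      rcases I with _ | ⟨i, I⟩ <;> rcases D with _ | ⟨d, D⟩ <;> rcases P with _ | ⟨p, P⟩ <;>
        rcases V with _ | ⟨v, V⟩ <;> rcases W with _ | ⟨w, W⟩ <;>
        first
        | exact Runs.single rfl rfl fun k => by cases k <;> rfl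
        | simp at hne

theorem runs_main (w : List (Option Bool)) :
    ∃ t ≤ 2 * (w.length + 1) + (w.length + 1) * (3 * w.length + 2), ∃ ctr flag D P s,
      s.out = evaluate w ∧ Runs t (conf .skip .up false [] [] ⟨w, [], [], [], false⟩)
        (conf .clean ctr flag D P s) := by
  obtain ⟨t₁, ht₁, h₁⟩ := runs_skip w
  rcases hs : skipString w with _ | w₁
  · rw [hs] at h₁
    exact ⟨t₁, by nlinarith, _, _, _, _, _, by simp [evaluate, hs], h₁⟩
  · rw [hs] at h₁
    obtain ⟨t₂, ht₂, c, D₀, h₂⟩ := runs_parse w₁ .up []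
    have hl₁ := length_skipString_le hs
    rcases hp : parse w₁ .up [] with _ | ⟨w₂, D⟩
    · rw [hp] at h₂
      exact ⟨_, by nlinarith, _, _, _, _, _, by simp [evaluate, hs, hp], h₁.trans h₂⟩
    · rw [hp] at h₂
      obtain ⟨hl₂, hl₃⟩ := length_parse_le hp
      obtain ⟨t₃, ht₃, flag, D', P', s', hs', h₃⟩ :=
        runs_loop (w₂.length + 1) .up ⟨w₂, [], [], [], false⟩ D (by simp)
      refine ⟨_, ?_, _, _, _, _, _, ?_, (h₁.trans h₂).trans h₃⟩
      · simp only [List.length_nil, add_zero] at hl₃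
        have : (w₂.length + 1) * (3 * D.length + 2) ≤ (w.length + 1) * (3 * w.length + 2) :=
          Nat.mul_le_mul (by omega) (by omega)
        omega
      · simp [evaluate, hs, hp, hs']

/-- A stack grows by at most `d` per step, so what is left to clear is at most linear in the input
length and the time spent so far. -/
theorem exists_time : ∃ p : Polynomial ℕ, ∀ w : List (Option Bool), ∃ t ≤ p.eval w.length,
    Runs t (conf .skip .up false [] [] ⟨w, [], [], [], false⟩) (final (evaluate w)) := by
  obtain ⟨d, hd⟩ := exists_length_iterate_nextCfg_le prog
  let q : Polynomial ℕ := 2 * (Polynomial.X + 1) + (Polynomial.X + 1) * (3 * Polynomial.X + 2)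
  refine ⟨q + (Polynomial.X + Polynomial.C d * q + 1), fun w => ?_⟩
  obtain ⟨t, ht, ctr, flag, D, P, s, hs, h⟩ := runs_main w
  have hq : q.eval w.length = 2 * (w.length + 1) + (w.length + 1) * (3 * w.length + 2) := by
    simp [q]
  rw [← hq] at ht
  have hc : (nextCfg prog)^[t] (conf .skip .up false [] [] ⟨w, [], [], [], false⟩) = _ :=
    iterate_getD_of_iterate_bind _ t h
  have hlen : ∀ k, ((conf .clean ctr flag D P s).stk k).length ≤ w.length + d * q.eval w.length := by
    intro k
    have h1 := hd (conf .skip .up false [] [] ⟨w, [], [], [], false⟩) t k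
    rw [hc] at h1
    refine h1.trans (add_le_add ?_ (Nat.mul_le_mul_left _ ht))
    cases k
    · exact le_rfl
    all_goals exact Nat.zero_le _
  obtain ⟨t', ht', h'⟩ := runs_clean _ ctr flag D P s (hlen .I) (hlen .D) (hlen .P) (hlen .V)
    (hlen .W)
  rw [hs] at h'
  refine ⟨_, ?_, h.trans h'⟩
  simp
  omega

end Evaluator

/-! ### Outputs of the evaluator are encodings of tuples -/

theorem encodeStrings_cons (w : List Bool) (l : List (List Bool)) :
    encodeStrings (w :: l) = w.map some ++ none :: encodeStrings l := by
  simp [encodeStrings]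

theorem encodeStrings_injective : Function.Injective encodeStrings := by
  have aux : ∀ (w w' : List Bool) (u u' : List (Option Bool)),
      w.map some ++ none :: u = w'.map some ++ none :: u' → w = w' ∧ u = u' := by
    intro w
    induction w with
    | nil =>
      rintro (_ | ⟨b, w'⟩) u u' h
      · simpa using h
      · simp at h
    | cons a w ih =>
      rintro (_ | ⟨b, w'⟩) u u' h
      · simp at h
      · simp only [List.map_cons, List.cons_append, List.cons.injEq, Option.some.injEq] at h
        obtain ⟨rfl, h⟩ := h
        obtain ⟨rfl, rfl⟩ := ih _ _ _ h
        exact ⟨rfl, rfl⟩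
  intro l
  induction l with
  | nil =>
    rintro (_ | ⟨w, l'⟩) h
    · rfl
    · simp [encodeStrings] at h
  | cons w l ih =>
    rintro (_ | ⟨w', l'⟩) h
    · simp [encodeStrings] at h
    · rw [encodeStrings_cons, encodeStrings_cons] at h
      obtain ⟨h1, h2⟩ := aux _ _ _ _ h
      rw [h1, ih h2]

/-- Once a string is open on the output stack, a new bit extends it at the front and a separator
opens another, empty one. This is why every round begins by pushing a separator. -/
theorem Op.exec_out_mem_range {s : EvalState} (hs : ∃ w l, s.out = encodeStrings (w :: l)) (o : Op) :
    ∃ w l, (o.exec s).out = encodeStrings (w :: l) := by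
  obtain ⟨w, l, h⟩ := hs
  cases o
  case out => exact ⟨s.acc :: w, l, by simp [Op.exec, h, encodeStrings_cons]⟩
  case sep => exact ⟨[], w :: l, by simp [Op.exec, h, encodeStrings_cons]⟩
  all_goals exact ⟨w, l, h⟩

theorem evalLoop_mem_range (n : ℕ) (s : EvalState) (D : List Op)
    (hs : s.out ∈ Set.range encodeStrings) : evalLoop n s D ∈ Set.range encodeStrings := by
  induction n generalizing s D with
  | zero => exact hs
  | succ n ih =>
    rw [evalLoop]
    split_ifs
    · exact hs
    · have h1 : ∀ (P : List Op) (s : EvalState), (∃ w l, s.out = encodeStrings (w :: l)) →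
          ∃ w l, (P.foldl Op.exec s).out = encodeStrings (w :: l) := by
        intro P
        induction P with
        | nil => exact fun s hs => hs
        | cons o P ih => exact fun s hs => ih _ (o.exec_out_mem_range hs)
      obtain ⟨l, hl⟩ := hs
      obtain ⟨w, l', h2⟩ := h1 (rewind D true []).2 { s with out := none :: s.out }
        ⟨[], l, by simp [hl, encodeStrings_cons]⟩
      simp only
      split
      · exact ih _ _ ⟨_, h2.symm⟩
      · exact ⟨_, h2.symm⟩

theorem evaluate_mem_range (w : List (Option Bool)) : evaluate w ∈ Set.range encodeStrings := by
  unfold evaluate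
  have h0 : ([] : List (Option Bool)) ∈ Set.range encodeStrings := ⟨[], rfl⟩
  split
  · exact h0
  · split
    · exact h0
    · exact evalLoop_mem_range _ _ _ h0

theorem Evaluator.initList_machine (w : List (Option Bool)) :
    Turing.initList machine w = conf .skip .up false [] [] ⟨w, [], [], [], false⟩ := by
  simp only [Turing.initList, conf]
  congr 1
  funext k
  cases k <;> rfl

theorem Evaluator.haltList_machine (w : List (Option Bool)) :
    Turing.haltList machine w = final w := by
  simp only [Turing.haltList, final]
  congr 1
  funext k
  cases k <;> rfl

/-- The evaluator runs in polynomial time. -/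
theorem exists_polyTime_evaluate :
    ∃ f, PolyTime f ∧ ∀ l, encodeStrings (f l) = evaluate (encodeStrings l) := by
  choose f hf using fun l : List (List Bool) => evaluate_mem_range (encodeStrings l)
  obtain ⟨p, hp⟩ := Evaluator.exists_time
  refine ⟨f, ⟨?_⟩, hf⟩
  choose t ht hrun using hp
  refine
    { tm := Evaluator.machine
      inputAlphabet := Equiv.refl _
      outputAlphabet := Equiv.refl _
      time := p
      outputsFun := fun l => ⟨⟨t (encodeStrings l), ?_⟩, ht _⟩ }
  have h := hrun (encodeStrings l)
  rw [← hf, ← Evaluator.initList_machine, ← Evaluator.haltList_machine] at h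
  have hid : ∀ w : List (Option Bool), w.map (Equiv.refl (Option Bool)).invFun = w :=
    fun w => List.map_id w
  exact (congrArg (fun w => (flip bind Evaluator.machine.step)^[t (encodeStrings l)]
    (some (Turing.initList Evaluator.machine w))) (hid (encodeStrings l))).trans
    (Eq.trans h (congrArg (fun w => some (Turing.haltList Evaluator.machine w))
      (hid (encodeStrings (f l))).symm))

end LDS

namespace LDS

/-! ### Programs for gates -/

/-- Executes `o` with the cursor at the `j`-th bit of the memory. -/
def Op.access (j : ℕ) (o : Op) : List Op := List.replicate j .up ++ o :: List.replicate j .down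

theorem foldl_exec_replicate_up (j : ℕ) (I : List (Option Bool)) (V W : List Bool)
    (O : List (Option Bool)) (a : Bool) (hj : j ≤ V.length) :
    (List.replicate j Op.up).foldl Op.exec ⟨I, V, W, O, a⟩ =
      ⟨I, V.drop j, (V.take j).reverse ++ W, O, a⟩ := by
  induction j generalizing V W with
  | zero => simp
  | succ j ih =>
    rcases V with _ | ⟨v, V⟩
    · simp at hj
    · rw [List.replicate_succ, List.foldl_cons]
      simp only [Op.exec, List.tail_cons, List.head?_cons, Option.getD_some]
      rw [ih _ _ (by simpa using hj)]
      simp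

theorem foldl_exec_replicate_down (j : ℕ) (I : List (Option Bool)) (V W : List Bool)
    (O : List (Option Bool)) (a : Bool) (hj : j ≤ W.length) :
    (List.replicate j Op.down).foldl Op.exec ⟨I, V, W, O, a⟩ =
      ⟨I, (W.take j).reverse ++ V, W.drop j, O, a⟩ := by
  induction j generalizing V W with
  | zero => simp
  | succ j ih =>
    rcases W with _ | ⟨v, W⟩
    · simp at hj
    · rw [List.replicate_succ, List.foldl_cons]
      simp only [Op.exec, List.tail_cons, List.head?_cons, Option.getD_some]
      rw [ih _ _ (by simpa using hj)]
      simp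

theorem foldl_exec_access_ld (j : ℕ) (I : List (Option Bool)) (V W : List Bool)
    (O : List (Option Bool)) (a b : Bool) (hj : V[j]? = some b) :
    (Op.access j .ld).foldl Op.exec ⟨I, V, W, O, a⟩ = ⟨I, V, W, O, b⟩ := by
  have hlt : j < V.length := (List.getElem?_eq_some_iff.1 hj).1
  have hlen : ((V.take j).reverse).length = j := by simp; omega
  rw [Op.access, List.foldl_append, List.foldl_cons, foldl_exec_replicate_up _ _ _ _ _ _ hlt.le]
  simp only [Op.exec]
  rw [foldl_exec_replicate_down _ _ _ _ _ _ (by simp; omega), List.take_append_of_le_length hlen.ge,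
    List.drop_append_of_le_length hlen.ge, List.take_of_length_le hlen.le,
    List.drop_of_length_le hlen.le]
  simp [hj]

theorem foldl_exec_access_and (j : ℕ) (I : List (Option Bool)) (V W : List Bool)
    (O : List (Option Bool)) (a b : Bool) (hj : V[j]? = some b) :
    (Op.access j .and).foldl Op.exec ⟨I, V, W, O, a⟩ = ⟨I, V, W, O, a && b⟩ := by
  have hlt : j < V.length := (List.getElem?_eq_some_iff.1 hj).1
  have hlen : ((V.take j).reverse).length = j := by simp; omega
  rw [Op.access, List.foldl_append, List.foldl_cons, foldl_exec_replicate_up _ _ _ _ _ _ hlt.le]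
  simp only [Op.exec]
  rw [foldl_exec_replicate_down _ _ _ _ _ _ (by simp; omega), List.take_append_of_le_length hlen.ge,
    List.drop_append_of_le_length hlen.ge, List.take_of_length_le hlen.le,
    List.drop_of_length_le hlen.le]
  simp [hj]

theorem length_access (j : ℕ) (o : Op) : (Op.access j o).length = 2 * j + 1 := by
  simp [Op.access]; omega

/-- The program does not touch the counter. -/
def NoCounter (P : List Op) : Prop := ∀ o ∈ P, o ≠ .cnt0 ∧ o ≠ .cnt1

theorem NoCounter.append {P Q : List Op} (hP : NoCounter P) (hQ : NoCounter Q) :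
    NoCounter (P ++ Q) := fun o ho =>
  (List.mem_append.1 ho).elim (hP o) (hQ o)

theorem noCounter_access (j : ℕ) {o : Op} (h : o ≠ .cnt0 ∧ o ≠ .cnt1) :
    NoCounter (Op.access j o) := by
  intro o' ho'
  simp only [Op.access, List.mem_append, List.mem_cons, List.mem_replicate] at ho'
  rcases ho' with ⟨_, rfl⟩ | rfl | ⟨_, rfl⟩
  · simp
  · exact h
  · simp

theorem exists_getElem?_of_mem {X : Type} {L : List (X → Bool)} {φ : X → Bool} (h : φ ∈ L) :
    ∃ j ≤ L.length, ∀ x M, (L.map (· x) ++ M)[j]? = some (φ x) := by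
  obtain ⟨j, hj, rfl⟩ := List.getElem_of_mem h
  refine ⟨j, hj.le, fun x M => ?_⟩
  rw [List.getElem?_append_left (by simpa using hj)]
  simp [hj]

theorem exists_load_program {X : Type} (L : List (X → Bool)) {φ : X → Bool} (h : φ ∈ L) :
    ∃ P : List Op, P.length ≤ 2 * L.length + 1 ∧ NoCounter P ∧ ∀ x I M W O a,
      P.foldl Op.exec ⟨I, L.map (· x) ++ M, W, O, a⟩ = ⟨I, L.map (· x) ++ M, W, O, φ x⟩ := by
  obtain ⟨j, hj, hφ⟩ := exists_getElem?_of_mem h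
  exact ⟨Op.access j .ld, by rw [length_access]; omega, noCounter_access j (by simp),
    fun x I M W O a => foldl_exec_access_ld j I _ W O a _ (hφ x M)⟩

/-- The memory is a stack and `l` is listed newest first, so the address of a wire is its position
in `l ++ L`; older contents `M` lie below and are not disturbed. A gate needs at most two accesses,
each linear in the number of wires. -/
theorem Gates.exists_program {X : Type} {B : Set (X → Bool)} {l : List (X → Bool)}
    (hl : Gates B l) (L : List (X → Bool)) (hB : ∀ φ ∈ B, φ ∈ L) :
    ∃ P : List Op, P.length ≤ l.length * (4 * (l.length + L.length) + 4) ∧ NoCounter P ∧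
      ∀ x I M W O a, ∃ a', P.foldl Op.exec ⟨I, L.map (· x) ++ M, W, O, a⟩ =
        ⟨I, (l ++ L).map (· x) ++ M, W, O, a'⟩ := by
  have key : ∀ {l : List (X → Bool)} {φ : X → Bool}, (φ ∈ B ∨ φ ∈ l) → φ ∈ l ++ L := fun h =>
    List.mem_append.2 (h.symm.imp_right (hB _))
  induction hl with
  | nil => exact ⟨[], by simp, by simp [NoCounter], fun x I M W O a => ⟨a, rfl⟩⟩
  | @const b l _ ih =>
    obtain ⟨P, hlen, hP, h⟩ := ih
    refine ⟨P ++ (.clr :: (if b then [.not, .push] else [.push])), ?_, ?_, ?_⟩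
    · have : (if b then [Op.not, .push] else [.push]).length ≤ 2 := by cases b <;> simp
      simp only [List.length_append, List.length_cons]
      nlinarith
    · refine hP.append ?_
      cases b <;> simp [NoCounter]
    · intro x I M W O a
      obtain ⟨a', h'⟩ := h x I M W O a
      refine ⟨b, ?_⟩
      rw [List.foldl_append, h']
      cases b <;> simp [Op.exec]
  | @not l φ _ hφ ih =>
    obtain ⟨P, hlen, hP, h⟩ := ih
    obtain ⟨P₁, hlen₁, hP₁, h₁⟩ := exists_load_program (l ++ L) (key hφ)
    refine ⟨P ++ (P₁ ++ [.not, .push]), ?_, hP.append (hP₁.append (by simp [NoCounter])), ?_⟩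
    · simp only [List.length_append, List.length_cons, List.length_nil] at hlen₁ ⊢
      nlinarith
    · intro x I M W O a
      obtain ⟨a', h'⟩ := h x I M W O a
      refine ⟨!φ x, ?_⟩
      rw [List.foldl_append, h', List.foldl_append, h₁]
      simp [Op.exec]
  | @and l φ ψ _ hφ hψ ih =>
    obtain ⟨P, hlen, hP, h⟩ := ih
    obtain ⟨P₁, hlen₁, hP₁, h₁⟩ := exists_load_program (l ++ L) (key hφ)
    obtain ⟨j, hj, hψ'⟩ := exists_getElem?_of_mem (key hψ)
    refine ⟨P ++ (P₁ ++ (Op.access j .and ++ [.push])), ?_,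
      hP.append (hP₁.append ((noCounter_access j (by simp)).append (by simp [NoCounter]))), ?_⟩
    · simp only [List.length_append, List.length_cons, List.length_nil, length_access] at hlen₁ hj ⊢
      nlinarith
    · intro x I M W O a
      obtain ⟨a', h'⟩ := h x I M W O a
      refine ⟨φ x && ψ x, ?_⟩
      rw [List.foldl_append, h', List.foldl_append, h₁, List.foldl_append,
        foldl_exec_access_and j _ _ _ _ _ _ (hψ' x M)]
      simp [Op.exec]

/-- The symbols that a list of wires and separators stands for. -/
def emit {X : Type} (E : List (Option (X → Bool))) (x : X) : List (Option Bool) :=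
  E.map fun e => e.map (· x)

/-- The output is a stack too, so the program for the tail of `E` runs before its head is written.
-/
theorem exists_emit_program {X : Type} (L : List (X → Bool)) (E : List (Option (X → Bool)))
    (hE : ∀ φ, some φ ∈ E → φ ∈ L) :
    ∃ P : List Op, P.length ≤ E.length * (2 * L.length + 2) ∧ NoCounter P ∧
      ∀ x I M W O a, ∃ a', P.foldl Op.exec ⟨I, L.map (· x) ++ M, W, O, a⟩ =
        ⟨I, L.map (· x) ++ M, W, emit E x ++ O, a'⟩ := by
  induction E with
  | nil => exact ⟨[], by simp, by simp [NoCounter], fun x I M W O a => ⟨a, rfl⟩⟩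
  | cons e E ih =>
    obtain ⟨P, hlen, hP, h⟩ := ih fun φ hφ => hE φ (List.mem_cons_of_mem _ hφ)
    rcases e with _ | φ
    · refine ⟨P ++ [.sep], by simp; nlinarith, hP.append (by simp [NoCounter]), ?_⟩
      intro x I M W O a
      obtain ⟨a', h'⟩ := h x I M W O a
      refine ⟨a', ?_⟩
      rw [List.foldl_append, h']
      simp [Op.exec, emit]
    · obtain ⟨P₁, hlen₁, hP₁, h₁⟩ := exists_load_program L (hE φ (by simp))
      refine ⟨P ++ (P₁ ++ [.out]), by simp; nlinarith,
        hP.append (hP₁.append (by simp [NoCounter])), ?_⟩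
      intro x I M W O a
      obtain ⟨a', h'⟩ := h x I M W O a
      refine ⟨φ x, ?_⟩
      rw [List.foldl_append, h', List.foldl_append, h₁]
      simp [Op.exec, emit]

theorem exists_coin_program (m : ℕ) :
    ∃ P : List Op, P.length ≤ 2 * m ∧ NoCounter P ∧ ∀ (cs : List Bool), cs.length = m →
      ∀ I M W O a, ∃ a', P.foldl Op.exec ⟨cs.map some ++ I, M, W, O, a⟩ =
        ⟨I, cs.reverse ++ M, W, O, a'⟩ := by
  induction m with
  | zero =>
    refine ⟨[], by simp, by simp [NoCounter], fun cs hcs I M W O a => ⟨a, ?_⟩⟩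
    simp [List.length_eq_zero_iff.1 hcs]
  | succ m ih =>
    obtain ⟨P, hlen, hP, h⟩ := ih
    refine ⟨.coin :: .push :: P, by simp; omega, ?_, ?_⟩
    · exact NoCounter.append (P := [.coin, .push]) (by simp [NoCounter]) hP
    · rintro (_ | ⟨c, cs⟩) hcs I M W O a
      · simp at hcs
      · obtain ⟨a', h'⟩ := h cs (by simpa using hcs) I (c :: M) W O c
        refine ⟨a', ?_⟩
        simpa [Op.exec, symBit] using h'

/-- A program that reads `m` coins and emits functions of them. -/
theorem Comp.exists_program {m c : ℕ} (E : List (Option ((Fin m → Bool) → Bool)))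
    (h : Comp (Set.range fun (i : Fin m) (x : Fin m → Bool) => x i) c {φ | some φ ∈ E}) :
    ∃ P : List Op, P.length ≤ 2 * m + c * (4 * (c + m) + 4) + E.length * (2 * (c + m) + 2) ∧
      NoCounter P ∧ ∀ x I M O a, ∃ M' a',
        P.foldl Op.exec ⟨(bits x).map some ++ I, M, [], O, a⟩ = ⟨I, M', [], emit E x ++ O, a'⟩ := by
  obtain ⟨l, hl, hc, hE⟩ := h
  let L : List ((Fin m → Bool) → Bool) := (List.ofFn fun (i : Fin m) (x : Fin m → Bool) => x i).reverse
  have hLlen : L.length = m := by simp [L]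
  have hL : ∀ x : Fin m → Bool, L.map (· x) = (bits x).reverse := by
    intro x
    simp [L, bits, List.map_ofFn, Function.comp_def]
  have hB : ∀ φ ∈ Set.range fun (i : Fin m) (x : Fin m → Bool) => x i, φ ∈ L := by
    rintro _ ⟨i, rfl⟩
    simp [L, List.mem_ofFn]
  obtain ⟨P₁, hlen₁, hP₁, h₁⟩ := exists_coin_program m
  obtain ⟨P₂, hlen₂, hP₂, h₂⟩ := hl.exists_program L hB
  obtain ⟨P₃, hlen₃, hP₃, h₃⟩ := exists_emit_program (l ++ L) E fun φ hφ =>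
    List.mem_append.2 ((hE φ hφ).symm.imp_right (hB φ))
  refine ⟨P₁ ++ (P₂ ++ P₃), ?_, hP₁.append (hP₂.append hP₃), ?_⟩
  · simp only [List.length_append, hLlen] at hlen₂ hlen₃ ⊢
    have h4 : l.length * (4 * (l.length + m) + 4) ≤ c * (4 * (c + m) + 4) :=
      Nat.mul_le_mul hc (by omega)
    have h5 : E.length * (2 * (l.length + m) + 2) ≤ E.length * (2 * (c + m) + 2) :=
      Nat.mul_le_mul_left _ (by omega)
    omega
  · intro x I M O a
    obtain ⟨a₁, e₁⟩ := h₁ (bits x) (by simp [bits]) I M [] O a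
    obtain ⟨a₂, e₂⟩ := h₂ x I M [] O a₁
    obtain ⟨a₃, e₃⟩ := h₃ x I M [] O a₂
    rw [← hL] at e₁
    refine ⟨(l ++ L).map (· x) ++ M, a₃, ?_⟩
    rw [List.foldl_append, e₁, List.foldl_append, e₂, e₃]

/-! ### The counter -/

/-- The digits of `c` in a counter of width `w`, lowest digit first. -/
def counter : ℕ → ℕ → List Op
  | 0, _ => []
  | w + 1, c => (if c % 2 = 1 then .cnt1 else .cnt0) :: counter w (c / 2)

theorem length_counter (w c : ℕ) : (counter w c).length = w := by
  induction w generalizing c with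
  | zero => rfl
  | succ w ih => simp [counter, ih]

theorem foldl_exec_counter (w c : ℕ) (s : EvalState) :
    (counter w c).reverse.foldl Op.exec s = s := by
  induction w generalizing c s with
  | zero => rfl
  | succ w ih =>
    rw [counter, List.reverse_cons, List.foldl_append, ih]
    split_ifs <;> rfl

theorem rewind_counter_false (w c : ℕ) (D P : List Op) :
    rewind (counter w c ++ D) false P = rewind D false ((counter w c).reverse ++ P) := by
  induction w generalizing c P with
  | zero => rfl
  | succ w ih =>
    rw [counter, List.cons_append, rewind]
    have : ∀ o : Op, o.decr false = (o, false) := by intro o; cases o <;> rfl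
    rw [this, ih]
    simp

/-- Binary decrement during the reversal: the counter is met lowest digit first, and the borrow is
absorbed by the first digit 1, so it has vanished when `D` is reached. -/
theorem rewind_counter_succ (w c : ℕ) (hc : c + 1 < 2 ^ w) (D P : List Op) :
    rewind (counter w (c + 1) ++ D) true P = rewind D false ((counter w c).reverse ++ P) := by
  induction w generalizing c P with
  | zero => simp at hc
  | succ w ih =>
    rw [counter, counter, List.cons_append, rewind]
    rcases Nat.even_or_odd' c with ⟨k, rfl | rfl⟩
    · have h1 : (2 * k + 1) % 2 = 1 := by omega
      have h2 : (2 * k) % 2 = 0 := by omega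
      have h3 : (2 * k + 1) / 2 = k := by omega
      have h4 : 2 * k / 2 = k := by omega
      rw [h1, h2, h3, h4]
      simp only [if_true, Op.decr]
      rw [rewind_counter_false]
      simp
    · have h1 : (2 * k + 1 + 1) % 2 = 0 := by omega
      have h2 : (2 * k + 1) % 2 = 1 := by omega
      have h3 : (2 * k + 1 + 1) / 2 = k + 1 := by omega
      have h4 : (2 * k + 1) / 2 = k := by omega
      rw [h1, h2, h3, h4]
      simp only [zero_ne_one, if_false, if_true, Op.decr]
      rw [ih k (by rw [pow_succ] at hc; omega)]
      simp

/-- With all digits zero nothing absorbs the borrow. A borrow that survives the whole program is the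
signal that stops `evalLoop`. -/
theorem rewind_counter_zero (w : ℕ) (D P : List Op) :
    ∃ P', rewind (counter w 0 ++ D) true P = rewind D true P' := by
  induction w generalizing P with
  | zero => exact ⟨P, rfl⟩
  | succ w ih => exact ih _

theorem rewind_noCounter {D : List Op} (hD : NoCounter D) (b : Bool) (P : List Op) :
    rewind D b P = (b, D.reverse ++ P) := by
  induction D generalizing P with
  | nil => rfl
  | cons o D ih =>
    have h1 : o.decr b = (o, b) := by
      have := hD o (by simp)
      cases o <;> cases b <;> simp_all [Op.decr]
    rw [rewind, h1, ih fun o ho => hD o (List.mem_cons_of_mem _ ho)]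
    simp

/-- The reversed program that repeats `P` exactly `c` times. -/
def repeatProgram (w c : ℕ) (P : List Op) : List Op := counter w c ++ P.reverse

/-- The counter forms the end of the program in execution order, where it acts as a no-op; each
rewind lowers it by one. Later blocks appear in front because the output is a stack. -/
theorem evalLoop_repeatProgram {m : ℕ} {P : List Op} (hP : NoCounter P)
    (E : List (Option ((Fin m → Bool) → Bool)))
    (hE : ∀ x I M O a, ∃ M' a', P.foldl Op.exec ⟨(bits x).map some ++ I, M, [], O, a⟩ =
      ⟨I, M', [], emit E x ++ O, a'⟩)
    (w : ℕ) (x : Fin m → Bool) (xs : List (Bool × (Fin m → Bool))) (hw : xs.length + 1 < 2 ^ w)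
    (n : ℕ) (hn : xs.length < n) (tail : List (Option Bool)) (M : List Bool)
    (O : List (Option Bool)) (a : Bool) :
    evalLoop n ⟨(bits x).map some ++ (xs.flatMap (fun y => some y.1 :: (bits y.2).map some) ++ tail),
      M, [], O, a⟩ (repeatProgram w (xs.length + 1) P) =
      (xs.reverse.flatMap fun y => emit E y.2 ++ [none]) ++ (emit E x ++ [none]) ++ O := by
  have hPr : NoCounter P.reverse := fun o ho => hP o (List.mem_reverse.1 ho)
  induction xs generalizing x n M O a with
  | nil =>
    rcases n with _ | n
    · simp at hn
    · have h1 : rewind (repeatProgram w (0 + 1) P) true [] =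
          (false, P ++ (counter w 0).reverse) := by
        rw [repeatProgram, rewind_counter_succ w 0 (by simpa using hw), rewind_noCounter hPr]
        simp
      obtain ⟨M', a', h2⟩ := hE x tail M (none :: O) a
      rw [List.length_nil, evalLoop, h1]
      simp only [Bool.false_eq_true, if_false, List.flatMap_nil, List.nil_append, List.foldl_append,
        h2, foldl_exec_counter, List.reverse_nil, List.append_assoc, List.cons_append]
      -- If another bit follows, the next rewind finds the counter at zero and stops without
      -- writing; running out of fuel or of input gives the same output.
      split
      · rcases n with _ | n
        · rfl
        · rw [evalLoop, List.reverse_append, List.reverse_reverse]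
          obtain ⟨P', h3⟩ := rewind_counter_zero w P.reverse []
          rw [h3, rewind_noCounter hPr]
          simp
      · rfl
  | cons y xs ih =>
    rcases n with _ | n
    · simp at hn
    · have h1 : rewind (repeatProgram w ((y :: xs).length + 1) P) true [] =
          (false, P ++ (counter w (xs.length + 1)).reverse) := by
        rw [repeatProgram, List.length_cons, rewind_counter_succ w _ (by simpa using hw),
          rewind_noCounter hPr]
        simp
      obtain ⟨M', a', h2⟩ := hE x (((y :: xs).flatMap fun y => some y.1 :: (bits y.2).map some) ++ tail)
        M (none :: O) a
      rw [evalLoop, h1]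
      simp only [Bool.false_eq_true, if_false, List.foldl_append, h2, foldl_exec_counter]
      simp only [List.flatMap_cons, List.cons_append, List.append_assoc, List.reverse_append,
        List.reverse_reverse]
      have h3 := ih y.2 (by simp at hw; omega) n (by simpa using hn) M' (emit E x ++ none :: O) a'
      rw [repeatProgram] at h3
      rw [h3]
      simp

/-- Only a `false` completes an instruction, so trailing ones are discarded at the separator. This
allows advice to be padded to a prescribed length. -/
theorem parse_code (P : List Op) (pad : ℕ) (w : List (Option Bool)) (D : List Op) :
    parse ((P.flatMap Op.code ++ List.replicate pad true).map some ++ none :: w) .up D =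
      some (w, P.reverse ++ D) := by
  have hrep : ∀ (k : ℕ) (o : Op) (v : List (Option Bool)) (D : List Op),
      parse (List.replicate k (some true) ++ v) o D = parse v (Op.next^[k] o) D := by
    intro k
    induction k with
    | zero => exact fun _ _ _ => rfl
    | succ k ih =>
      intro o v D
      rw [List.replicate_succ, List.cons_append, parse, ih, Function.iterate_succ_apply]
  induction P generalizing D with
  | nil =>
    simp only [List.flatMap_nil, List.nil_append, List.map_replicate, List.reverse_nil]
    rw [hrep, parse]
  | cons o P ih =>
    have hidx : Op.next^[o.index] .up = o := by cases o <;> rfl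
    have h1 : ((o :: P).flatMap Op.code ++ List.replicate pad true).map some ++ none :: w =
        List.replicate o.index (some true) ++ (some false ::
          ((P.flatMap Op.code ++ List.replicate pad true).map some ++ none :: w)) := by
      simp [Op.code]
    rw [h1, hrep, hidx, parse, ih]
    simp

theorem length_flatMap_code_le (P : List Op) : (P.flatMap Op.code).length ≤ 12 * P.length := by
  induction P with
  | nil => simp
  | cons o P ih =>
    have : o.code.length ≤ 12 := by cases o <;> simp [Op.code, Op.index]
    simp only [List.flatMap_cons, List.length_append, List.length_cons]
    omega

/-- The advice for the evaluator: the code of the program that repeats `P` exactly `c` times. -/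
def adviceOf (w c : ℕ) (P : List Op) : List Bool := (repeatProgram w c P).reverse.flatMap Op.code

theorem length_adviceOf_le (w c : ℕ) (P : List Op) :
    (adviceOf w c P).length ≤ 12 * (P.length + w) := by
  refine (length_flatMap_code_le _).trans ?_
  simp [repeatProgram, length_counter]

theorem evaluate_encodeStrings (n w c pad : ℕ) (P : List Op) (ρ : List Bool) :
    evaluate (encodeStrings [ones n, adviceOf w c P ++ List.replicate pad true, ρ]) =
      evalLoop (ρ.length + 2) ⟨ρ.map some ++ [none], [], [], [], false⟩ (repeatProgram w c P) := by
  have h1 : ∀ (n : ℕ) (v : List (Option Bool)),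
      skipString ((ones n).map some ++ none :: v) = some v := by
    intro n v
    induction n with
    | zero => rfl
    | succ n ih => exact ih
  rw [encodeStrings_cons, encodeStrings_cons, encodeStrings_cons, evaluate, h1]
  simp only
  rw [adviceOf, parse_code]
  simp [encodeStrings]

/-- The `i`-th block of `m` coins; the blocks are separated by single coins. -/
def coinBlock (m : ℕ) (ρ : List Bool) (i : ℕ) : Fin m → Bool := fun j =>
  ρ.getD (i * (m + 1) + j) false

/-- The stride is `m + 1` because the evaluator discards one coin between rounds when it checks that
input remains. -/
theorem take_eq_coinBlocks (m : ℕ) (ρ : List Bool) (k : ℕ) (h : k * (m + 1) + m ≤ ρ.length) :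
    ρ.take (k * (m + 1) + m) = bits (coinBlock m ρ 0) ++ (List.range k).flatMap fun i =>
      ρ.getD (i * (m + 1) + m) false :: bits (coinBlock m ρ (i + 1)) := by
  induction k with
  | zero =>
    simp only [zero_mul, zero_add] at h
    simp only [zero_mul, zero_add, List.range_zero, List.flatMap_nil, List.append_nil, bits]
    apply List.ext_getElem
    · simpa using h
    · intro i h1 h2
      simp only [List.length_take] at h1
      simp [coinBlock, List.getD_eq_getElem?_getD, List.getElem?_eq_getElem (l := ρ) (i := i) (by omega)]
  | succ k ih =>
    have e : (k + 1) * (m + 1) + m = (k * (m + 1) + m) + (m + 1) := by ring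
    rw [e] at h ⊢
    rw [List.take_add, ih (by omega), List.range_succ, List.flatMap_append, List.append_assoc]
    congr 2
    apply List.ext_getElem
    · simp [bits]; omega
    · intro i h1 h2
      simp only [List.length_take, List.length_drop] at h1
      rcases i with _ | i
      · simp [List.getD_eq_getElem?_getD,
          List.getElem?_eq_getElem (l := ρ) (i := k * (m + 1) + m) (by omega)]
      · have e2 : (k + 1) * (m + 1) + i = k * (m + 1) + m + (i + 1) := by ring
        simp [bits, coinBlock, List.getD_eq_getElem?_getD, e2,
          List.getElem?_eq_getElem (l := ρ) (i := k * (m + 1) + m + (i + 1)) (by omega)]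

/-! ### Running a program that is given as advice -/

section Evaluation

variable {f : List (List Bool) → List (List Bool)}
  (hf : ∀ l, encodeStrings (f l) = evaluate (encodeStrings l)) {m : ℕ} {P : List Op}
  (hP : NoCounter P)

include hf hP

/-- A single evaluation of a program. -/
theorem eval_program_once (E : List (Option ((Fin m → Bool) → Bool)))
    (hE : ∀ x I M O a, ∃ M' a', P.foldl Op.exec ⟨(bits x).map some ++ I, M, [], O, a⟩ =
      ⟨I, M', [], emit E x ++ O, a'⟩) (n : ℕ) (x : Fin m → Bool) (out : List (List Bool))
    (hout : encodeStrings out = emit E x ++ [none]) :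
    f [ones n, adviceOf 2 1 P, bits x] = out := by
  apply encodeStrings_injective
  have h := evaluate_encodeStrings n 2 1 0 P (bits x)
  rw [List.replicate_zero, List.append_nil] at h
  rw [hf, h, hout]
  simpa using evalLoop_repeatProgram hP E hE 2 x [] (by simp) ((bits x).length + 2) (by simp)
    [none] [] [] false

/-- Repeated evaluation of a program on consecutive blocks of coins. -/
theorem eval_program_repeat {N : ℕ} (Y : (Fin m → Bool) → Fin N → Bool)
    (hE : ∀ x I M O a, ∃ M' a', P.foldl Op.exec ⟨(bits x).map some ++ I, M, [], O, a⟩ =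
      ⟨I, M', [], emit (List.ofFn fun i => some fun x => Y x i) x ++ O, a'⟩)
    (n pad w K : ℕ) (hK : 0 < K) (hw : K < 2 ^ w) (ρ : List Bool) (hρ : K * (m + 1) ≤ ρ.length) :
    f [ones n, adviceOf w K P ++ List.replicate pad true, ρ] =
      List.ofFn fun i : Fin K => bits (Y (coinBlock m ρ i.rev)) := by
  obtain ⟨k, rfl⟩ : ∃ k, K = k + 1 := ⟨K - 1, by omega⟩
  apply encodeStrings_injective
  rw [hf, evaluate_encodeStrings]
  have hk : k * (m + 1) + m ≤ ρ.length := by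
    have : (k + 1) * (m + 1) = k * (m + 1) + m + 1 := by ring
    omega
  have hdec := take_eq_coinBlocks m ρ k hk
  let xs : List (Bool × (Fin m → Bool)) := (List.range k).map fun i =>
    (ρ.getD (i * (m + 1) + m) false, coinBlock m ρ (i + 1))
  have hxs : xs.length = k := by simp [xs]
  have hρ' : ρ.map some ++ [none] = (bits (coinBlock m ρ 0)).map some ++
      (xs.flatMap (fun y => some y.1 :: (bits y.2).map some) ++
        ((ρ.drop (k * (m + 1) + m)).map some ++ [none])) := by
    conv_lhs => rw [← List.take_append_drop (k * (m + 1) + m) ρ, hdec]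
    simp [xs, List.flatMap_map, List.map_flatMap]
  have hmain := evalLoop_repeatProgram hP _ hE w (coinBlock m ρ 0) xs (by rw [hxs]; exact hw)
    (ρ.length + 2) (by
      rw [hxs]
      have : k ≤ k * (m + 1) := Nat.le_mul_of_pos_right _ (by omega)
      omega) ((ρ.drop (k * (m + 1) + m)).map some ++ [none]) [] [] false
  rw [hxs] at hmain
  rw [hρ', hmain]
  have hemit : ∀ x, emit (List.ofFn fun i => some fun x => Y x i) x = (bits (Y x)).map some := by
    intro x
    simp [emit, bits, List.map_ofFn, Function.comp_def]
  -- The index is reversed since the string of a later block is written in front of the earlier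
  -- ones.
  have hlist : (List.ofFn fun i : Fin (k + 1) => bits (Y (coinBlock m ρ i.rev))) =
      (List.range (k + 1)).reverse.map fun i => bits (Y (coinBlock m ρ i)) := by
    apply List.ext_getElem
    · simp
    · intro i h1 h2
      have h3 : k + 1 - (i + 1) = k + 1 - 1 - i := by omega
      rw [List.getElem_ofFn, List.getElem_map, List.getElem_reverse, List.getElem_range]
      simp [Fin.rev, h3]
  rw [hlist, List.range_succ_eq_map]
  simp only [hemit, encodeStrings, List.reverse_cons, List.map_append, List.flatMap_append,
    List.map_cons, List.map_nil, List.flatMap_cons, List.flatMap_nil, List.append_nil]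
  simp [xs, List.flatMap_map, ← List.map_reverse]

end Evaluation

end LDS

namespace LDS

/-! ### Polynomially bounded functions -/

/-- `g` is bounded by a polynomial. -/
def PolyBounded (g : ℕ → ℕ) : Prop := ∃ p : Polynomial ℕ, ∀ n, g n ≤ p.eval n

namespace PolyBounded

variable {g h : ℕ → ℕ}

theorem const (c : ℕ) : PolyBounded fun _ => c := ⟨Polynomial.C c, by simp⟩

theorem id : PolyBounded fun n => n := ⟨Polynomial.X, by simp⟩

theorem eval (p : Polynomial ℕ) : PolyBounded fun n => p.eval n := ⟨p, fun _ => le_rfl⟩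

theorem add (hg : PolyBounded g) (hh : PolyBounded h) : PolyBounded fun n => g n + h n := by
  obtain ⟨p, hp⟩ := hg
  obtain ⟨q, hq⟩ := hh
  exact ⟨p + q, fun n => by simpa using add_le_add (hp n) (hq n)⟩

theorem mul (hg : PolyBounded g) (hh : PolyBounded h) : PolyBounded fun n => g n * h n := by
  obtain ⟨p, hp⟩ := hg
  obtain ⟨q, hq⟩ := hh
  exact ⟨p * q, fun n => by simpa using Nat.mul_le_mul (hp n) (hq n)⟩

theorem mono (hg : PolyBounded g) (h' : ∀ n, h n ≤ g n) : PolyBounded h := by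
  obtain ⟨p, hp⟩ := hg
  exact ⟨p, fun n => (h' n).trans (hp n)⟩

theorem eval_comp (p : Polynomial ℕ) (hg : PolyBounded g) : PolyBounded fun n => p.eval (g n) := by
  obtain ⟨q, hq⟩ := hg
  exact ⟨p.comp q, fun n => by
    rw [Polynomial.eval_comp]
    exact nat_polynomial_eval_mono p (hq n)⟩

end PolyBounded

/-! ### Circuits from gates -/

/-- Circuit wires are numbered oldest first, after those of `L`, hence `L ++ l.reverse`. Unary
addresses make the code at most quadratic in the number of wires. -/
theorem Gates.exists_gates {X : Type} {n : ℕ} {B : Set (X → Bool)} {l : List (X → Bool)}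
    (hl : Gates B l) (L : List (X → Bool)) (hB : ∀ φ ∈ B, φ ∈ L) :
    ∃ gs : List (Gate n), gs.length = l.length ∧
      (gs.flatMap Gate.code).length ≤ l.length * (2 * (L.length + l.length) + 5) ∧
      (∀ (i : ℕ) (h : i < gs.length), ∀ j ∈ gs[i].refs, j < L.length + i) ∧
      ∀ (z : Fin n → Bool) (x : X), gs.foldl (fun w g => w ++ [g.eval z w]) (L.map (· x)) =
        (L ++ l.reverse).map (· x) := by
  have key : ∀ {l : List (X → Bool)} {φ : X → Bool}, (φ ∈ B ∨ φ ∈ l) →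
      ∃ j < L.length + l.length, ∀ x, ((L ++ l.reverse).map (· x)).getD j false = φ x := by
    intro l φ h
    have hmem : φ ∈ L ++ l.reverse := by
      rcases h with h | h
      · exact List.mem_append_left _ (hB _ h)
      · exact List.mem_append_right _ (List.mem_reverse.2 h)
    obtain ⟨j, hj, rfl⟩ := List.getElem_of_mem hmem
    refine ⟨j, by simpa using hj, fun x => ?_⟩
    rw [List.getD_eq_getElem?_getD, List.getElem?_map, List.getElem?_eq_getElem hj]
    rfl
  have wf : ∀ {gs : List (Gate n)} {g : Gate n} {N : ℕ}, gs.length = N →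
      (∀ (i : ℕ) (h : i < gs.length), ∀ j ∈ gs[i].refs, j < L.length + i) →
      (∀ j ∈ g.refs, j < L.length + N) →
      ∀ (i : ℕ) (h : i < (gs ++ [g]).length), ∀ j ∈ (gs ++ [g])[i].refs, j < L.length + i := by
    intro gs g N hN h1 h2 i hi j hj
    by_cases hi' : i < gs.length
    · rw [List.getElem_append_left hi'] at hj
      exact h1 i hi' j hj
    · have : i = gs.length := by simp at hi; omega
      subst this
      rw [List.getElem_append_right le_rfl] at hj
      rw [hN]
      exact h2 j (by simpa using hj)
  have len : ∀ {gs : List (Gate n)} {g : Gate n} {N : ℕ},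
      (gs.flatMap Gate.code).length ≤ N * (2 * (L.length + N) + 5) →
      g.code.length ≤ 2 * (L.length + N) + 5 →
      ((gs ++ [g]).flatMap Gate.code).length ≤ (N + 1) * (2 * (L.length + (N + 1)) + 5) := by
    intro gs g N h1 h2
    simp only [List.flatMap_append, List.length_append, List.flatMap_cons, List.flatMap_nil,
      List.append_nil]
    nlinarith
  induction hl with
  | nil => exact ⟨[], rfl, by simp, by simp, by simp⟩
  | const b _ ih =>
    obtain ⟨gs, h1, h2, h3, h4⟩ := ih
    refine ⟨gs ++ [.const b], by simp [h1], len h2 ?_, wf h1 h3 (by simp [Gate.refs]), ?_⟩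
    · simp [Gate.code]
    · intro z x
      rw [List.foldl_append, h4]
      simp [Gate.eval]
  | not _ hφ ih =>
    obtain ⟨gs, h1, h2, h3, h4⟩ := ih
    obtain ⟨j, hj, hj'⟩ := key hφ
    refine ⟨gs ++ [.not j], by simp [h1], len h2 ?_, wf h1 h3 ?_, ?_⟩
    · simp [Gate.code, Gate.unary]; omega
    · simpa [Gate.refs] using hj
    · intro z x
      rw [List.foldl_append, h4, List.foldl_cons, List.foldl_nil, Gate.eval, hj']
      simp
  | and _ hφ hψ ih =>
    obtain ⟨gs, h1, h2, h3, h4⟩ := ih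
    obtain ⟨j, hj, hj'⟩ := key hφ
    obtain ⟨k, hk, hk'⟩ := key hψ
    refine ⟨gs ++ [.and j k], by simp [h1], len h2 ?_, wf h1 h3 ?_, ?_⟩
    · simp [Gate.code, Gate.unary]; omega
    · intro i hi
      simp only [Gate.refs, List.mem_cons, List.not_mem_nil, or_false] at hi
      rcases hi with rfl | rfl <;> assumption
    · intro z x
      rw [List.foldl_append, h4, List.foldl_cons, List.foldl_nil, Gate.eval, hj', hk']
      simp

theorem foldl_eval_of_refs_nil {n : ℕ} (z : Fin n → Bool) (gs : List (Gate n))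
    (h : ∀ g ∈ gs, ∀ w, g.eval z w = g.eval z []) (w : List Bool) :
    gs.foldl (fun w g => w ++ [g.eval z w]) w = w ++ gs.map fun g => g.eval z [] := by
  induction gs generalizing w with
  | nil => simp
  | cons g gs ih =>
    rw [List.foldl_cons, ih fun g hg => h g (List.mem_cons_of_mem _ hg), h g (by simp)]
    simp

/-- The wires for the constants `θ` and `b` and the input `z`. -/
def inputWires (n : ℕ) : List ((Fin n → Bool) × (Fin n → Bool) × Bool → Bool) :=
  (List.ofFn fun i x => x.1 i) ++ (fun x => x.2.2) :: List.ofFn fun i x => x.2.1 i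

/-- Circuits with hardwired constants, with a code in which the constants are visible. -/
theorem Comp.exists_circuit {n c : ℕ} {R : (Fin n → Bool) × (Fin n → Bool) × Bool → Bool}
    (h : Comp {φ | φ ∈ inputWires n} c {R}) :
    ∃ (C : (Fin n → Bool) → Bool → Circuit n) (rest : List Bool),
      rest.length ≤ n * (n + 4) + (c + 1) * (2 * ((2 * n + 1) + (c + 1)) + 5) ∧
      (∀ θ b z, (C θ b).eval z = R (θ, z, b)) ∧
      ∀ θ b, (C θ b).code =
        (bits θ).flatMap (fun a => [false, false, a]) ++ ([false, false, b] ++ rest) := by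
  obtain ⟨l, hl, hc, hR⟩ := h
  -- `R` may be an input or an intermediate wire, but a circuit outputs its last gate; one redundant
  -- conjunction moves `R` there.
  have hl' : Gates {φ | φ ∈ inputWires n} ((fun x => R x && R x) :: l) :=
    hl.and (hR R rfl) (hR R rfl)
  have hlen : (inputWires n).length = 2 * n + 1 := by simp [inputWires]; omega
  obtain ⟨gs, h1, h2, h3, h4⟩ := hl'.exists_gates (n := n) (inputWires n) fun φ hφ => hφ
  rw [hlen] at h2 h3
  let pre : (Fin n → Bool) → Bool → List (Gate n) := fun θ b =>
    (List.ofFn fun i => Gate.const (θ i)) ++ .const b :: List.ofFn fun i => Gate.input i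
  have hpre : ∀ θ b, (pre θ b).length = 2 * n + 1 := by intro θ b; simp [pre]; omega
  have hmem : ∀ θ b, ∀ g ∈ pre θ b, (∃ a, g = .const a) ∨ ∃ i, g = .input i := by
    intro θ b g hg
    simp only [pre, List.mem_append, List.mem_cons, List.mem_ofFn] at hg
    rcases hg with ⟨i, rfl⟩ | rfl | ⟨i, rfl⟩
    · exact Or.inl ⟨_, rfl⟩
    · exact Or.inl ⟨_, rfl⟩
    · exact Or.inr ⟨_, rfl⟩
  refine ⟨fun θ b => ⟨pre θ b ++ gs, ?_, ?_⟩,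
    ((List.ofFn fun i : Fin n => Gate.input i) ++ gs).flatMap Gate.code, ?_, ?_, ?_⟩
  · intro i hi j hj
    by_cases hi' : i < (pre θ b).length
    · rw [List.getElem_append_left hi'] at hj
      rcases hmem θ b _ (List.getElem_mem hi') with ⟨a, ha⟩ | ⟨k, hk⟩
      · rw [ha] at hj; simp [Gate.refs] at hj
      · rw [hk] at hj; simp [Gate.refs] at hj
    · rw [List.getElem_append_right (by omega)] at hj
      have := h3 _ _ j hj
      rw [hpre] at this
      rw [hpre] at hi'
      omega
  · have := hpre θ b
    intro h0
    simp only [List.append_eq_nil_iff] at h0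
    rw [h0.1] at this
    simp at this
  · have hin : ∀ m, ∀ g : Fin m → Fin n,
        ((List.ofFn fun i : Fin m => Gate.input (g i)).flatMap Gate.code).length ≤ m * (n + 4) := by
      intro m g
      induction m with
      | zero => simp
      | succ m ih =>
        have h5 := ih fun i => g i.succ
        have h6 : (Gate.input (g 0)).code.length ≤ n + 4 := by
          simp [Gate.code, Gate.unary]
        rw [List.ofFn_succ, List.flatMap_cons, List.length_append]
        nlinarith
    rw [List.flatMap_append, List.length_append]
    refine add_le_add (hin n _root_.id) (h2.trans ?_)
    simp only [List.length_cons]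
    exact Nat.mul_le_mul (by omega) (by omega)
  · intro θ b z
    have h5 : (pre θ b).foldl (fun w g => w ++ [g.eval z w]) [] =
        (inputWires n).map (· (θ, z, b)) := by
      rw [foldl_eval_of_refs_nil z _ fun g hg w => by
        rcases hmem θ b g hg with ⟨a, rfl⟩ | ⟨k, rfl⟩ <;> rfl]
      simp [pre, inputWires, List.map_ofFn, Function.comp_def, Gate.eval]
    simp only [Circuit.eval, Circuit.values, List.foldl_append]
    rw [h5, h4]
    simp
  · intro θ b
    simp [Circuit.code, pre, bits, Gate.code, List.flatMap_append]
    simp [List.flatMap, List.map_ofFn, Function.comp_def, Gate.code]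

/-! ### Circuits for the building blocks -/

/-- Dynamic programming on a one-hot counter: whether the first `k + 1` functions take the value
true exactly `j` times depends on `δ k` and on whether the first `k` do so `j` or `j - 1` times. -/
theorem Comp.count {X : Type} {B : Set (X → Bool)} {c N : ℕ} (δ : ℕ → X → Bool)
    (hδ : ∀ i, Comp B c {δ i}) (k : ℕ) :
    Comp B (k * (c + (N + 1) * localCost 3) + (N + 1)) (Set.range fun (j : Fin (N + 1)) x =>
      decide (((Finset.range k).filter fun i => δ i x = true).card = j)) := by
  induction k with
  | zero =>
    refine (Comp.range (c := 1) fun j : Fin (N + 1) => ?_).mono subset_rfl (by simp) subset_rfl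
    simpa using Comp.const (B := B) (decide (0 = (j : ℕ)))
  | succ k ih =>
    refine ((ih.union (hδ k)).trans (Comp.range (c := localCost 3) fun j => ?_)).mono subset_rfl
      (d := (k + 1) * (c + (N + 1) * localCost 3) + (N + 1)) ?_ subset_rfl
    · let w : Fin 3 → X → Bool
        | 0 => δ k
        | 1 => fun x => decide (((Finset.range k).filter fun i => δ i x = true).card = j)
        -- For `j = 0` the truncated `j - 1` repeats the previous wire, which is all that is needed.
        | 2 => fun x => decide (((Finset.range k).filter fun i => δ i x = true).card =
            ((⟨j - 1, by omega⟩ : Fin (N + 1)) : ℕ))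
      refine (Comp.of_dependsOn w ?_ _ ?_).mono subset_rfl (by simp) subset_rfl
      · intro i
        match i with
        | 0 => exact Or.inr rfl
        | 1 => exact Or.inl ⟨j, rfl⟩
        | 2 => exact Or.inl ⟨⟨j - 1, by omega⟩, rfl⟩
      · intro x x' hx
        have h0 : δ k x = δ k x' := hx 0
        have h1 := hx 1
        have h2 := hx 2
        simp only [w, decide_eq_decide] at h1 h2
        have hcard : ∀ y, ((Finset.range (k + 1)).filter fun i => δ i y = true).card =
            ((Finset.range k).filter fun i => δ i y = true).card +
              if δ k y = true then 1 else 0 := by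
          intro y
          rw [Finset.range_add_one, Finset.filter_insert]
          split_ifs <;> simp
        rw [decide_eq_decide, hcard, hcard, h0]
        split_ifs <;> omega
    · rw [Fintype.card_fin]
      nlinarith

/-- Threshold functions. -/
theorem Comp.threshold {X : Type} {B : Set (X → Bool)} {c n : ℕ} (δ : Fin n → X → Bool)
    (hδ : ∀ i, Comp B c {δ i}) (t : ℝ) :
    Comp B (n * (c + 1 + (n + 1) * localCost 3) + (n + 1) + ((n + 1) * 3 + 1))
      {fun x => decide (((Finset.univ.filter fun i => δ i x = true).card : ℝ) ≤ t)} := by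
  classical
  let δ' : ℕ → X → Bool := fun i x => if h : i < n then δ ⟨i, h⟩ x else false
  have hδ' : ∀ i, Comp B (c + 1) {δ' i} := by
    intro i
    by_cases h : i < n
    · exact (hδ ⟨i, h⟩).mono subset_rfl (by omega) (by simp [δ', h])
    · exact (Comp.const false).mono subset_rfl (by omega) (by simp [δ', h])
  have hcard : ∀ x, ((Finset.range n).filter fun i => δ' i x = true).card =
      (Finset.univ.filter fun i => δ i x = true).card := by
    intro x
    symm
    refine Finset.card_bij (fun i _ => (i : ℕ)) ?_ ?_ ?_
    · intro i hi
      simpa [δ'] using hi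
    · intro i _ j _ h
      exact Fin.ext h
    · intro i hi
      simp only [Finset.mem_filter, Finset.mem_range] at hi
      exact ⟨⟨i, hi.1⟩, by simpa [δ', hi.1] using hi.2, rfl⟩
  have h1 := Comp.count (N := n) δ' hδ' n
  -- The count is at most `t` iff it differs from every `j ≤ n` above `t`; the comparison of `j`
  -- with the real number `t` is hardwired.
  have h2 := Comp.forall (B := Set.range fun (j : Fin (n + 1)) x =>
      decide (((Finset.range n).filter fun i => δ' i x = true).card = j)) (c := 2)
    (φ := fun j : Fin (n + 1) => if ((j : ℕ) : ℝ) ≤ t then fun _ => true else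
      fun x => !decide (((Finset.range n).filter fun i => δ' i x = true).card = j)) (by
    intro j
    split_ifs
    · exact (Comp.const true).mono subset_rfl (by omega) subset_rfl
    · exact (Comp.not (Comp.mem (by exact ⟨j, rfl⟩))).mono subset_rfl (by omega) subset_rfl)
  refine (h1.trans h2).mono subset_rfl (by simp) ?_
  simp only [Set.singleton_subset_iff, Set.mem_singleton_iff]
  funext x
  rw [decide_eq_decide, ← hcard]
  have hle : ((Finset.range n).filter fun i => δ' i x = true).card ≤ n :=
    (Finset.card_filter_le _ _).trans (by simp)
  constructor
  · intro h j
    split_ifs with hj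
    · rfl
    · simp only [Bool.not_eq_true', decide_eq_false_iff_not]
      intro h'
      rw [h'] at h
      exact hj h
  · intro h
    by_contra hlt
    have := h ⟨_, Nat.lt_succ_of_le hle⟩
    simp only at this
    rw [if_neg hlt] at this
    simp at this

/-- When the positions of the separators are fixed, each symbol test is a wire, the negation of a
wire or a constant. -/
theorem Comp.cellWire_emit {X : Type} {B : Set (X → Bool)} (S : List (Option (X → Bool)))
    (hS : ∀ φ, some φ ∈ S → φ ∈ B) :
    Comp B (S.length + 2) {ψ | ∃ i g, ψ = cellWire (emit S) i g} := by
  have h1 : Comp B (S.length * 1) (Set.range fun (i : Fin S.length) x =>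
      !(((S[i]).map (· x)).getD false)) := by
    refine (Comp.range (c := 1) fun i => ?_).mono subset_rfl (by simp) subset_rfl
    rcases h : S[i] with _ | φ
    · simpa using Comp.const true
    · exact (Comp.mem (hS φ (h ▸ List.getElem_mem i.2))).not.mono subset_rfl (by omega) (by simp)
  refine (((Comp.of_subset (subset_refl B)).union h1).union
    ((Comp.const true).union (Comp.const false))).mono subset_rfl (by omega) ?_
  have hb : ∀ b : Bool, (fun _ : X => b) ∈
      ({fun _ => true} ∪ {fun _ => false} : Set (X → Bool)) := by
    rintro (_ | _) <;> simp
  rintro _ ⟨i, g, rfl⟩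
  by_cases hi : i < S.length
  · rcases h : S[i] with _ | φ
    · refine Or.inr ?_
      convert! hb (decide (g = none)) using 1
      funext x
      simp [cellWire, emit, List.getElem?_map, List.getElem?_eq_getElem hi, h, eq_comm]
    · have hφ : φ ∈ B := hS φ (h ▸ List.getElem_mem hi)
      rcases g with _ | _ | _
      · refine Or.inr ?_
        convert! hb false using 1
        funext x
        simp [cellWire, emit, List.getElem?_map, List.getElem?_eq_getElem hi, h]
      · refine Or.inl (Or.inr ⟨⟨i, hi⟩, ?_⟩)
        funext x
        cases hx : φ x <;>
          simp [cellWire, emit, List.getElem?_map, List.getElem?_eq_getElem hi, h, hx]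
      · refine Or.inl (Or.inl ?_)
        convert! hφ using 1
        funext x
        cases hx : φ x <;>
          simp [cellWire, emit, List.getElem?_map, List.getElem?_eq_getElem hi, h, hx]
  · refine Or.inr ?_
    convert! hb false using 1
    funext x
    simp [cellWire, emit, List.getElem?_map, List.getElem?_eq_none (not_lt.1 hi)]

/-- Polynomial-time functions have polynomial-size circuits on inputs of a fixed shape. -/
theorem PolyTime.exists_comp_emit {f : List (List Bool) → List (List Bool)} (hf : PolyTime f) :
    ∃ Q : Polynomial ℕ, ∀ (X : Type) (B : Set (X → Bool)) (inp : X → List (List Bool))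
      (S : List (Option (X → Bool))), (∀ x, encodeStrings (inp x) = emit S x) →
      (∀ φ, some φ ∈ S → φ ∈ B) →
      (∀ x, (encodeStrings (f (inp x))).length ≤ Q.eval S.length) ∧
      Comp B (Q.eval S.length) {φ | ∃ i g, φ = cellWire (fun x => encodeStrings (f (inp x))) i g} := by
  obtain ⟨Q, hQ⟩ := hf.exists_comp
  refine ⟨Q + (Polynomial.X + 2), fun X B inp S hS hB => ?_⟩
  have hemit : (fun x => encodeStrings (inp x)) = emit S := funext hS
  obtain ⟨h1, h2⟩ := hQ X {ψ | ∃ i g, ψ = cellWire (emit S) i g} inp S.length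
    (fun x => by rw [hS]; simp [emit]) (fun i g => ⟨i, g, by rw [hemit]⟩)
  refine ⟨fun x => (h1 x).trans (by simp), ((Comp.cellWire_emit S hB).trans h2).mono subset_rfl ?_
    subset_rfl⟩
  simp
  omega

end LDS

namespace LDS

/-! ### The sampler is efficient -/

theorem mem_inputWires_const {n : ℕ} (i : Fin n) :
    (fun p : (Fin n → Bool) × (Fin n → Bool) × Bool => p.1 i) ∈ inputWires n := by
  simp [inputWires, List.mem_ofFn]

theorem mem_inputWires_input {n : ℕ} (i : Fin n) :
    (fun p : (Fin n → Bool) × (Fin n → Bool) × Bool => p.2.1 i) ∈ inputWires n := by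
  simp [inputWires, List.mem_ofFn]

theorem mem_inputWires_bit (n : ℕ) :
    (fun p : (Fin n → Bool) × (Fin n → Bool) × Bool => p.2.2) ∈ inputWires n := by
  simp [inputWires]

section

variable {γ : ℕ → ℕ} (H : ∀ n, (Fin n → Bool) → (Fin (γ n) → Bool))
  (υ : ∀ n, Fin (γ n) → Bool) (r r' : ℕ → ℝ) (x x' : ∀ n, Fin n → Bool)

open Classical in
/-- Membership of `z` in the set of the sampler on the seed `θ`, with `x` (`b = false`) or `x'`
(`b = true`) as the first center, as a function of `(θ, z, b)`. -/
noncomputable def ldsFun (n : ℕ) : (Fin n → Bool) × (Fin n → Bool) × Bool → Bool := fun p =>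
  decide (p.2.1 ∈ ldsSet H υ r r' n (if p.2.2 then x' n else x n) (xorBits (x n) p.1))

variable {H}

/-- The tableau of `H`, followed by a bitwise comparison with `υ n`. The width `γ n` is polynomially
bounded because the output of the machine is. -/
theorem exists_comp_hash (hH : EfficientlyComputable H) :
    ∃ c, PolyBounded c ∧ ∀ n, Comp {φ | φ ∈ inputWires n} (c n)
      {fun p => decide (H n p.2.1 = υ n)} := by
  obtain ⟨f, hf, hfH⟩ := hH
  obtain ⟨Q, hQ⟩ := hf.exists_comp_emit
  refine ⟨fun n => Q.eval (n + 1) + (Q.eval (n + 1) * (0 + 1) + 1), ?_, fun n => ?_⟩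
  · have := PolyBounded.eval_comp Q (PolyBounded.id.add (.const 1))
    exact this.add ((this.mul (.const _)).add (.const 1))
  · let X := (Fin n → Bool) × (Fin n → Bool) × Bool
    let S : List (Option (X → Bool)) := (List.ofFn fun i => some fun p => p.2.1 i) ++ [none]
    have hSlen : S.length = n + 1 := by simp [S]
    obtain ⟨h1, h2⟩ := hQ X {φ | φ ∈ inputWires n} (fun p => [bits p.2.1]) S
      (fun p => by simp [encodeStrings, bits, emit, S, List.map_ofFn, Function.comp_def])
      (fun φ hφ => by
        simp only [S, List.mem_append, List.mem_ofFn, Option.some.injEq, List.mem_singleton,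
          reduceCtorEq, or_false] at hφ
        obtain ⟨i, rfl⟩ := hφ
        exact mem_inputWires_input i)
    rw [hSlen] at h1 h2
    have henc : ∀ p : X, encodeStrings (f [bits p.2.1]) = (bits (H n p.2.1)).map some ++ [none] := by
      intro p
      rw [hfH]
      simp [encodeStrings]
    have hγ : γ n ≤ Q.eval (n + 1) := by
      have := h1 (fun _ => false, fun _ => false, false)
      rw [henc] at this
      simp [bits] at this
      omega
    have h3 := Comp.forall (c := 0) (φ := fun j : Fin (γ n) =>
      cellWire (fun p : X => encodeStrings (f [bits p.2.1])) j (some (υ n j)))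
      fun j => Comp.mem (B := {φ | ∃ i g, φ = cellWire (fun p : X =>
        encodeStrings (f [bits p.2.1])) i g})
        ⟨j, _, rfl⟩
    refine (h2.trans h3).mono subset_rfl ?_ ?_
    · rw [Fintype.card_fin]
      exact Nat.add_le_add_left (Nat.add_le_add_right (Nat.mul_le_mul_right _ hγ) 1) _
    · simp only [Set.singleton_subset_iff, Set.mem_singleton_iff]
      funext p
      rw [decide_eq_decide, funext_iff]
      refine forall_congr' fun j => ?_
      rw [cellWire, decide_eq_true_eq, henc, List.getElem?_append_left (by simp [bits])]
      simp [bits]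

/-- Two Hamming thresholds and the hash test. As `x` and `x'` are hardwired, each disagreement bit
depends on only two wires: `b` and a bit of `z`, or a bit of `θ` and one of `z`. -/
theorem exists_comp_ldsFun (hH : EfficientlyComputable H) :
    ∃ c, PolyBounded c ∧ ∀ n, Comp {φ | φ ∈ inputWires n} (c n) {ldsFun H υ r r' x x' n} := by
  obtain ⟨c, hc, hcomp⟩ := exists_comp_hash υ hH
  let d : ℕ → ℕ := fun n =>
    n * (localCost 2 + 1 + (n + 1) * localCost 3) + (n + 1) + ((n + 1) * 3 + 1)
  have hd : PolyBounded d := by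
    have h1 : PolyBounded fun n => n + 1 := PolyBounded.id.add (.const 1)
    exact ((PolyBounded.id.mul ((PolyBounded.const (localCost 2 + 1)).add
      (h1.mul (.const _)))).add h1).add ((h1.mul (.const 3)).add (.const 1))
  refine ⟨fun n => d n + (d n + c n + 1) + 1, (hd.add ((hd.add hc).add (.const 1))).add (.const 1),
    fun n => ?_⟩
  have h1 := Comp.threshold (B := {φ | φ ∈ inputWires n}) (c := localCost 2)
    (fun (i : Fin n) p => decide ((if p.2.2 then x' n else x n) i ≠ p.2.1 i)) (fun i => by
      refine (Comp.of_dependsOn (B := {φ | φ ∈ inputWires n})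
        (fun (k : Bool) (p : (Fin n → Bool) × (Fin n → Bool) × Bool) =>
          if k then p.2.2 else p.2.1 i) ?_ _ ?_).mono subset_rfl (by simp) subset_rfl
      · rintro (_ | _)
        · exact mem_inputWires_input i
        · exact mem_inputWires_bit n
      · intro p p' h
        have h1 := h true
        have h0 := h false
        simp only [if_true, Bool.false_eq_true, if_false] at h1 h0
        simp only [h1, h0]) (r n)
  have h2 := Comp.threshold (B := {φ | φ ∈ inputWires n}) (c := localCost 2)
    (fun (i : Fin n) p => decide (xorBits (x n) p.1 i ≠ p.2.1 i)) (fun i => by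
      refine (Comp.of_dependsOn (B := {φ | φ ∈ inputWires n})
        (fun (k : Bool) (p : (Fin n → Bool) × (Fin n → Bool) × Bool) =>
          if k then p.1 i else p.2.1 i) ?_ _ ?_).mono subset_rfl (by simp) subset_rfl
      · rintro (_ | _)
        · exact mem_inputWires_input i
        · exact mem_inputWires_const i
      · intro p p' h
        have h1 := h true
        have h0 := h false
        simp only [if_true, Bool.false_eq_true, if_false] at h1 h0
        rw [decide_eq_decide, xorBits, xorBits, h1, h0]) (r' n)
  refine (h1.and (h2.and (hcomp n))).mono subset_rfl le_rfl ?_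
  simp only [Set.singleton_subset_iff, Set.mem_singleton_iff]
  funext p
  rw [Bool.eq_iff_iff]
  simp only [ldsFun, ldsSet, ball, hammingDist, Set.mem_inter_iff, Set.mem_ofPred_eq,
    Set.mem_preimage, Set.mem_singleton_iff, decide_eq_true_eq, Bool.and_eq_true, and_assoc]

/-- The sampler has an efficient implementation. -/
theorem exists_efficient_sampler (hH : EfficientlyComputable H) :
    ∃ S : Sampler fun n => n, IsLDSSampler H υ r r' x x' S ∧ S.Efficient := by
  obtain ⟨c, hc, hcomp⟩ := exists_comp_ldsFun υ r r' x x' hH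
  choose C rest hrest heval hcode using fun n => (hcomp n).exists_circuit
  obtain ⟨f, hf, hfe⟩ := exists_polyTime_evaluate
  let S : Sampler fun n => n := fun n θ => (C n θ false, C n θ true)
  -- The code of the circuit as a fixed template: a bit of `θ` occurs only as the third bit of the
  -- code of a constant gate. Sampling amounts to copying `θ` into the template.
  let W : ∀ n, Bool → List (Option ((Fin n → Bool) → Bool)) := fun n b =>
    (List.ofFn fun i : Fin n => i).flatMap (fun i => [some fun _ => false, some fun _ => false,
      some fun θ => θ i]) ++ ([false, false, b] ++ rest n).map fun a => some fun _ => a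
  have hW : ∀ n b θ, emit (W n b) θ = (C n θ b).code.map some := by
    intro n b θ
    rw [hcode]
    simp only [emit, W, bits, List.map_append, List.map_flatMap, List.map_map]
    congr 1
    simp only [List.flatMap, List.map_ofFn]
    simp [Function.comp_def]
  let E : ∀ n, List (Option ((Fin n → Bool) → Bool)) := fun n => W n false ++ none :: W n true
  have hE : ∀ n, Comp (Set.range fun (i : Fin n) (θ : Fin n → Bool) => θ i) 2 {φ | some φ ∈ E n} := by
    intro n
    refine ((Comp.of_subset (subset_refl (Set.range fun (i : Fin n) (θ : Fin n → Bool) => θ i))).union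
      ((Comp.const true).union (Comp.const false))).mono subset_rfl le_rfl ?_
    have hb : ∀ b : Bool, (fun _ : Fin n → Bool => b) ∈
        ({fun _ => true} ∪ {fun _ => false} : Set ((Fin n → Bool) → Bool)) := by
      rintro (_ | _) <;> simp
    have hWmem : ∀ b φ, some φ ∈ W n b → φ ∈ (Set.range fun (i : Fin n) (θ : Fin n → Bool) => θ i) ∪
        ({fun _ => true} ∪ {fun _ => false}) := by
      intro b φ hφ
      simp only [W, List.mem_append, List.mem_flatMap, List.mem_map, Option.some.injEq] at hφ
      rcases hφ with ⟨i, _, hi⟩ | ⟨a, _, rfl⟩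
      · simp only [List.mem_cons, Option.some.injEq, List.not_mem_nil, or_false] at hi
        rcases hi with rfl | rfl | rfl
        · exact Or.inr (hb false)
        · exact Or.inr (hb false)
        · exact Or.inl ⟨i, rfl⟩
      · exact Or.inr (hb a)
    intro φ hφ
    simp only [E, Set.mem_ofPred_eq, List.mem_append, List.mem_cons, reduceCtorEq, false_or] at hφ
    rcases hφ with hφ | hφ
    · exact hWmem _ _ hφ
    · exact hWmem _ _ hφ
  choose P hPlen hP hrun using fun n => (hE n).exists_program
  refine ⟨S, fun n θ => ⟨fun z => ?_, fun z => ?_⟩, f, fun n => adviceOf 2 1 (P n), hf, ?_, ?_⟩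
  · rw [heval]
    simp [ldsFun]
  · rw [heval]
    simp [ldsFun]
  · have hElen : ∀ n, (E n).length = 2 * (3 * n + 3 + (rest n).length) + 1 := by
      intro n
      simp [E, W, Function.comp_def]
      omega
    have h1 : PolyBounded fun n => (rest n).length := by
      refine PolyBounded.mono ?_ hrest
      have h2 : PolyBounded fun n => c n + 1 := hc.add (.const 1)
      exact (PolyBounded.id.mul (PolyBounded.id.add (.const 4))).add (h2.mul
        (((PolyBounded.const 2).mul ((((PolyBounded.const 2).mul PolyBounded.id).add (.const 1)).add
          h2)).add (.const 5)))
    have h2 : PolyBounded fun n => (E n).length := by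
      simp only [hElen]
      exact ((PolyBounded.const 2).mul ((((PolyBounded.const 3).mul .id).add (.const 3)).add h1)).add
        (.const 1)
    have h3 : PolyBounded fun n => 2 + n := (PolyBounded.const 2).add .id
    have h4 : PolyBounded fun n => (P n).length := by
      refine PolyBounded.mono ?_ hPlen
      exact (((PolyBounded.const 2).mul .id).add ((PolyBounded.const 2).mul
        (((PolyBounded.const 4).mul h3).add (.const 4)))).add
        (h2.mul (((PolyBounded.const 2).mul h3).add (.const 2)))
    exact ((PolyBounded.const 12).mul (h4.add (.const 2))).mono fun n => length_adviceOf_le _ _ _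
  · intro n θ
    refine eval_program_once hfe (hP n) (E n) (hrun n) n θ _ ?_
    rw [encodeStrings_cons, encodeStrings_cons]
    have : emit (E n) θ = emit (W n false) θ ++ none :: emit (W n true) θ := by simp [E, emit]
    rw [this, hW, hW]
    simp [encodeStrings, S]

end

end LDS

namespace LDS

/-! ### Uniform probability -/

section Uniform

open Classical in
/-- The probability of `E` under the uniform distribution. -/
noncomputable def uprob {Ω : Type} [Fintype Ω] (E : Ω → Prop) : ℝ :=
  (∑ ω, if E ω then 1 else 0) / (Fintype.card Ω : ℝ)

variable {Ω Ω' : Type} [Fintype Ω] [Fintype Ω']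

theorem coinProb_eq_uprob (m : ℕ) (E : (Fin m → Bool) → Prop) : coinProb m E = uprob E := by
  classical
  have : {ρ : Fin m → Bool | E ρ}.ncard = (Finset.univ.filter E).card := by
    rw [← Set.ncard_coe_finset]
    simp
  simp [coinProb, uprob, this]

theorem uprob_mono {E F : Ω → Prop} (h : ∀ ω, E ω → F ω) : uprob E ≤ uprob F := by
  classical
  unfold uprob
  gcongr with ω
  split_ifs with h1 h2
  · exact le_rfl
  · exact absurd (h ω h1) h2
  · exact zero_le_one
  · exact le_rfl

theorem uprob_nonneg (E : Ω → Prop) : 0 ≤ uprob E := by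
  classical
  unfold uprob
  positivity

theorem uprob_le_one (E : Ω → Prop) : uprob E ≤ 1 := by
  classical
  unfold uprob
  refine div_le_one_of_le₀ ?_ (by positivity)
  calc (∑ ω, if E ω then (1 : ℝ) else 0) ≤ ∑ _ω : Ω, 1 := by gcongr; split_ifs <;> simp
    _ = Fintype.card Ω := by simp

theorem uprob_not [Nonempty Ω] (E : Ω → Prop) : uprob (fun ω => ¬E ω) = 1 - uprob E := by
  classical
  have hc : (Fintype.card Ω : ℝ) ≠ 0 := by positivity
  unfold uprob
  rw [eq_sub_iff_add_eq, ← add_div, ← Finset.sum_add_distrib, div_eq_one_iff_eq hc]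
  rw [Finset.sum_congr rfl (g := fun _ => (1 : ℝ)) fun ω _ => by by_cases h : E ω <;> simp [h]]
  simp

theorem uprob_or_le (E F : Ω → Prop) : uprob (fun ω => E ω ∨ F ω) ≤ uprob E + uprob F := by
  classical
  unfold uprob
  rw [← add_div, ← Finset.sum_add_distrib]
  gcongr with ω
  by_cases h1 : E ω <;> by_cases h2 : F ω <;> simp [h1, h2]

theorem uprob_exists_le {ι : Type} [Fintype ι] (E : ι → Ω → Prop) {b : ℝ}
    (h : ∀ i, uprob (E i) ≤ b) : uprob (fun ω => ∃ i, E i ω) ≤ Fintype.card ι * b := by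
  classical
  calc uprob (fun ω => ∃ i, E i ω) ≤ ∑ i, uprob (E i) := by
        unfold uprob
        rw [← Finset.sum_div, Finset.sum_comm]
        gcongr with ω
        split_ifs with hω
        · obtain ⟨i, hi⟩ := hω
          calc (1 : ℝ) = if E i ω then 1 else 0 := by simp [hi]
            _ ≤ _ := Finset.single_le_sum (f := fun i => if E i ω then (1 : ℝ) else 0)
              (fun _ _ => by split_ifs <;> simp) (Finset.mem_univ i)
        · exact Finset.sum_nonneg fun _ _ => by split_ifs <;> simp
    _ ≤ ∑ _i : ι, b := Finset.sum_le_sum fun i _ => h i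
    _ = _ := by simp

theorem uprob_equiv (e : Ω ≃ Ω') (E : Ω' → Prop) : uprob (fun ω => E (e ω)) = uprob E := by
  classical
  unfold uprob
  rw [Fintype.card_congr e, e.sum_comp (fun ω => if E ω then (1 : ℝ) else 0)]

theorem uprob_prod (Q : Ω → Ω' → Prop) :
    uprob (fun p : Ω × Ω' => Q p.1 p.2) = (∑ a, uprob (Q a)) / Fintype.card Ω := by
  classical
  unfold uprob
  rw [Fintype.sum_prod_type, Fintype.card_prod, ← Finset.sum_div, div_div, Nat.cast_mul, mul_comm]

theorem uprob_prod_le [Nonempty Ω] (Q : Ω → Ω' → Prop) {b : ℝ} (h : ∀ a, uprob (Q a) ≤ b) :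
    uprob (fun p : Ω × Ω' => Q p.1 p.2) ≤ b := by
  rw [uprob_prod, div_le_iff₀ (by positivity), mul_comm]
  calc ∑ a, uprob (Q a) ≤ ∑ _a : Ω, b := Finset.sum_le_sum fun a _ => h a
    _ = _ := by simp

theorem uprob_fst [Nonempty Ω'] (E : Ω → Prop) : uprob (fun p : Ω × Ω' => E p.1) = uprob E := by
  classical
  rw [uprob_prod (fun a _ => E a)]
  have hc : (Fintype.card Ω' : ℝ) ≠ 0 := by positivity
  have : ∀ a, uprob (fun _ : Ω' => E a) = if E a then 1 else 0 := by
    intro a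
    unfold uprob
    split_ifs <;> simp [hc]
  simp only [this]
  rfl

theorem uprob_pi {ι : Type} [Fintype ι] [DecidableEq ι] (E : ι → Ω → Prop) :
    uprob (fun v : ι → Ω => ∀ i, E i (v i)) = ∏ i, uprob (E i) := by
  classical
  unfold uprob
  rw [Finset.prod_div_distrib, Fintype.prod_sum, Finset.prod_const, Finset.card_univ,
    Fintype.card_fun, Nat.cast_pow]
  congr 1
  refine Finset.sum_congr rfl fun v _ => ?_
  split_ifs with h
  · simp [h]
  · obtain ⟨i, hi⟩ := not_forall.1 h
    exact (Finset.prod_eq_zero (Finset.mem_univ i) (by simp [hi])).symm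

theorem uprob_eval [Nonempty Ω] {ι : Type} [Fintype ι] [DecidableEq ι] (i : ι) (E : Ω → Prop) :
    uprob (fun v : ι → Ω => E (v i)) = uprob E := by
  rw [← uprob_fst (Ω' := {j : ι // j ≠ i} → Ω) E,
    ← uprob_equiv (Equiv.funSplitAt i Ω) fun p => E p.1]
  rfl

/-- Uniform bits restricted along an injection are uniform. -/
theorem uprob_comp_injective {ι κ : Type} [Fintype ι] [Fintype κ] [DecidableEq ι] [DecidableEq κ]
    (e : ι → κ) (he : Function.Injective e) (E : (ι → Bool) → Prop) :
    uprob (fun ρ : κ → Bool => E (ρ ∘ e)) = uprob E := by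
  classical
  let f : ι ⊕ ((Set.range e)ᶜ : Set κ) ≃ κ :=
    ((Equiv.ofInjective e he).sumCongr (Equiv.refl _)).trans (Equiv.Set.sumCompl (Set.range e))
  let g : (κ → Bool) ≃ (ι → Bool) × (((Set.range e)ᶜ : Set κ) → Bool) :=
    (Equiv.arrowCongr f.symm (Equiv.refl Bool)).trans (Equiv.sumArrowEquivProdArrow _ _ _)
  rw [← uprob_fst (Ω' := ((Set.range e)ᶜ : Set κ) → Bool) E, ← uprob_equiv g fun p => E p.1]
  rfl

/-- A map to a finite set with distribution `D`. -/
theorem uprob_prod_comp {T : Type} [Fintype T] [DecidableEq T] (t : Ω → T) (Q : T → Ω' → Prop) :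
    uprob (fun p : Ω × Ω' => Q (t p.1) p.2) = ∑ s, uprob (fun ω => t ω = s) * uprob (Q s) := by
  classical
  rw [uprob_prod (fun a b => Q (t a) b)]
  have h1 : ∀ s, uprob (fun ω => t ω = s) * uprob (Q s) =
      (∑ ω, if t ω = s then uprob (Q s) else 0) / Fintype.card Ω := by
    intro s
    rw [uprob, div_mul_eq_mul_div, Finset.sum_mul]
    congr 1
    refine Finset.sum_congr rfl fun ω _ => ?_
    split_ifs <;> simp
  simp only [h1]
  rw [← Finset.sum_div, Finset.sum_comm]
  congr 1
  refine Finset.sum_congr rfl fun ω _ => ?_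
  simp

end Uniform

/-! ### Concentration of randomized response -/

/-- The probability of `b` in randomized response on `false`. -/
noncomputable def flipProb (ε : ℝ) (b : Bool) : ℝ :=
  if b then 1 / (1 + Real.exp ε) else Real.exp ε / (1 + Real.exp ε)

theorem flipProb_pos (ε : ℝ) (b : Bool) : 0 < flipProb ε b := by
  unfold flipProb
  split_ifs <;> positivity

theorem flipProb_false (ε : ℝ) : flipProb ε false = 1 - flipProb ε true := by
  have : (0 : ℝ) < 1 + Real.exp ε := by positivity
  simp only [flipProb, if_true, Bool.false_eq_true, if_false]
  field_simp
  ring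

theorem flipProb_true_lt (ε : ℝ) (hε : 0 < ε) : flipProb ε true < 1 / 2 := by
  have : 1 < Real.exp ε := by simpa using hε
  simp only [flipProb, if_true]
  rw [div_lt_div_iff₀ (by positivity) (by norm_num)]
  linarith

theorem randomizedResponse_toReal (ε : ℝ) {n : ℕ} (θ : Fin n → Bool) :
    (randomizedResponse ε (fun _ : Fin n => false) θ).toReal = ∏ i, flipProb ε (θ i) := by
  rw [randomizedResponse, PMF.ofFintype_apply, ENNReal.toReal_prod]
  refine Finset.prod_congr rfl fun i _ => ?_
  have : (0 : ℝ) < 1 + Real.exp ε := by positivity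
  cases h : θ i
  · simp only [rrBit, flipProb, if_true, Bool.false_eq_true, if_false]
    exact ENNReal.toReal_ofReal (by positivity)
  · simp only [rrBit, flipProb, if_true, Bool.true_eq_false, if_false]
    exact ENNReal.toReal_ofReal (by positivity)

/-- A Chernoff bound: for `y` far from `x`, it is unlikely that `y` is close to `x ⊕ θ`. -/
theorem sum_flipProb_ball_le (ε : ℝ) {n : ℕ} (x y : Fin n → Bool) (t l : ℝ) (hl : 0 ≤ l)
    (hl1 : l ≤ 1) :
    ∑ θ : Fin n → Bool, (∏ i, flipProb ε (θ i)) *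
      (if (hammingDist (xorBits x θ) y : ℝ) ≤ t then 1 else 0) ≤
    Real.exp (l * t - l * (flipProb ε true * n + (1 - 2 * flipProb ε true) * hammingDist x y) +
      n * l ^ 2) := by
  set p := flipProb ε true with hp
  have hp0 : 0 < p := flipProb_pos ε true
  have hq0 : 0 < 1 - p := by rw [hp, ← flipProb_false]; exact flipProb_pos ε false
  have hdist : ∀ u v : Fin n → Bool, (hammingDist u v : ℝ) = ∑ i, if u i ≠ v i then 1 else 0 := by
    intro u v
    rw [hammingDist, Finset.card_filter, Nat.cast_sum]
    exact Finset.sum_congr rfl fun i _ => by split_ifs <;> simp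
  -- The second-order error, at most `l ^ 2` per coordinate, produces the term `n * l ^ 2`.
  have hexp : Real.exp (-l) ≤ 1 - l + l ^ 2 := by
    have := Real.abs_exp_sub_one_sub_id_le (x := -l) (by rw [abs_neg, abs_of_nonneg hl]; exact hl1)
    have := (abs_le.1 this).2
    nlinarith
  calc ∑ θ : Fin n → Bool, (∏ i, flipProb ε (θ i)) *
        (if (hammingDist (xorBits x θ) y : ℝ) ≤ t then 1 else 0)
      ≤ ∑ θ : Fin n → Bool, (∏ i, flipProb ε (θ i)) *
          (Real.exp (l * t) * Real.exp (-l * hammingDist (xorBits x θ) y)) := by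
        -- Exponential Markov inequality: the indicator is at most `exp (l * (t - distance))`.
        refine Finset.sum_le_sum fun θ _ => mul_le_mul_of_nonneg_left ?_
          (Finset.prod_nonneg fun i _ => (flipProb_pos ε _).le)
        rw [← Real.exp_add]
        split_ifs with h
        · refine Real.one_le_exp ?_
          nlinarith
        · positivity
    _ = Real.exp (l * t) * ∑ θ : Fin n → Bool,
          ∏ i, flipProb ε (θ i) * Real.exp (-l * if xor (x i) (θ i) ≠ y i then 1 else 0) := by
        rw [Finset.mul_sum]
        refine Finset.sum_congr rfl fun θ _ => ?_
        rw [hdist, Finset.mul_sum, Real.exp_sum, Finset.prod_mul_distrib]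
        rw [mul_left_comm]
        congr!
    _ = Real.exp (l * t) * ∏ i, ∑ b, flipProb ε b *
          Real.exp (-l * if xor (x i) b ≠ y i then 1 else 0) := by
        rw [Fintype.prod_sum (fun i b => flipProb ε b *
          Real.exp (-l * if xor (x i) b ≠ y i then 1 else 0))]
    _ ≤ Real.exp (l * t) * ∏ i, Real.exp (-l * (p + (1 - 2 * p) * if x i ≠ y i then 1 else 0) +
          l ^ 2) := by
        refine mul_le_mul_of_nonneg_left (Finset.prod_le_prod (fun i _ => ?_) fun i _ => ?_)
          (Real.exp_pos _).le
        · exact Finset.sum_nonneg fun b _ => mul_nonneg (flipProb_pos ε b).le (Real.exp_pos _).le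
        · rw [Fintype.sum_bool, flipProb_false, ← hp]
          have h1 : ∀ s : ℝ, 1 + s ≤ Real.exp s := fun s => by
            have := Real.add_one_le_exp s
            linarith
          -- A coordinate where `x` and `y` agree adds to the distance with probability `p`, one
          -- where they differ with probability `1 - p`.
          by_cases hxy : x i = y i
          · have e1 : (xor (x i) true ≠ y i) := by rw [hxy]; cases y i <;> simp
            have e2 : ¬(xor (x i) false ≠ y i) := by rw [hxy]; simp
            rw [if_pos e1, if_neg e2, if_neg (by simpa using hxy)]
            refine le_trans ?_ (h1 _)
            simp only [mul_one, mul_zero, Real.exp_zero]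
            nlinarith
          · have e1 : ¬(xor (x i) true ≠ y i) := by revert hxy; cases x i <;> cases y i <;> simp
            have e2 : (xor (x i) false ≠ y i) := by simpa using hxy
            rw [if_neg e1, if_pos e2, if_pos hxy]
            refine le_trans ?_ (h1 _)
            simp only [mul_one, mul_zero, Real.exp_zero]
            nlinarith
    _ = _ := by
        rw [← Real.exp_sum, ← Real.exp_add]
        congr 1
        rw [Finset.sum_add_distrib, ← Finset.mul_sum, Finset.sum_add_distrib, ← Finset.mul_sum,
          ← hdist]
        simp
        ring

end LDS

namespace LDS

/-! ### Circuits for simulated trials of an adversary -/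

/-- Biased coins with a dyadic bias from fair ones. -/
theorem exists_comparator (n N : ℕ) (hN : N ≤ 2 ^ n) : ∃ g : (Fin n → Bool) → Bool,
    Comp (Set.range fun (i : Fin n) (u : Fin n → Bool) => u i) (5 * n + 1) {g} ∧
      uprob (fun u => g u = true) = N / 2 ^ n := by
  induction n generalizing N with
  | zero =>
    refine ⟨fun _ => decide (N = 1), (Comp.const _).mono subset_rfl (by omega) subset_rfl, ?_⟩
    have : N = 0 ∨ N = 1 := by
      simp at hN
      omega
    rcases this with rfl | rfl <;> simp [uprob]
  | succ n ih =>
    have hsplit : ∀ E : (Fin (n + 1) → Bool) → Prop, uprob E =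
        (uprob (fun u : Fin n → Bool => E (Fin.cons true u)) +
          uprob (fun u : Fin n → Bool => E (Fin.cons false u))) / 2 := by
      intro E
      rw [← uprob_equiv (Fin.consEquiv fun _ => Bool) E]
      have := uprob_prod (Ω := Bool) (Ω' := Fin n → Bool) fun b u => E (Fin.cons b u)
      rw [Fintype.sum_bool, Fintype.card_bool] at this
      exact this
    have htail : ∀ {g : (Fin n → Bool) → Bool},
        Comp (Set.range fun (i : Fin n) (u : Fin n → Bool) => u i) (5 * n + 1) {g} →
        Comp (Set.range fun (i : Fin (n + 1)) (u : Fin (n + 1) → Bool) => u i) (5 * n + 1)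
          {fun u => g (Fin.tail u)} := by
      intro g hg
      refine (hg.comap (B' := Set.range fun (i : Fin (n + 1)) (u : Fin (n + 1) → Bool) => u i)
        (fun u : Fin (n + 1) → Bool => Fin.tail u) ?_).mono subset_rfl le_rfl ?_
      · rintro _ ⟨i, rfl⟩
        exact ⟨i.succ, rfl⟩
      · rw [Set.image_singleton]
        rfl
    have hhead : Comp (Set.range fun (i : Fin (n + 1)) (u : Fin (n + 1) → Bool) => u i) 0
        {fun u => u 0} := Comp.mem (by exact ⟨0, rfl⟩)
    have hfalse : uprob (fun _ : Fin n → Bool => False) = 0 := by simp [uprob]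
    have htrue : uprob (fun _ : Fin n → Bool => True) = 1 := by simp [uprob]
    -- The first coin decides between the halves: for small `N` it must be true and the rest must
    -- succeed; for large `N` it suffices alone, and the rest supplies the surplus `N - 2 ^ n`.
    by_cases h : N ≤ 2 ^ n
    · obtain ⟨g, hg, hp⟩ := ih N h
      refine ⟨fun u => u 0 && g (Fin.tail u), (hhead.and (htail hg)).mono subset_rfl (by omega)
        subset_rfl, ?_⟩
      rw [hsplit]
      simp only [Fin.cons_zero, Fin.tail_cons, Bool.true_and, Bool.false_and, Bool.false_eq_true,
        hp, hfalse]
      field_simp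
      ring
    · obtain ⟨g, hg, hp⟩ := ih (N - 2 ^ n) (by rw [pow_succ] at hN; omega)
      refine ⟨fun u => u 0 || g (Fin.tail u), (hhead.or (htail hg)).mono subset_rfl (by omega)
        subset_rfl, ?_⟩
      rw [hsplit]
      simp only [Fin.cons_zero, Fin.tail_cons, Bool.true_or, Bool.false_or, hp, htrue]
      rw [Nat.cast_sub (by omega)]
      push_cast
      field_simp
      ring

/-- The coins of a simulated trial: `n` coins for every bit of the seed, and `a` for the adversary. -/
abbrev TrialIndex (n a : ℕ) : Type := (Fin n × Fin n) ⊕ Fin a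

/-- The seed of a simulated trial. -/
def trialSeed {n a : ℕ} (g : (Fin n → Bool) → Bool) (ω : TrialIndex n a → Bool) : Fin n → Bool :=
  fun i => g fun j => ω (.inl (i, j))

/-- The input of the adversary in a simulated trial. -/
def trialInput (A : NonuniformPPT) {n : ℕ} (g : (Fin n → Bool) → Bool)
    (ω : TrialIndex n (A.coins.eval n) → Bool) : List (List Bool) :=
  [ones n, A.advice n, bits (trialSeed g ω), bits fun j => ω (.inr j)]

/-- The output of the adversary in a simulated trial, read as an `n`-bit string. -/
noncomputable def trialOutput (A : NonuniformPPT) {n : ℕ} (g : (Fin n → Bool) → Bool)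
    (ω : TrialIndex n (A.coins.eval n) → Bool) : Fin n → Bool :=
  fun i => cellWire (fun ω => encodeStrings (A.run (trialInput A g ω))) i (some true) ω

theorem trialOutput_eq {A : NonuniformPPT} {n : ℕ} {g : (Fin n → Bool) → Bool}
    {ω : TrialIndex n (A.coins.eval n) → Bool} {z : Fin n → Bool}
    (h : A.run (trialInput A g ω) = [bits z]) : trialOutput A g ω = z := by
  funext i
  rw [trialOutput, cellWire, h]
  simp only [encodeStrings, List.flatMap_cons, List.flatMap_nil, List.append_nil]
  rw [List.getElem?_append_left (by simp [bits])]
  simp [bits]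

section

variable {γ : ℕ → ℕ} (H : ∀ n, (Fin n → Bool) → (Fin (γ n) → Bool))
  (υ : ∀ n, Fin (γ n) → Bool) (r r' : ℕ → ℝ) (x x' : ∀ n, Fin n → Bool)

/-- A simulated trial is successful. -/
noncomputable def trialValid (A : NonuniformPPT) {n : ℕ} (g : (Fin n → Bool) → Bool)
    (ω : TrialIndex n (A.coins.eval n) → Bool) : Bool :=
  Bool.xor (ldsFun H υ r r' x x' n (trialSeed g ω, trialOutput A g ω, false))
    (ldsFun H υ r r' x x' n (trialSeed g ω, trialOutput A g ω, true))

variable {H}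

/-- A trial computes the seed with comparators, runs the tableau of the adversary with `1ⁿ` and the
advice hardwired, and tests the output with the circuit of `ldsFun` for both centers. The bound `c`
is uniform in `g`. -/
theorem exists_comp_trial (A : NonuniformPPT) (hH : EfficientlyComputable H) :
    ∃ c, PolyBounded c ∧ ∀ (n : ℕ) (g : (Fin n → Bool) → Bool),
      Comp (Set.range fun (i : Fin n) (u : Fin n → Bool) => u i) (5 * n + 1) {g} →
      Comp (Set.range fun (i : TrialIndex n (A.coins.eval n)) (ω : _ → Bool) => ω i) (c n)
        {trialValid H υ r r' x x' A g} ∧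
      ∀ i : Fin n, Comp (Set.range fun (i : TrialIndex n (A.coins.eval n)) (ω : _ → Bool) => ω i)
        (c n) {fun ω => trialOutput A g ω i} := by
  obtain ⟨cl, hcl, hlds⟩ := exists_comp_ldsFun υ r r' x x' hH
  obtain ⟨Q, hQ⟩ := A.polyTime.exists_comp_emit
  obtain ⟨q, hq⟩ := A.polyLength
  let s : ℕ → ℕ := fun n => n + 1 + ((A.advice n).length + 1) + (n + 1) + (A.coins.eval n + 1)
  have h1 : ∀ {g : ℕ → ℕ}, PolyBounded g → PolyBounded fun n => g n + 1 :=
    fun h => h.add (.const 1)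
  refine ⟨fun n => n * (5 * n + 1) + 2 + Q.eval (s n) + (2 * cl n + 2 * cl n + 8), ?_, ?_⟩
  · refine ((((PolyBounded.id.mul (h1 ((PolyBounded.const 5).mul .id))).add (.const 2)).add
      (PolyBounded.eval_comp Q ?_))).add ((((PolyBounded.const 2).mul hcl).add
        ((PolyBounded.const 2).mul hcl)).add (.const 8))
    exact (((h1 .id).add (h1 ((PolyBounded.eval q).mono hq))).add (h1 .id)).add
      (h1 (PolyBounded.eval _))
  · intro n g hg
    let Ω := TrialIndex n (A.coins.eval n) → Bool
    let B : Set (Ω → Bool) := Set.range fun (i : TrialIndex n (A.coins.eval n)) (ω : Ω) => ω i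
    let B₁ : Set (Ω → Bool) := B ∪ ((Set.range fun (i : Fin n) (ω : Ω) => trialSeed g ω i) ∪
      ({fun _ => true} ∪ {fun _ => false}))
    have hb : ∀ b : Bool, (fun _ : Ω => b) ∈ B₁ := by
      rintro (_ | _) <;> simp [B₁]
    have hB₁ : Comp B (n * (5 * n + 1) + 2) B₁ := by
      refine ((Comp.of_subset (subset_refl B)).union ((Comp.range (c := 5 * n + 1) fun i => ?_).union
        ((Comp.const true).union (Comp.const false)))).mono subset_rfl (by simp) subset_rfl
      refine (hg.comap (B' := B) (fun (ω : Ω) j => ω (.inl (i, j))) ?_).mono subset_rfl le_rfl ?_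
      · rintro _ ⟨j, rfl⟩
        exact ⟨.inl (i, j), rfl⟩
      · rw [Set.image_singleton]
        rfl
    let S : List (Option (Ω → Bool)) :=
      (List.replicate n (some fun _ => true) ++ [none]) ++
      ((A.advice n).map (fun b => some fun _ => b) ++ [none]) ++
      ((List.ofFn fun i : Fin n => some fun ω => trialSeed g ω i) ++ [none]) ++
      ((List.ofFn fun j => some fun ω => ω (.inr j)) ++ [none])
    have hS : S.length = s n := by simp [S, s]; omega
    obtain ⟨-, h2⟩ := hQ Ω B₁ (trialInput A g) S
      (fun ω => by
        simp [encodeStrings, bits, emit, S, trialInput, ones, List.map_ofFn, Function.comp_def])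
      (fun φ hφ => by
        simp only [S, List.mem_append, List.mem_replicate, List.mem_ofFn, List.mem_map,
          Option.some.injEq, List.mem_singleton, reduceCtorEq, or_false] at hφ
        rcases hφ with ((⟨_, rfl⟩ | ⟨a, _, rfl⟩) | ⟨i, rfl⟩) | ⟨j, rfl⟩
        · exact hb true
        · exact hb a
        · exact Or.inr (Or.inl ⟨i, rfl⟩)
        · exact Or.inl ⟨_, rfl⟩)
    rw [hS] at h2
    let C : Set (Ω → Bool) :=
      {φ | ∃ i g', φ = cellWire (fun ω => encodeStrings (A.run (trialInput A g ω))) i g'}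
    have h3 : Comp B (n * (5 * n + 1) + 2 + Q.eval (s n)) (B₁ ∪ C) :=
      (hB₁.trans ((Comp.of_subset (subset_refl B₁)).union h2)).mono subset_rfl (by omega) subset_rfl
    have h4 : ∀ b : Bool, Comp (B₁ ∪ C) (cl n)
        {fun ω => ldsFun H υ r r' x x' n (trialSeed g ω, trialOutput A g ω, b)} := by
      intro b
      refine ((hlds n).comap (B' := B₁ ∪ C) (fun ω => (trialSeed g ω, trialOutput A g ω, b))
        ?_).mono subset_rfl le_rfl ?_
      · intro φ hφ
        simp only [inputWires, Set.mem_ofPred_eq, List.mem_append, List.mem_cons, List.mem_ofFn]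
          at hφ
        rcases hφ with ⟨i, rfl⟩ | rfl | ⟨i, rfl⟩
        · exact Or.inl (Or.inr (Or.inl ⟨i, rfl⟩))
        · exact Or.inl (hb b)
        · exact Or.inr ⟨i, some true, rfl⟩
      · rw [Set.image_singleton]
        rfl
    refine ⟨(h3.trans ((h4 false).xor (h4 true))).mono subset_rfl le_rfl subset_rfl, fun i => ?_⟩
    exact (h3.trans (Comp.mem (B := B₁ ∪ C) (Or.inr ⟨i, some true, rfl⟩))).mono subset_rfl
      (Nat.le_add_right _ _) subset_rfl

end

/-! ### Repeated trials -/

/-- The value of `y` at the first member of the list that satisfies `valid`. -/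
def select {Ω Y : Type} (valid : Ω → Bool) (y : Ω → Y) (d : Y) : List Ω → Y
  | [] => d
  | ω :: l => if valid ω then y ω else select valid y d l

theorem exists_select_eq {Ω Y : Type} (valid : Ω → Bool) (y : Ω → Y) (d : Y) {l : List Ω}
    (h : ∃ ω ∈ l, valid ω = true) : ∃ ω ∈ l, valid ω = true ∧ select valid y d l = y ω := by
  induction l with
  | nil => simp at h
  | cons ω l ih =>
    by_cases hω : valid ω = true
    · exact ⟨ω, by simp, hω, by simp [select, hω]⟩
    · obtain ⟨ω', h1, h2, h3⟩ := ih (by simpa [hω] using h)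
      exact ⟨ω', List.mem_cons_of_mem _ h1, h2, by simp [select, hω, h3]⟩

/-- A chain of multiplexers for every output bit. The trials are recomputed for each bit, which
keeps the size polynomial. -/
theorem Comp.select {ι X : Type} {n c : ℕ} {valid : (ι → Bool) → Bool}
    {y : (ι → Bool) → Fin n → Bool}
    (hv : Comp (Set.range fun (i : ι) (ω : ι → Bool) => ω i) c {valid})
    (hy : ∀ j, Comp (Set.range fun (i : ι) (ω : ι → Bool) => ω i) c {fun ω => y ω j})
    {B : Set (X → Bool)} (l : List (X → ι → Bool)) (hl : ∀ t ∈ l, ∀ i, (fun x => t x i) ∈ B) :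
    Comp B (n * (l.length * (3 * c + 7) + 1))
      (Set.range fun j x => LDS.select valid y (fun _ => false) (l.map (· x)) j) := by
  refine (Comp.range (c := l.length * (3 * c + 7) + 1) fun j => ?_).mono subset_rfl (by simp)
    subset_rfl
  induction l with
  | nil => exact (Comp.const false).mono subset_rfl (by simp) subset_rfl
  | cons t l ih =>
    have hcomap : ∀ {φ : (ι → Bool) → Bool},
        Comp (Set.range fun (i : ι) (ω : ι → Bool) => ω i) c {φ} → Comp B c {fun x => φ (t x)} := by
      intro φ hφ
      refine (hφ.comap (B' := B) t ?_).mono subset_rfl le_rfl ?_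
      · rintro _ ⟨i, rfl⟩
        exact hl t (by simp) i
      · rw [Set.image_singleton]
        rfl
    refine (Comp.ite (hcomap hv) (hcomap (hy j))
      (ih fun t' ht' => hl t' (List.mem_cons_of_mem _ ht'))).mono subset_rfl ?_ ?_
    · rw [List.length_cons]
      nlinarith
    · simp only [Set.singleton_subset_iff, Set.mem_singleton_iff]
      funext x
      simp only [List.map_cons, LDS.select]
      split_ifs <;> rfl

/-! ### Independent blocks of independent trials -/

section

variable {Ω Y : Type} [Fintype Ω] [Nonempty Ω] (valid : Ω → Bool) (y : Ω → Y) (d : Y)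

theorem uprob_forall_not_le (L : ℕ) :
    uprob (fun v : Fin L → Ω => ∀ l, ¬valid (v l) = true) ≤
      Real.exp (-(uprob (fun ω => valid ω = true) * L)) := by
  classical
  rw [uprob_pi fun _ ω => ¬valid ω = true, uprob_not, Finset.prod_const, Finset.card_univ,
    Fintype.card_fin, mul_comm, ← mul_neg, Real.exp_nat_mul]
  refine pow_le_pow_left₀ (sub_nonneg.2 (uprob_le_one _)) ?_ _
  have := Real.add_one_le_exp (-uprob (fun ω => valid ω = true))
  linarith

/-- In `K` blocks of `L` independent trials, every block is successful and the selected values are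
distinct, except with small probability. -/
theorem le_uprob_select_injective (K L : ℕ) {μ : ℝ}
    (hμ : ∀ c, uprob (fun ω => valid ω = true ∧ y ω = c) ≤ μ) :
    1 - (K * Real.exp (-(uprob (fun ω => valid ω = true) * L)) + K * (K * (L * μ))) ≤
      uprob fun W : Fin K → Fin L → Ω => (∀ i, ∃ l, valid (W i l) = true) ∧
        Function.Injective fun i => select valid y d (List.ofFn (W i)) := by
  classical
  have hμ0 : 0 ≤ μ := (uprob_nonneg _).trans (hμ d)
  -- Two values selected in successful blocks can agree only if some successful trial of block `i`
  -- hits the value selected in block `j`; this is union bounded over `i`, `j` and the `L` trials.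
  let bad : (Fin K → Fin L → Ω) → Prop := fun W => (∃ i, ∀ l, ¬valid (W i l) = true) ∨
    ∃ i j, i ≠ j ∧ ∃ l, valid (W i l) = true ∧ y (W i l) = select valid y d (List.ofFn (W j))
  have h1 : uprob bad ≤ K * Real.exp (-(uprob (fun ω => valid ω = true) * L)) +
      K * (K * (L * μ)) := by
    refine (uprob_or_le _ _).trans (add_le_add ?_ ?_)
    · refine (uprob_exists_le _ (b := Real.exp (-(uprob (fun ω => valid ω = true) * L)))
        fun i => ?_).trans (by simp)
      rw [uprob_eval i fun v : Fin L → Ω => ∀ l, ¬valid (v l) = true]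
      exact uprob_forall_not_le valid L
    · refine (uprob_exists_le _ (b := K * (L * μ)) fun i => ?_).trans (by simp)
      refine (uprob_exists_le _ (b := L * μ) fun j => ?_).trans (by simp)
      by_cases hij : i = j
      · have : uprob (fun W : Fin K → Fin L → Ω => i ≠ j ∧ ∃ l, valid (W i l) = true ∧
            y (W i l) = select valid y d (List.ofFn (W j))) = 0 := by simp [uprob, hij]
        rw [this]
        positivity
      · refine (uprob_mono fun W hW => hW.2).trans ?_
        -- With block `j` held fixed its selected value is a constant, while the trials of block `i`
        -- remain uniform, so `hμ` applies to each of them.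
        have := uprob_prod_le (Ω := Fin L → Ω) (Ω' := {k : Fin K // k ≠ j} → Fin L → Ω)
          (fun u W => ∃ l, valid (W ⟨i, hij⟩ l) = true ∧
            y (W ⟨i, hij⟩ l) = select valid y d (List.ofFn u)) (b := L * μ) fun u => by
          rw [uprob_eval (⟨i, hij⟩ : {k : Fin K // k ≠ j}) fun v : Fin L → Ω =>
            ∃ l, valid (v l) = true ∧ y (v l) = select valid y d (List.ofFn u)]
          refine (uprob_exists_le _ (b := μ) fun l => ?_).trans (by simp)
          rw [uprob_eval l fun ω => valid ω = true ∧ y ω = select valid y d (List.ofFn u)]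
          exact hμ _
        rw [← uprob_equiv (Equiv.funSplitAt j (Fin L → Ω))] at this
        exact this
  have h2 : 1 - uprob bad ≤ uprob fun W : Fin K → Fin L → Ω =>
      (∀ i, ∃ l, valid (W i l) = true) ∧
        Function.Injective fun i => select valid y d (List.ofFn (W i)) := by
    rw [← uprob_not]
    refine uprob_mono fun W hW => ?_
    simp only [bad, not_or, not_exists, not_forall, not_not] at hW
    refine ⟨hW.1, fun i j hij => ?_⟩
    by_contra hne
    obtain ⟨l, hl⟩ := hW.1 i
    obtain ⟨ω, hω, hv, he⟩ := exists_select_eq valid y d (l := List.ofFn (W i))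
      ⟨W i l, List.mem_ofFn.2 ⟨l, rfl⟩, hl⟩
    obtain ⟨l', rfl⟩ := List.mem_ofFn.1 hω
    exact hW.2 i j ⟨hne, l', hv, by rw [← he]; exact hij⟩
  linarith

end

end LDS

namespace LDS

/-! ### The distribution of a simulated trial -/

theorem uprob_trialSeed {n : ℕ} (g : (Fin n → Bool) → Bool) (s : Fin n → Bool) :
    uprob (fun u : Fin n × Fin n → Bool => (fun i => g fun j => u (i, j)) = s) =
      ∏ i, uprob fun u => g u = s i := by
  classical
  rw [← uprob_pi fun i u => g u = s i,
    ← uprob_equiv (Equiv.curry (Fin n) (Fin n) Bool) fun v => ∀ i, g (v i) = s i]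
  simp only [funext_iff]
  rfl

/-- The bits of the seed and the adversary use disjoint coins, so the seed has a product
distribution independent of the adversary's coins. -/
theorem uprob_trial {n a : ℕ} (g : (Fin n → Bool) → Bool)
    (R : (Fin n → Bool) → (Fin a → Bool) → Prop) :
    uprob (fun ω : TrialIndex n a → Bool => R (trialSeed g ω) fun j => ω (.inr j)) =
      ∑ s, (∏ i, uprob fun u => g u = s i) * uprob (R s) := by
  classical
  simp only [← uprob_trialSeed]
  rw [← uprob_prod_comp (fun (u : Fin n × Fin n → Bool) i => g fun j => u (i, j)) R,
    ← uprob_equiv (Equiv.sumArrowEquivProdArrow (Fin n × Fin n) (Fin a) Bool)]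
  rfl

/-- The comparator approximates the bias of randomized response. -/
structure Approximates (ε : ℝ) {n : ℕ} (g : (Fin n → Bool) → Bool) : Prop where
  le (s : Fin n → Bool) : (∏ i, flipProb ε (s i)) / 2 ≤ ∏ i, uprob fun u => g u = s i
  ge (s : Fin n → Bool) : ∏ i, (uprob fun u => g u = s i) ≤ 2 * ∏ i, flipProb ε (s i)

/-- Rounding changes the bias by at most `2^(-n) ≤ p / (2n)`. As `p < 1 - p`, both values of a bit
keep their probability up to a relative error `t = 1 / (2n)`, and over `n` bits `(1 - t)^n ≥ 1/2` by
Bernoulli and `(1 + t)^n ≤ e^(1/2) ≤ 2`. -/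
theorem approximates_of_uprob_eq {ε : ℝ} (hε : 0 < ε) {n : ℕ} (hn : 1 ≤ n)
    (h2 : 2 * (n : ℝ) ≤ flipProb ε true * 2 ^ n) {g : (Fin n → Bool) → Bool}
    (hg : uprob (fun u => g u = true) = (⌊flipProb ε true * 2 ^ n⌋₊ : ℝ) / 2 ^ n) :
    Approximates ε g := by
  set p := flipProb ε true with hp
  have hp0 : 0 < p := flipProb_pos ε true
  have hp2 : p < 1 / 2 := flipProb_true_lt ε hε
  have hn' : (1 : ℝ) ≤ n := by exact_mod_cast hn
  have hpow : (0 : ℝ) < 2 ^ n := by positivity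
  have hgf : uprob (fun u => g u = false) = 1 - uprob (fun u => g u = true) := by
    rw [← uprob_not]
    simp
  set t : ℝ := 1 / (2 * n) with ht
  have ht0 : 0 < t := by positivity
  have ht2 : t ≤ 1 / 2 := by
    rw [ht, div_le_div_iff₀ (by positivity) (by norm_num)]
    linarith
  have hnt : n * t = 1 / 2 := by
    rw [ht]
    field_simp
  have hinv : 1 / 2 ^ n ≤ p * t := by
    rw [ht, mul_one_div, div_le_div_iff₀ hpow (by positivity)]
    linarith
  have hle : uprob (fun u => g u = true) ≤ p := by
    rw [hg, div_le_iff₀ hpow]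
    exact Nat.floor_le (by positivity)
  have hge : p - p * t ≤ uprob (fun u => g u = true) := by
    have h1 : p * 2 ^ n < ⌊p * 2 ^ n⌋₊ + 1 := Nat.lt_floor_add_one _
    have h3 : p ≤ (⌊p * 2 ^ n⌋₊ : ℝ) / 2 ^ n + 1 / 2 ^ n := by
      rw [← add_div, le_div_iff₀ hpow]
      exact h1.le
    rw [hg]
    linarith
  have hb : ∀ b, (1 - t) * flipProb ε b ≤ uprob (fun u => g u = b) ∧
      uprob (fun u => g u = b) ≤ (1 + t) * flipProb ε b := by
    rintro (_ | _)
    · rw [hgf, flipProb_false, ← hp]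
      constructor <;> nlinarith
    · rw [← hp]
      constructor <;> nlinarith
  constructor
  · intro s
    have h1 : (1 : ℝ) / 2 ≤ (1 - t) ^ n := by
      have := one_add_mul_le_pow (a := -t) (by linarith) n
      rw [← sub_eq_add_neg] at this
      linarith
    calc (∏ i, flipProb ε (s i)) / 2 = 1 / 2 * ∏ i, flipProb ε (s i) := by ring
      _ ≤ (1 - t) ^ n * ∏ i, flipProb ε (s i) :=
        mul_le_mul_of_nonneg_right h1 (Finset.prod_nonneg fun i _ => (flipProb_pos ε _).le)
      _ = ∏ i, (1 - t) * flipProb ε (s i) := by simp [Finset.prod_mul_distrib]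
      _ ≤ _ := Finset.prod_le_prod
        (fun i _ => mul_nonneg (by linarith) (flipProb_pos ε _).le) fun i _ => (hb _).1
  · intro s
    have h1 : (1 + t) ^ n ≤ 2 := by
      have h3 : (1 + t) ^ n ≤ Real.exp t ^ n :=
        pow_le_pow_left₀ (by linarith) (by linarith [Real.add_one_le_exp t]) n
      rw [← Real.exp_nat_mul, hnt] at h3
      have h4 : Real.exp (1 / 2) ^ 2 ≤ 2 ^ 2 := by
        rw [← Real.exp_nat_mul]
        norm_num
        linarith [Real.exp_one_lt_d9]
      exact h3.trans (le_of_sq_le_sq h4 (by norm_num))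
    calc ∏ i, (uprob fun u => g u = s i) ≤ ∏ i, (1 + t) * flipProb ε (s i) :=
        Finset.prod_le_prod (fun i _ => uprob_nonneg _) fun i _ => (hb _).2
      _ = (1 + t) ^ n * ∏ i, flipProb ε (s i) := by simp [Finset.prod_mul_distrib]
      _ ≤ _ :=
        mul_le_mul_of_nonneg_right h1 (Finset.prod_nonneg fun i _ => (flipProb_pos ε _).le)

section

variable {γ : ℕ → ℕ} {H : ∀ n, (Fin n → Bool) → (Fin (γ n) → Bool)}
  {υ : ∀ n, Fin (γ n) → Bool} {r r' : ℕ → ℝ} {x x' : ∀ n, Fin n → Bool}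

/-- A simulated trial succeeds about as often as the adversary. -/
theorem differProb_le {S : Sampler fun n => n} (hS : IsLDSSampler H υ r r' x x' S)
    (A : NonuniformPPT) {ε : ℝ} {n : ℕ} {g : (Fin n → Bool) → Bool} (hg : Approximates ε g) :
    differProb S n (randomizedResponse ε fun _ : Fin n => false) A ≤
      2 * uprob fun ω => trialValid H υ r r' x x' A g ω = true := by
  have h1 : uprob (fun ω : TrialIndex n (A.coins.eval n) → Bool => ∃ z : Fin n → Bool,
      A.run (trialInput A g ω) = [bits z] ∧
        (S n (trialSeed g ω)).1.eval z ≠ (S n (trialSeed g ω)).2.eval z) ≤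
      uprob fun ω => trialValid H υ r r' x x' A g ω = true := by
    refine uprob_mono ?_
    rintro ω ⟨z, hz, hne⟩
    have e1 : ldsFun H υ r r' x x' n (trialSeed g ω, z, false) =
        (S n (trialSeed g ω)).1.eval z := by
      rw [Bool.eq_iff_iff, (hS n _).1 z]
      simp [ldsFun]
    have e2 : ldsFun H υ r r' x x' n (trialSeed g ω, z, true) =
        (S n (trialSeed g ω)).2.eval z := by
      rw [Bool.eq_iff_iff, (hS n _).2 z]
      simp [ldsFun]
    rw [trialValid, trialOutput_eq hz, e1, e2]
    revert hne
    cases (S n (trialSeed g ω)).1.eval z <;> cases (S n (trialSeed g ω)).2.eval z <;> simp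
  refine le_trans ?_ (mul_le_mul_of_nonneg_left h1 (by norm_num))
  have h2 := uprob_trial (a := A.coins.eval n) g fun s ρ => ∃ z : Fin n → Bool,
    A.run [ones n, A.advice n, bits s, bits ρ] = [bits z] ∧ (S n s).1.eval z ≠ (S n s).2.eval z
  simp only [trialInput]
  rw [h2, Finset.mul_sum, differProb]
  refine Finset.sum_le_sum fun s _ => ?_
  rw [randomizedResponse_toReal, coinProb_eq_uprob, ← mul_assoc]
  refine mul_le_mul_of_nonneg_right ?_ (uprob_nonneg _)
  linarith [hg.le s]

/-- No string is the output of a successful trial with large probability. -/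
theorem uprob_trialOutput_le (A : NonuniformPPT) {ε : ℝ} (hε : 0 < ε) {n : ℕ}
    (hadj : hammingDist (x n) (x' n) = 1) {g : (Fin n → Bool) → Bool} (hg : Approximates ε g)
    {l : ℝ} (hl : 0 ≤ l) (hl1 : l ≤ 1) (c : Fin n → Bool) :
    uprob (fun ω => trialValid H υ r r' x x' A g ω = true ∧ trialOutput A g ω = c) ≤
      2 * Real.exp (l * r' n - l * (flipProb ε true * n + (1 - 2 * flipProb ε true) * (r n - 1)) +
        n * l ^ 2) := by
  classical
  -- Within distance `r - 1` of `x` a point lies in both balls of radius `r`, and outside the ball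
  -- around `x̃` it lies in neither set; in both cases the two indicators agree.
  have key : ∀ ω : TrialIndex n (A.coins.eval n) → Bool,
      trialValid H υ r r' x x' A g ω = true → trialOutput A g ω = c →
      r n - 1 ≤ hammingDist (x n) c ∧
        (hammingDist (xorBits (x n) (trialSeed g ω)) c : ℝ) ≤ r' n := by
    intro ω hv hc
    rw [trialValid, hc] at hv
    constructor
    · by_contra hlt
      rw [not_le] at hlt
      have h1 : (hammingDist (x' n) c : ℝ) ≤ 1 + hammingDist (x n) c := by
        have := hammingDist_triangle (x' n) (x n) c
        rw [hammingDist_comm (x' n) (x n), hadj] at this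
        exact_mod_cast this
      have b1 : c ∈ ball (x n) (r n) := by
        simp only [ball, Set.mem_ofPred_eq]
        linarith
      have b2 : c ∈ ball (x' n) (r n) := by
        simp only [ball, Set.mem_ofPred_eq]
        linarith
      simp [ldsFun, ldsSet, b1, b2] at hv
    · by_contra hlt
      have b1 : c ∉ ball (xorBits (x n) (trialSeed g ω)) (r' n) := hlt
      simp [ldsFun, ldsSet, b1] at hv
  by_cases hfar : r n - 1 ≤ hammingDist (x n) c
  · have h1 : uprob (fun ω => trialValid H υ r r' x x' A g ω = true ∧ trialOutput A g ω = c) ≤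
        uprob fun ω : TrialIndex n (A.coins.eval n) → Bool =>
          (hammingDist (xorBits (x n) (trialSeed g ω)) c : ℝ) ≤ r' n :=
      uprob_mono fun ω hω => (key ω hω.1 hω.2).2
    have h2 := uprob_trial (a := A.coins.eval n) g fun s _ =>
      (hammingDist (xorBits (x n) s) c : ℝ) ≤ r' n
    have h3 : ∀ s, uprob (fun _ : Fin (A.coins.eval n) → Bool =>
        (hammingDist (xorBits (x n) s) c : ℝ) ≤ r' n) =
        if (hammingDist (xorBits (x n) s) c : ℝ) ≤ r' n then 1 else 0 := by
      intro s
      unfold uprob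
      by_cases hs : (hammingDist (xorBits (x n) s) c : ℝ) ≤ r' n <;> simp [hs]
    have h4 := sum_flipProb_ball_le ε (x n) c (r' n) l hl hl1
    refine (h1.trans_eq h2).trans ?_
    calc _ ≤ ∑ s : Fin n → Bool, (2 * ∏ i, flipProb ε (s i)) *
          (if (hammingDist (xorBits (x n) s) c : ℝ) ≤ r' n then 1 else 0) := by
          refine Finset.sum_le_sum fun s _ => ?_
          rw [h3]
          exact mul_le_mul_of_nonneg_right (hg.ge s) (by split_ifs <;> simp)
      _ = 2 * ∑ s : Fin n → Bool, (∏ i, flipProb ε (s i)) *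
          (if (hammingDist (xorBits (x n) s) c : ℝ) ≤ r' n then 1 else 0) := by
          rw [Finset.mul_sum]
          exact Finset.sum_congr rfl fun s _ => mul_assoc _ _ _
      _ ≤ _ := by
          refine mul_le_mul_of_nonneg_left (h4.trans (Real.exp_le_exp.2 ?_)) (by norm_num)
          have hp : 0 ≤ 1 - 2 * flipProb ε true := by linarith [flipProb_true_lt ε hε]
          have := mul_le_mul_of_nonneg_left (mul_le_mul_of_nonneg_left hfar hp) hl
          linarith
  · have h1 : uprob (fun ω => trialValid H υ r r' x x' A g ω = true ∧ trialOutput A g ω = c) ≤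
        uprob fun _ : TrialIndex n (A.coins.eval n) → Bool => False :=
      uprob_mono fun ω hω => hfar (key ω hω.1 hω.2).1
    refine h1.trans ?_
    have : uprob (fun _ : TrialIndex n (A.coins.eval n) → Bool => False) = 0 := by simp [uprob]
    rw [this]
    positivity

/-- Both sets are contained in the fiber over `υ n`, so the outputs of all successful trials
collide. -/
theorem hash_eq_of_trialValid {A : NonuniformPPT} {n : ℕ} {g : (Fin n → Bool) → Bool}
    {ω : TrialIndex n (A.coins.eval n) → Bool}
    (h : trialValid H υ r r' x x' A g ω = true) : H n (trialOutput A g ω) = υ n := by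
  by_contra hne
  simp [trialValid, ldsFun, ldsSet, hne] at h

end

/-! ### Asymptotics -/

open Filter Topology Asymptotics

/-- Turns polynomial bounds into pure powers of `n`, the form in which `IsCRKHF` prescribes advice
lengths; constants are absorbed by a further factor `n`. -/
theorem PolyBounded.eventually_le_pow {g : ℕ → ℕ} (hg : PolyBounded g) :
    ∃ d : ℕ, ∀ᶠ n in atTop, g n ≤ n ^ d := by
  obtain ⟨p, hp⟩ := hg
  suffices h : ∃ d : ℕ, ∀ᶠ n : ℕ in atTop, p.eval n ≤ n ^ d by
    obtain ⟨d, hd⟩ := h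
    exact ⟨d, hd.mono fun n hn => (hp n).trans hn⟩
  clear hp
  induction p using Polynomial.induction_on' with
  | add p q hp hq =>
    obtain ⟨d, hd⟩ := hp
    obtain ⟨e, he⟩ := hq
    refine ⟨max d e + 1, ?_⟩
    filter_upwards [hd, he, eventually_ge_atTop 2] with n h1 h2 h3
    have h4 : n ^ d ≤ n ^ max d e := Nat.pow_le_pow_right (by omega) (le_max_left _ _)
    have h5 : n ^ e ≤ n ^ max d e := Nat.pow_le_pow_right (by omega) (le_max_right _ _)
    rw [Polynomial.eval_add, pow_succ]
    nlinarith
  | monomial k a =>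
    refine ⟨k + 1, ?_⟩
    filter_upwards [eventually_ge_atTop a] with n hn
    rw [Polynomial.eval_monomial, pow_succ, mul_comm]
    exact Nat.mul_le_mul_left _ hn

theorem exists_frequently_of_not_superpolynomialDecay {f : ℕ → ℝ} (hf : ∀ n, 0 ≤ f n)
    (h : ¬SuperpolynomialDecay atTop (fun n : ℕ => (n : ℝ)) f) :
    ∃ k : ℕ, ∃ᶠ n : ℕ in atTop, 1 ≤ (n : ℝ) ^ k * f n := by
  by_contra hcon
  simp only [not_exists, not_frequently, not_le] at hcon
  refine h fun k => ?_
  refine squeeze_zero' (Eventually.of_forall fun n => mul_nonneg (by positivity) (hf n)) ?_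
    tendsto_one_div_atTop_nhds_zero_nat
  filter_upwards [hcon (k + 1), eventually_gt_atTop 0] with n h1 h2
  have h3 : (0 : ℝ) < n := by exact_mod_cast h2
  rw [le_div_iff₀ h3]
  rw [pow_succ] at h1
  linarith

/-- Polynomially many strings collide with negligible probability. -/
theorem tendsto_pow_mul_exp {p : ℝ} (hp : p < 1 / 2) (M : ℕ) :
    Tendsto (fun n : ℕ => (n : ℝ) ^ M * Real.exp (
      (n : ℝ) ^ (-0.3 : ℝ) * (p * n + (n : ℝ) ^ (0.6 : ℝ)) -
      (n : ℝ) ^ (-0.3 : ℝ) * (p * n + (1 - 2 * p) * (0.5 * (n : ℝ) ^ (0.9 : ℝ) - 1)) +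
      n * ((n : ℝ) ^ (-0.3 : ℝ)) ^ 2)) atTop (𝓝 0) := by
  set c : ℝ := (1 - 2 * p) / 2 with hc
  have hc0 : 0 < c := by rw [hc]; linarith
  have h1 : Tendsto (fun n : ℕ => (n : ℝ) ^ M * Real.exp (-(n : ℝ) ^ (0.5 : ℝ))) atTop (𝓝 0) := by
    have h2 := Real.tendsto_pow_mul_exp_neg_atTop_nhds_zero (2 * M)
    have h3 : Tendsto (fun n : ℕ => (n : ℝ) ^ (0.5 : ℝ)) atTop atTop :=
      (tendsto_rpow_atTop (by norm_num)).comp tendsto_natCast_atTop_atTop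
    refine (h2.comp h3).congr fun n => ?_
    simp only [Function.comp_apply]
    rw [pow_mul, ← Real.rpow_natCast _ 2, ← Real.rpow_mul (by positivity)]
    norm_num
  -- The exponent is `n^0.3 - c n^0.6 + 2c n^(-0.3) + n^0.4`. Its positive terms are at most `(2 +
  -- 2c) n^0.5`, so for these `n` it is below `-n^0.5`.
  have h4 : ∀ᶠ n : ℕ in atTop, (4 + 2 * c) / c ≤ (n : ℝ) ^ (0.1 : ℝ) :=
    ((tendsto_rpow_atTop (by norm_num)).comp tendsto_natCast_atTop_atTop).eventually_ge_atTop _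
  refine squeeze_zero' (Eventually.of_forall fun n => by positivity) ?_ h1
  filter_upwards [h4, eventually_ge_atTop 1] with n hn hn1
  have hn1 : (1 : ℝ) ≤ n := by exact_mod_cast hn1
  have hn0 : (0 : ℝ) < n := by linarith
  refine mul_le_mul_of_nonneg_left (Real.exp_le_exp.2 ?_) (by positivity)
  have e1 : (n : ℝ) ^ (-0.3 : ℝ) * (n : ℝ) ^ (0.6 : ℝ) = (n : ℝ) ^ (0.3 : ℝ) := by
    rw [← Real.rpow_add hn0]; norm_num
  have e2 : (n : ℝ) ^ (-0.3 : ℝ) * (n : ℝ) ^ (0.9 : ℝ) = (n : ℝ) ^ (0.6 : ℝ) := by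
    rw [← Real.rpow_add hn0]; norm_num
  have e3 : n * ((n : ℝ) ^ (-0.3 : ℝ)) ^ 2 = (n : ℝ) ^ (0.4 : ℝ) := by
    nth_rewrite 1 [← Real.rpow_one (n : ℝ)]
    rw [← Real.rpow_natCast _ 2, ← Real.rpow_mul hn0.le, ← Real.rpow_add hn0]
    norm_num
  have e4 : (n : ℝ) ^ (0.5 : ℝ) * (n : ℝ) ^ (0.1 : ℝ) = (n : ℝ) ^ (0.6 : ℝ) := by
    rw [← Real.rpow_add hn0]; norm_num
  have i1 : (n : ℝ) ^ (0.3 : ℝ) ≤ (n : ℝ) ^ (0.5 : ℝ) :=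
    Real.rpow_le_rpow_of_exponent_le hn1 (by norm_num)
  have i2 : (n : ℝ) ^ (0.4 : ℝ) ≤ (n : ℝ) ^ (0.5 : ℝ) :=
    Real.rpow_le_rpow_of_exponent_le hn1 (by norm_num)
  have i3 : (n : ℝ) ^ (-0.3 : ℝ) ≤ (n : ℝ) ^ (0.5 : ℝ) :=
    Real.rpow_le_rpow_of_exponent_le hn1 (by norm_num)
  have i4 : (4 + 2 * c) * (n : ℝ) ^ (0.5 : ℝ) ≤ c * (n : ℝ) ^ (0.6 : ℝ) := by
    rw [div_le_iff₀ hc0] at hn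
    rw [← e4]
    have : (0 : ℝ) ≤ (n : ℝ) ^ (0.5 : ℝ) := by positivity
    nlinarith
  have i5 : (0 : ℝ) ≤ (n : ℝ) ^ (0.5 : ℝ) := by positivity
  rw [e3]
  have e5 : (1 - 2 * p) = 2 * c := by rw [hc]; ring
  have e6 : (n : ℝ) ^ (-0.3 : ℝ) * (p * n + (n : ℝ) ^ (0.6 : ℝ)) -
      (n : ℝ) ^ (-0.3 : ℝ) * (p * n + (1 - 2 * p) * (0.5 * (n : ℝ) ^ (0.9 : ℝ) - 1)) =
      (n : ℝ) ^ (0.3 : ℝ) - c * (n : ℝ) ^ (0.6 : ℝ) + 2 * c * (n : ℝ) ^ (-0.3 : ℝ) := by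
    rw [e5, ← e1]
    nth_rewrite 3 [← e2]
    ring
  rw [e6]
  have i6 : 2 * c * (n : ℝ) ^ (-0.3 : ℝ) ≤ 2 * c * (n : ℝ) ^ (0.5 : ℝ) :=
    mul_le_mul_of_nonneg_left i3 (by linarith)
  linarith

theorem tendsto_natCast_pow_mul_exp_neg (m : ℕ) :
    Tendsto (fun n : ℕ => (n : ℝ) ^ m * Real.exp (-(n : ℝ))) atTop (𝓝 0) :=
  (Real.tendsto_pow_mul_exp_neg_atTop_nhds_zero m).comp tendsto_natCast_atTop_atTop

theorem eventually_mul_pow_lt_two_pow (m : ℕ) {C : ℝ} (hC : 0 < C) :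
    ∀ᶠ n : ℕ in atTop, C * (n : ℝ) ^ m < 2 ^ n := by
  have h := tendsto_pow_const_div_const_pow_of_one_lt m (one_lt_two (α := ℝ))
  filter_upwards [h.eventually_lt_const (show 0 < 1 / C by positivity)] with n hn
  rw [div_lt_div_iff₀ (by positivity) hC] at hn
  linarith

end LDS

namespace LDS

/-! ### From an adversary against the sampler to multi-collisions -/

section

variable {γ : ℕ → ℕ} {H : ∀ n, (Fin n → Bool) → (Fin (γ n) → Bool)}
  {υ : ∀ n, Fin (γ n) → Bool} {r r' : ℕ → ℝ} {x x' : ∀ n, Fin n → Bool}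

variable (H υ r r' x x') in
/-- The output of the first successful trial. -/
noncomputable def blockOutput (A : NonuniformPPT) {n L : ℕ} (g : (Fin n → Bool) → Bool)
    (v : Fin L → TrialIndex n (A.coins.eval n) → Bool) : Fin n → Bool :=
  select (trialValid H υ r r' x x' A g) (trialOutput A g) (fun _ => false) (List.ofFn v)

-- A block of `L` trials as one straight-line program on `M` coins. The length bound `q` depends
-- neither on `g` nor on how often the block will be repeated.
variable (υ r r' x x') in
theorem exists_block_program (A : NonuniformPPT) (hH : EfficientlyComputable H) {L : ℕ → ℕ}
    (hL : PolyBounded L) :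
    ∃ M q : ℕ → ℕ, PolyBounded M ∧ PolyBounded q ∧ ∀ (n : ℕ) (g : (Fin n → Bool) → Bool),
      Comp (Set.range fun (i : Fin n) (u : Fin n → Bool) => u i) (5 * n + 1) {g} →
      ∃ (e : Fin (L n) × TrialIndex n (A.coins.eval n) → Fin (M n)) (P : List Op),
        Function.Injective e ∧ P.length ≤ q n ∧ NoCounter P ∧
        ∀ β I N O a, ∃ N' a', P.foldl Op.exec ⟨(bits β).map some ++ I, N, [], O, a⟩ =
          ⟨I, N', [], emit (List.ofFn fun j => some fun β : Fin (M n) → Bool =>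
            blockOutput H υ r r' x x' A g (fun l i => β (e (l, i))) j) β ++ O, a'⟩ := by
  obtain ⟨c, hc, hcomp⟩ := exists_comp_trial υ r r' x x' A hH
  let M : ℕ → ℕ := fun n => L n * (n * n + A.coins.eval n)
  let C : ℕ → ℕ := fun n => n * (L n * (3 * c n + 7) + 1)
  have hM : PolyBounded M := hL.mul ((PolyBounded.id.mul .id).add (PolyBounded.eval _))
  have hC : PolyBounded C := PolyBounded.id.mul
    ((hL.mul (((PolyBounded.const 3).mul hc).add (.const 7))).add (.const 1))
  refine ⟨M, fun n => 2 * M n + C n * (4 * (C n + M n) + 4) + n * (2 * (C n + M n) + 2), hM, ?_, ?_⟩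
  · exact (((PolyBounded.const 2).mul hM).add (hC.mul (((PolyBounded.const 4).mul
      (hC.add hM)).add (.const 4)))).add (PolyBounded.id.mul (((PolyBounded.const 2).mul
      (hC.add hM)).add (.const 2)))
  · intro n g hg
    obtain ⟨hv, hy⟩ := hcomp n g hg
    have hcard : Fintype.card (Fin (L n) × TrialIndex n (A.coins.eval n)) = M n := by simp [M]
    let e := Fintype.equivFinOfCardEq hcard
    have h1 := hv.select hy (B := Set.range fun (i : Fin (M n)) (β : Fin (M n) → Bool) => β i)
      (List.ofFn fun l β i => β (e (l, i))) (by
        intro t ht i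
        obtain ⟨l, rfl⟩ := List.mem_ofFn.1 ht
        exact ⟨e (l, i), rfl⟩)
    obtain ⟨P, hP, hP', hrun⟩ := Comp.exists_program (m := M n) (c := C n)
      (List.ofFn fun j => some fun β : Fin (M n) → Bool =>
        blockOutput H υ r r' x x' A g (fun l i => β (e (l, i))) j) (by
      refine h1.mono subset_rfl (by simp [C]) ?_
      intro φ hφ
      simp only [Set.mem_ofPred_eq, List.mem_ofFn, Option.some.injEq] at hφ
      obtain ⟨j, rfl⟩ := hφ
      refine ⟨j, ?_⟩
      funext β
      simp only [blockOutput, List.map_ofFn]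
      rfl)
    exact ⟨e, P, e.injective, hP.trans (by simp), hP', hrun⟩

/-- One program, repeated by the counter on disjoint blocks of coins, realizes `K` independent
blocks of trials; each successful block outputs a preimage of `υ n`, and distinct ones form a
multi-collision. -/
theorem le_coinProb_isMultiCollision {f : List (List Bool) → List (List Bool)}
    (hf : ∀ l, encodeStrings (f l) = evaluate (encodeStrings l)) (A : NonuniformPPT) {n L M : ℕ}
    {g : (Fin n → Bool) → Bool} {e : Fin L × TrialIndex n (A.coins.eval n) → Fin M}
    (he : Function.Injective e) {P : List Op} (hP : NoCounter P)
    (hrun : ∀ β I N O a, ∃ N' a', P.foldl Op.exec ⟨(bits β).map some ++ I, N, [], O, a⟩ =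
      ⟨I, N', [], emit (List.ofFn fun j => some fun β : Fin M → Bool =>
        blockOutput H υ r r' x x' A g (fun l i => β (e (l, i))) j) β ++ O, a'⟩)
    (pad w K m : ℕ) (hK : 0 < K) (hw : K < 2 ^ w) (hm : K * (M + 1) ≤ m) :
    (uprob fun W : Fin K → Fin L → TrialIndex n (A.coins.eval n) → Bool =>
      (∀ i, ∃ l, trialValid H υ r r' x x' A g (W i l) = true) ∧
        Function.Injective fun i => blockOutput H υ r r' x x' A g (W i)) ≤
    coinProb m fun ρ => IsMultiCollision H n K
      (f [ones n, adviceOf w K P ++ List.replicate pad true, bits ρ]) := by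
  classical
  have hlt : ∀ (i : Fin K) (j : Fin M), (i.rev : ℕ) * (M + 1) + j < m := by
    intro i j
    have h1 : ((i.rev : ℕ) + 1) * (M + 1) ≤ K * (M + 1) :=
      Nat.mul_le_mul_right _ (Nat.succ_le_of_lt i.rev.2)
    have h2 := j.2
    nlinarith
  -- The coin behind each bit of each trial: output string `i` comes from block `i.rev`, and blocks
  -- have stride `M + 1`. Injectivity makes the trials jointly uniform.
  let J : Fin K × Fin L × TrialIndex n (A.coins.eval n) → Fin m := fun s =>
    ⟨(s.1.rev : ℕ) * (M + 1) + e s.2, hlt _ _⟩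
  have hJ : Function.Injective J := by
    rintro ⟨i, s⟩ ⟨i', s'⟩ h
    have h0 : (i.rev : ℕ) * (M + 1) + e s = (i'.rev : ℕ) * (M + 1) + e s' := congrArg Fin.val h
    have h1 : (e s : ℕ) < M + 1 := (e s).2.trans (Nat.lt_succ_self M)
    have h2 : (e s' : ℕ) < M + 1 := (e s').2.trans (Nat.lt_succ_self M)
    have h3 : (i.rev : ℕ) = i'.rev := by
      have := congrArg (· / (M + 1)) h0
      simpa [Nat.add_div_of_dvd_right, Nat.mul_add_div, mul_comm, Nat.div_eq_of_lt h1,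
        Nat.div_eq_of_lt h2] using this
    have h4 : (e s : ℕ) = e s' := by rw [h3] at h0; omega
    exact Prod.ext (Fin.rev_injective (Fin.ext h3)) (he (Fin.ext h4))
  let Ev : (Fin K → Fin L → TrialIndex n (A.coins.eval n) → Bool) → Prop := fun W =>
    (∀ i, ∃ l, trialValid H υ r r' x x' A g (W i l) = true) ∧
      Function.Injective fun i => blockOutput H υ r r' x x' A g (W i)
  let E : (Fin K × Fin L × TrialIndex n (A.coins.eval n) → Bool) ≃
      (Fin K → Fin L → TrialIndex n (A.coins.eval n) → Bool) :=
    (Equiv.curry _ _ _).trans (Equiv.arrowCongr (Equiv.refl _) (Equiv.curry _ _ _))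
  have h1 : uprob Ev = uprob fun ρ : Fin m → Bool => Ev (E (ρ ∘ J)) := by
    rw [← uprob_equiv E Ev, ← uprob_comp_injective J hJ fun u => Ev (E u)]
  rw [coinProb_eq_uprob]
  refine h1.trans_le (uprob_mono fun ρ hρ => ?_)
  rw [eval_program_repeat hf hP _ hrun n pad w K hK hw (bits ρ) (by simpa [bits] using hm)]
  have hblock : ∀ i : Fin K, (fun (l : Fin L) (s : TrialIndex n (A.coins.eval n)) =>
      coinBlock M (bits ρ) i.rev (e (l, s))) = E (ρ ∘ J) i := by
    intro i
    funext l s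
    have := hlt i (e (l, s))
    simp only [coinBlock, bits, List.getD_eq_getElem?_getD, List.getElem?_ofFn, this, dite_true]
    rfl
  refine ⟨fun i => blockOutput H υ r r' x x' A g (E (ρ ∘ J) i), ?_, hρ.2, ?_⟩
  · congr 1
    funext i
    exact congrArg (fun v => bits (blockOutput H υ r r' x x' A g v)) (hblock i)
  · have : ∀ i, H n (blockOutput H υ r r' x x' A g (E (ρ ∘ J) i)) = υ n := by
      intro i
      obtain ⟨l, hl⟩ := hρ.1 i
      obtain ⟨ω, -, hω, hsel⟩ := exists_select_eq (trialValid H υ r r' x x' A g) (trialOutput A g)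
        (fun _ => false) (l := List.ofFn (E (ρ ∘ J) i)) ⟨_, List.mem_ofFn.2 ⟨l, rfl⟩, hl⟩
      rw [blockOutput, hsel]
      exact hash_eq_of_trialValid hω
    intro i j
    rw [this, this]

end

open Filter Topology Asymptotics

/-- The parameters are chosen in the order of the quantifiers: `k` from the adversary, the number
`L` of trials and the program, the advice exponent, and only then `c₂`, `K` and the number of coins.
-/
theorem superpolynomialDecay_differProb {γ : ℕ → ℕ}
    {H : ∀ n, (Fin n → Bool) → (Fin (γ n) → Bool)} (hH : IsCRKHF H) {ε : ℝ} (hε : 0 < ε)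
    {r r' : ℕ → ℝ} (hr : ∀ n : ℕ, r n = 0.5 * (n : ℝ) ^ (0.9 : ℝ))
    (hr' : ∀ n : ℕ, r' n = 1 / (1 + Real.exp ε) * n + (n : ℝ) ^ (0.6 : ℝ))
    {x x' : ∀ n, Fin n → Bool} (hadj : ∀ n, 1 ≤ n → hammingDist (x n) (x' n) = 1)
    {υ : ∀ n, Fin (γ n) → Bool} {S : Sampler fun n => n} (hS : IsLDSSampler H υ r r' x x' S)
    (A : NonuniformPPT) :
    SuperpolynomialDecay atTop (fun n : ℕ => (n : ℝ)) fun n =>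
      differProb S n (randomizedResponse ε fun _ : Fin n => false) A := by
  set p := flipProb ε true with hp
  have hp0 : 0 < p := flipProb_pos ε true
  have hp2 : p < 1 / 2 := flipProb_true_lt ε hε
  by_contra hcon
  obtain ⟨k, hk⟩ := exists_frequently_of_not_superpolynomialDecay (fun n =>
    Finset.sum_nonneg fun θ _ => mul_nonneg ENNReal.toReal_nonneg (by
      rw [coinProb_eq_uprob]; exact uprob_nonneg _)) hcon
  have hfloor : ∀ n : ℕ, ⌊p * 2 ^ n⌋₊ ≤ 2 ^ n := by
    intro n
    refine Nat.floor_le_of_le ?_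
    push_cast
    have : (0 : ℝ) < 2 ^ n := by positivity
    nlinarith
  choose g hg hgp using fun n => exists_comparator n _ (hfloor n)
  -- A trial succeeds with probability `δ ≥ 1 / (2 n^k)`, the factor 2 being lost in simulating the
  -- seed; hence `δ * L ≥ n`, and a block fails with probability at most `e^(-n)`.
  let L : ℕ → ℕ := fun n => 2 * n ^ (k + 1)
  have hpow : ∀ d : ℕ, PolyBounded fun n => n ^ d := fun d => ⟨Polynomial.X ^ d, by simp⟩
  have hL : PolyBounded L := (PolyBounded.const 2).mul (hpow _)
  obtain ⟨M, q, hM, hq, hprog⟩ := exists_block_program υ r r' x x' A hH.1 hL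
  choose e P he hPq hP hrun using fun n => hprog n (g n) (hg n)
  obtain ⟨f, hf, hfe⟩ := exists_polyTime_evaluate
  -- The advice length allows for a counter of `n` digits, whatever `K` will be. The exponent `d +
  -- 1` is used below because `c₁` must be positive.
  obtain ⟨d, hd⟩ := ((PolyBounded.const 12).mul (hq.add .id)).eventually_le_pow
  obtain ⟨c₂, hc₂, hcr⟩ := hH.2 ((d + 1 : ℕ) : ℝ) (by positivity)
  let K : ℕ → ℕ := fun n => ⌈(n : ℝ) ^ c₂⌉₊
  have hKle : ∀ n, K n ≤ n ^ ⌈c₂⌉₊ := by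
    intro n
    rcases Nat.eq_zero_or_pos n with rfl | hn
    · simp [K, Real.zero_rpow hc₂.ne']
    · refine Nat.ceil_le.2 ?_
      push_cast
      rw [← Real.rpow_natCast]
      exact Real.rpow_le_rpow_of_exponent_le (by exact_mod_cast hn) (Nat.le_ceil _)
  have hKpos : ∀ n, 1 ≤ n → 0 < K n := fun n hn =>
    Nat.ceil_pos.2 (Real.rpow_pos_of_pos (by exact_mod_cast hn) _)
  obtain ⟨coins, hcoins⟩ := ((hpow ⌈c₂⌉₊).mono hKle).mul (hM.add (.const 1))
  have hζ : ∀ n : ℕ, ⌈(n : ℝ) ^ ((d + 1 : ℕ) : ℝ)⌉₊ = n ^ (d + 1) := by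
    intro n
    rw [Real.rpow_natCast, ← Nat.cast_pow, Nat.ceil_natCast]
  -- Padding and truncation give exactly the prescribed length for every `n`; truncation has no
  -- effect once `12 * (q n + n) ≤ n ^ d`, that is, for all large `n`.
  let z : ℕ → List Bool := fun n =>
    (adviceOf n (K n) (P n) ++ List.replicate (n ^ (d + 1) - (adviceOf n (K n) (P n)).length)
      true).take (n ^ (d + 1))
  have hz : ∀ n, (z n).length = ⌈(n : ℝ) ^ ((d + 1 : ℕ) : ℝ)⌉₊ := by
    intro n
    rw [hζ]
    simp [z]
    omega
  obtain ⟨negl, hnegl, hbound⟩ := hcr ⟨f, hf, coins⟩ z hz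
  have hneglt : Tendsto negl atTop (𝓝 0) := by simpa using hnegl.2 0
  set μ : ℕ → ℝ := fun n => Real.exp (
      (n : ℝ) ^ (-0.3 : ℝ) * (p * n + (n : ℝ) ^ (0.6 : ℝ)) -
      (n : ℝ) ^ (-0.3 : ℝ) * (p * n + (1 - 2 * p) * (0.5 * (n : ℝ) ^ (0.9 : ℝ) - 1)) +
      n * ((n : ℝ) ^ (-0.3 : ℝ)) ^ 2) with hμ
  set m := ⌈c₂⌉₊ with hm
  -- Each of the two failure probabilities is kept below `1/4`; in the second, `L * (2 * μ)`
  -- contributes a factor 4, hence `1/16`. The collision probability is then at least `1/2`, against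
  -- `negl n < 1/2`.
  have ev1 := (tendsto_natCast_pow_mul_exp_neg m).eventually_lt_const
    (show (0 : ℝ) < 1 / 4 by norm_num)
  have ev2 := (tendsto_pow_mul_exp hp2 (2 * m + (k + 1))).eventually_lt_const
    (show (0 : ℝ) < 1 / 16 by norm_num)
  have ev3 := eventually_mul_pow_lt_two_pow m one_pos
  have ev4 := eventually_mul_pow_lt_two_pow 1 (show 0 < 2 / p by positivity)
  have ev5 := hneglt.eventually_lt_const (show (0 : ℝ) < 1 / 2 by norm_num)
  obtain ⟨n, hδ, h1, h2, h3, h4, h5, h6, hn⟩ := (hk.and_eventually (ev1.and (ev2.and (ev3.and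
    (ev4.and (ev5.and (hd.and (eventually_ge_atTop 1)))))))).exists
  have hn' : (1 : ℝ) ≤ n := by exact_mod_cast hn
  have happ : Approximates ε (g n) := by
    refine approximates_of_uprob_eq hε hn ?_ (hgp n)
    rw [pow_one, div_mul_eq_mul_div, div_lt_iff₀ hp0] at h4
    linarith
  have hl1 : (n : ℝ) ^ (-0.3 : ℝ) ≤ 1 := Real.rpow_le_one_of_one_le_of_nonpos hn' (by norm_num)
  have hcoll : ∀ c, uprob (fun ω => trialValid H υ r r' x x' A (g n) ω = true ∧
      trialOutput A (g n) ω = c) ≤ 2 * μ n := by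
    intro c
    have := uprob_trialOutput_le (H := H) (υ := υ) (r := r) (r' := r') A hε (hadj n hn) happ
      (by positivity) hl1 c
    rw [hr, hr'] at this
    exact this
  have hsucc := le_uprob_select_injective (trialValid H υ r r' x x' A (g n)) (trialOutput A (g n))
    (fun _ => false) (K n) (L n) hcoll
  have hKn : (K n : ℝ) ≤ (n : ℝ) ^ m := by exact_mod_cast hKle n
  have hKlt : K n < 2 ^ n := by
    have : (K n : ℝ) < 2 ^ n := by linarith
    exact_mod_cast this
  have hadv : z n = adviceOf n (K n) (P n) ++
      List.replicate (n ^ (d + 1) - (adviceOf n (K n) (P n)).length) true := by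
    have hle : (adviceOf n (K n) (P n)).length ≤ n ^ (d + 1) := by
      refine (length_adviceOf_le _ _ _).trans ((Nat.mul_le_mul_left 12
        (Nat.add_le_add_right (hPq n) n)).trans (h6.trans ?_))
      exact Nat.pow_le_pow_right hn (Nat.le_succ d)
    refine List.take_of_length_le ?_
    simp
    omega
  have hfin := (hsucc.trans (le_coinProb_isMultiCollision hfe A (he n) (hP n) (hrun n)
    (n ^ (d + 1) - (adviceOf n (K n) (P n)).length) n (K n) (coins.eval n) (hKpos n hn) hKlt
    (hcoins n)))
  rw [← hadv] at hfin
  have hlast := hfin.trans (hbound n)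
  have hδ' := differProb_le hS A happ
  set δ := uprob fun ω => trialValid H υ r r' x x' A (g n) ω = true with hδdef
  have hδL : (n : ℝ) ≤ δ * L n := by
    have e1 : δ * (L n : ℝ) = n * (n ^ k * (2 * δ)) := by
      simp only [L]
      push_cast
      ring
    rw [e1]
    have : 1 ≤ (n : ℝ) ^ k * (2 * δ) :=
      hδ.trans (mul_le_mul_of_nonneg_left hδ' (by positivity))
    nlinarith
  have t1 : K n * Real.exp (-(δ * L n)) ≤ 1 / 4 :=
    (mul_le_mul hKn (Real.exp_le_exp.2 (neg_le_neg hδL)) (Real.exp_pos _).le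
      (by positivity)).trans h1.le
  have hμ0 : 0 ≤ μ n := (Real.exp_pos _).le
  have t2 : K n * (K n * (L n * (2 * μ n))) ≤ 1 / 4 := by
    have e2 : (L n : ℝ) * (2 * μ n) = 4 * ((n : ℝ) ^ (k + 1) * μ n) := by
      simp only [L]
      push_cast
      ring
    have h2' : (n : ℝ) ^ (2 * m + (k + 1)) * μ n < 1 / 16 := h2
    rw [e2]
    calc (K n : ℝ) * (K n * (4 * ((n : ℝ) ^ (k + 1) * μ n)))
        ≤ (n : ℝ) ^ m * ((n : ℝ) ^ m * (4 * ((n : ℝ) ^ (k + 1) * μ n))) := by gcongr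
      _ = 4 * ((n : ℝ) ^ (2 * m + (k + 1)) * μ n) := by ring
      _ ≤ 1 / 4 := by linarith
  linarith

end LDS

/-! ### The sampler is efficient and a public-coin differing-inputs sampler -/

theorem lemma2 {γ : ℕ → ℕ} (H : ∀ n, (Fin n → Bool) → (Fin (γ n) → Bool)) (hH : LDS.IsCRKHF H)
    (ε : ℝ) (hε : 0 < ε) (r r' : ℕ → ℝ)
    (hr : ∀ n : ℕ, r n = 0.5 * (n : ℝ) ^ (0.9 : ℝ))
    (hr' : ∀ n : ℕ, r' n = 1 / (1 + Real.exp ε) * n + (n : ℝ) ^ (0.6 : ℝ))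
    (x x' : ∀ n, Fin n → Bool) (hadj : ∀ n, 1 ≤ n → hammingDist (x n) (x' n) = 1)
    (υ : ∀ n, Fin (γ n) → Bool) :
    (∃ S : LDS.Sampler fun n => n, LDS.IsLDSSampler H υ r r' x x' S ∧ S.Efficient) ∧
    ∀ S : LDS.Sampler fun n => n, LDS.IsLDSSampler H υ r r' x x' S → S.Efficient →
      LDS.IsPublicCoinDISampler (fun n => LDS.randomizedResponse ε (fun _ : Fin n => false))
        (LDS.ldsCircuits H υ r r') S := by
  -- The negligible bound is the differing probability itself.
  refine ⟨LDS.exists_efficient_sampler υ r r' x x' hH.1, fun S hS hSe => ⟨hSe, fun n θ _ =>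
    ⟨⟨_, _, (hS n θ).1⟩, ⟨_, _, (hS n θ).2⟩⟩, fun A => ⟨_, ⟨fun n => ?_,
      LDS.superpolynomialDecay_differProb hH hε hr hr' hadj hS A⟩, fun n => le_rfl⟩⟩⟩
  refine Finset.sum_nonneg fun θ _ => mul_nonneg ENNReal.toReal_nonneg ?_
  rw [LDS.coinProb_eq_uprob]
  exact LDS.uprob_nonneg _
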